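/- **Setting.** Let $\mu$ be the normalized surface measure on $\mathbb S^2$ ($\mu(\mathbb S^2)=1$), let $P_\ell(x)=\frac{1}{2^\ell\ell!}\frac{d^\ell}{dx^\ell}(x^2-1)^\ell$, and let $Y_{\ell,m}$ ($\ell\ge 0$, $-\ell\le m\le\ell$) be the complex spherical harmonics $Y_{\ell,m}(\theta,\varphi)=\sqrt{\frac{(2\ell+1)(\ell-m)!}{(\ell+m)!}}\,(-1)^m(\sin\theta)^mP_\ell^{(m)}(\cos\theta)e^{im\varphi}$ for $m\ge 0$ and $Y_{\ell,m}=(-1)^m\overline{Y_{\ell,-m}}$ for $m<0$; they are orthonormal in $L_2(\mathbb S^2,\mu)$. Put $\lambda_\ell=\ell(\ell+1)$ and $\widehat f_{\ell,m}=\int_{\mathbb S^2} f\,\overline{Y_{\ell,m}}\,d\mu$. Let $0<\alpha\le 1$, $\tau>0$, $E_\alpha(z)=\sum_{k\ge0}z^k/\Gamma(\alpha k+1)$, and $\sigma^2_{\ell,t,\alpha}=\int_0^tE_\alpha(-\lambda_\ell r^\alpha)^2\,dr$. On a probability space $(\Omega,\mathcal F,\mathbb P)$ a (real) random field on $\mathbb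 S^2$ is a jointly measurable function $\Omega\times\mathbb S^2\to\mathbb R$. It is *Gaussian* if its values at any finitely many points are jointly Gaussian (possibly degenerate); *2-weakly isotropic* if all its values have finite second moments and its first and second moments $\mathbb E[\xi(x)]$, $\mathbb E[\xi(x)\xi(y)]$ are invariant under $SO(3)$; and *strongly isotropic* if all its finite-dimensional distributions are invariant under $SO(3)$. Let $\xi\in L_2(\Omega\times\mathbb S^2)$ be a centred, 2-weakly isotropic Gaussian random field with angular power spectrum $\mathcal C_\ell=\mathbb E|\widehat\xi_{\ell,m}|^2$ (which does not depend on $m$), $\sum_\ell(2\ell+1)\mathcal C_\ell<\infty$. Let $W_\tau(t)$, $t\ge\tau$, be a $Q$-Wiener process in the real space $L_2(\mathbb S^2)$ started at time $\tau$: $W_\tau(\tau)=0$, continuous paths (a.s.), independent increments, and $W_\tau(t)-W_\tau(s)\sim\mathcal N(0,(t-s)Q)$ for $t\ge s\ge\tau$, where $Q$ is a bounded positive self-adjoint operator with $QY_{\ell,m}=\mathcal A_\ell Y_{\ell,m}$ for all $\ell,m$ (in the sense of real and imaginary parts), $\mathcal A_\ell\ge0$, $\sum_\ell(2\ell+1)\mathcal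 A_\ell<\infty$. Let $\xi$ and $W_\tau$ be independent. Write $\widehat W_{\ell,m,0}(s)$, $s\ge0$, for the $(\ell,m)$ Fourier coefficient of $W_\tau(\tau+s)$. For $t>0$ put $$\widehat{U^H}_{\ell,m}(t)=E_\alpha(-\lambda_\ell t^\alpha)\,\widehat\xi_{\ell,m},\qquad \widehat{U^I}_{\ell,m}(t)=\begin{cases}0,&t\le\tau,\\ \int_0^{t-\tau}E_\alpha(-\lambda_\ell(t-\tau-s)^\alpha)\,d\widehat W_{\ell,m,0}(s),&t>\tau\end{cases}$$ (a Wiener integral), and let $$U(t)=U^H(t)+U^I(t),\quad U^H(t)=\sum_{\ell=0}^\infty\sum_{m=-\ell}^{\ell}\widehat{U^H}_{\ell,m}(t)Y_{\ell,m},\quad U^I(t)=\sum_{\ell=0}^\infty\sum_{m=-\ell}^{\ell}\widehat{U^I}_{\ell,m}(t)Y_{\ell,m},$$ the solution of the time-fractional equation $dU-D_t^{1-\alpha}\Delta_{\mathbb S^2}U\,dt=\mathbf 1_{\{t\ge\tau\}}\,dW_\tau$, $U(0)=\xi$, where the sums are taken in $L_2(\Omega\times\mathbb S^2)$. **Proposition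 5.1.** Fix $t\in(0,\infty)$. Both series converge in $L_2(\Omega\times\mathbb S^2)$ to random fields. Moreover: 1. There is a random field $V$ that is, at each point $x\in\mathbb S^2$, the $L_2(\Omega)$-sum of the expansion of $U(t)$, i.e. $V(x)=\sum_{\ell}\sum_{m}\big(\widehat{U^H}_{\ell,m}(t)+\widehat{U^I}_{\ell,m}(t)\big)Y_{\ell,m}(x)$. Every such $V$ coincides with $U(t)$ $\mathbb P\otimes\mu$-almost everywhere, lies in $L_2(\Omega\times\mathbb S^2)$, and is a centred, 2-weakly isotropic (hence strongly isotropic) Gaussian random field on $\mathbb S^2$. 2. For all $\ell\ge0$, $-\ell\le m\le\ell$, the random coefficient $\widehat U_{\ell,m}(t)=\int_{\mathbb S^2}U(t)\overline{Y_{\ell,m}}\,d\mu$ is square integrable, has mean zero, and almost surely $$\widehat U_{\ell,m}(t)=\begin{cases}\widehat{U^H}_{\ell,m}(t),&t\le\tau,\\ \widehat{U^H}_{\ell,m}(t)+\widehat{U^I}_{\ell,m}(t),&t>\tau.\end{cases}$$ 3. For all $\ell,\ell'\ge0$, $-\ell\le m\le\ell$, $-\ell'\le m'\le\ell'$, $$\mathbb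 E\big[\widehat U_{\ell,m}(t)\overline{\widehat U_{\ell',m'}(t)}\big]=\delta_{\ell\ell'}\delta_{mm'}\begin{cases}\mathcal C_\ell\,E_\alpha(-\lambda_\ell t^\alpha)^2,&t\le\tau,\\ \mathcal C_\ell\,E_\alpha(-\lambda_\ell t^\alpha)^2+\mathcal A_\ell\,\sigma^2_{\ell,t-\tau,\alpha},&t>\tau.\end{cases}$$ -/

import Mathlib

open MeasureTheory ProbabilityTheory Filter Topology
open scoped ComplexConjugate NNReal ENNReal

namespace SphereDiffusion

/-! ### The sphere, its rotations and its normalized surface measure -/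

/-- Euclidean three-space. -/
abbrev E3 : Type := EuclideanSpace ℝ (Fin 3)

/-- The two-dimensional unit sphere in Euclidean three-space. -/
abbrev S2 : Type := Metric.sphere (0 : E3) 1

/-- The normalized surface measure on the sphere (total mass one). -/
noncomputable def sphereMeasure : Measure S2 :=
  ((volume : Measure E3).toSphere Set.univ)⁻¹ • (volume : Measure E3).toSphere

instance isProbabilityMeasure_sphereMeasure : IsProbabilityMeasure sphereMeasure := by
  refine ⟨?_⟩
  rw [sphereMeasure, Measure.smul_apply, smul_eq_mul]
  refine ENNReal.inv_mul_cancel ?_ (measure_ne_top _ _)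
  exact Measure.measure_univ_ne_zero.mpr (Measure.toSphere_ne_zero _)

/-- The point `R x` of the sphere, for a linear isometry `R` of three-space. -/
noncomputable def rotate (R : E3 ≃ₗᵢ[ℝ] E3) (x : S2) : S2 :=
  ⟨R (x : E3), by simp⟩

/-- `R` belongs to the rotation group `SO(3)`. -/
def IsRotation (R : E3 ≃ₗᵢ[ℝ] E3) : Prop :=
  LinearMap.det (R.toLinearEquiv : E3 →ₗ[ℝ] E3) = 1

/-! ### Spherical harmonics -/

/-- The Legendre polynomial `P_ℓ(t) = 2^{-ℓ} / ℓ! · (d/dt)^ℓ (t² - 1)^ℓ`. -/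
noncomputable def legendre (ℓ : ℕ) : Polynomial ℝ :=
  Polynomial.C ((2 ^ ℓ * (ℓ.factorial : ℝ))⁻¹) *
    (Polynomial.derivative^[ℓ] ((Polynomial.X ^ 2 - 1) ^ ℓ))

/-- The spherical harmonic `Y_{ℓ,m}` for `m ≥ 0`.  As `(sin θ)^m e^{i m φ} = (x₁ + i x₂)^m` and
`cos θ = x₃`, the usual expression
`√((2ℓ+1) (ℓ-m)! / (ℓ+m)!) · (-1)^m (1 - cos² θ)^{m/2} P_ℓ^{(m)}(cos θ) · e^{i m φ}`
is the following polynomial in the Euclidean coordinates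
(see `sphericalHarmonicNat_of_angles`). -/
noncomputable def sphericalHarmonicNat (ℓ m : ℕ) (x : S2) : ℂ :=
  ((Real.sqrt ((2 * ℓ + 1) * ((ℓ - m).factorial : ℝ) / ((ℓ + m).factorial : ℝ)) *
      ((-1) ^ m * (Polynomial.derivative^[m] (legendre ℓ)).eval ((x : E3) 2)) : ℝ) : ℂ) *
    (((x : E3) 0 : ℂ) + Complex.I * ((x : E3) 1 : ℂ)) ^ m

/-- The complex spherical harmonics `Y_{ℓ,m}`, `-ℓ ≤ m ≤ ℓ`, with
`Y_{ℓ,m} = (-1)^m conj Y_{ℓ,-m}` for `m < 0`. -/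
noncomputable def sphericalHarmonic (ℓ : ℕ) (m : ℤ) (x : S2) : ℂ :=
  if 0 ≤ m then sphericalHarmonicNat ℓ m.natAbs x
  else (-1) ^ m.natAbs * conj (sphericalHarmonicNat ℓ m.natAbs x)

/-- The expression of `Y_{ℓ,m}` in spherical coordinates. -/
theorem sphericalHarmonicNat_of_angles (ℓ m : ℕ) (x : S2) (θ φ : ℝ)
    (hθ : θ ∈ Set.Icc 0 Real.pi)
    (h0 : (x : E3) 0 = Real.sin θ * Real.cos φ)
    (h1 : (x : E3) 1 = Real.sin θ * Real.sin φ) (h2 : (x : E3) 2 = Real.cos θ) :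
    sphericalHarmonicNat ℓ m x =
      ((Real.sqrt ((2 * ℓ + 1) * ((ℓ - m).factorial : ℝ) / ((ℓ + m).factorial : ℝ)) *
        ((-1) ^ m * (1 - Real.cos θ ^ 2) ^ ((m : ℝ) / 2) *
          (Polynomial.derivative^[m] (legendre ℓ)).eval (Real.cos θ)) : ℝ) : ℂ) *
        Complex.exp (Complex.I * m * φ) := by
  have hs : 0 ≤ Real.sin θ := Real.sin_nonneg_of_mem_Icc hθ
  have e1 : (1 - Real.cos θ ^ 2) ^ ((m : ℝ) / 2) = Real.sin θ ^ m := by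
    have : 1 - Real.cos θ ^ 2 = Real.sin θ ^ 2 := by rw [Real.sin_sq]
    rw [this, ← Real.rpow_natCast (Real.sin θ) 2, ← Real.rpow_mul hs,
      ← Real.rpow_natCast (Real.sin θ) m]
    congr 1
    push_cast
    ring
  have e2 : (((x : E3) 0 : ℂ) + Complex.I * ((x : E3) 1 : ℂ)) ^ m
      = ((Real.sin θ ^ m : ℝ) : ℂ) * Complex.exp (Complex.I * m * φ) := by
    have : (((x : E3) 0 : ℂ) + Complex.I * ((x : E3) 1 : ℂ))
        = (Real.sin θ : ℂ) * Complex.exp (φ * Complex.I) := by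
      rw [h0, h1, Complex.exp_mul_I]
      push_cast
      ring
    rw [this, mul_pow, ← Complex.exp_nat_mul]
    push_cast
    congr 2
    ring
  rw [sphericalHarmonicNat, e2, e1, h2]
  push_cast
  ring

theorem continuous_sphericalHarmonic (ℓ : ℕ) (m : ℤ) : Continuous (sphericalHarmonic ℓ m) := by
  have h : Continuous (sphericalHarmonicNat ℓ m.natAbs) := by
    unfold sphericalHarmonicNat
    have c : ∀ i : Fin 3, Continuous fun x : S2 => (x : E3) i := fun i => by fun_prop
    have := c 0
    have := c 1
    have := c 2
    fun_prop
  unfold sphericalHarmonic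
  split_ifs
  · exact h
  · exact continuous_const.mul (Complex.continuous_conj.comp h)

/-- The eigenvalue `λ_ℓ = ℓ (ℓ + 1)` of the negative Laplace-Beltrami operator. -/
def eigenvalue (ℓ : ℕ) : ℝ := ℓ * (ℓ + 1)

/-- The Fourier coefficient `∫ f conj(Y_{ℓ,m}) dμ` of a real function on the sphere. -/
noncomputable def sphericalCoeff (f : S2 → ℝ) (ℓ : ℕ) (m : ℤ) : ℂ :=
  ∫ x, (f x : ℂ) * conj (sphericalHarmonic ℓ m x) ∂sphereMeasure

/-- The real Hilbert space of square integrable real functions on the sphere. -/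
abbrev L2S : Type := Lp ℝ 2 sphereMeasure

noncomputable instance : MeasurableSpace L2S := borel _

instance : BorelSpace L2S := ⟨rfl⟩

/-- The real part of `Y_{ℓ,m}` as an element of the real `L²` space. -/
noncomputable def harmonicRe (ℓ : ℕ) (m : ℤ) : L2S :=
  ContinuousMap.toLp 2 sphereMeasure ℝ
    ⟨fun x => (sphericalHarmonic ℓ m x).re,
      Complex.continuous_re.comp (continuous_sphericalHarmonic ℓ m)⟩

/-- The imaginary part of `Y_{ℓ,m}` as an element of the real `L²` space. -/
noncomputable def harmonicIm (ℓ : ℕ) (m : ℤ) : L2S :=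
  ContinuousMap.toLp 2 sphereMeasure ℝ
    ⟨fun x => (sphericalHarmonic ℓ m x).im,
      Complex.continuous_im.comp (continuous_sphericalHarmonic ℓ m)⟩

/-! ### The Mittag-Leffler function -/

/-- The two-parametric Mittag-Leffler function at a real argument. -/
noncomputable def mittagLeffler₂ (α β z : ℝ) : ℝ :=
  ∑' k : ℕ, z ^ k / Real.Gamma (α * k + β)

/-- The classical Mittag-Leffler function `E_α = E_{α,1}`. -/
noncomputable def mittagLeffler (α z : ℝ) : ℝ := mittagLeffler₂ α 1 z

/-- `σ²_{ℓ,t,α} = ∫₀ᵗ E_α(-λ_ℓ r^α)² dr`. -/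
noncomputable def sigmaSq (ℓ : ℕ) (t α : ℝ) : ℝ :=
  ∫ r in (0 : ℝ)..t, mittagLeffler α (-eigenvalue ℓ * r ^ α) ^ 2

section Fields

variable {Ω : Type*} [MeasurableSpace Ω]

/-! ### Random fields on the sphere -/

/-- A (jointly measurable, real-valued) random field on the sphere. -/
def IsRandomField (ξ : S2 → Ω → ℝ) : Prop :=
  Measurable fun p : Ω × S2 => ξ p.2 p.1

/-- The field, as a function on `Ω × S²`, is square integrable. -/
def IsSquareIntegrable (P : Measure Ω) (ξ : S2 → Ω → ℝ) : Prop :=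
  MemLp (fun p : Ω × S2 => ξ p.2 p.1) 2 (P.prod sphereMeasure)

/-- The field is centred. -/
def IsCentred (P : Measure Ω) (ξ : S2 → Ω → ℝ) : Prop :=
  ∀ x, Integrable (ξ x) P ∧ ∫ ω, ξ x ω ∂P = 0

/-- `2`-weak isotropy: finite second moments, rotation invariant first and second moments. -/
def IsTwoWeaklyIsotropic (P : Measure Ω) (ξ : S2 → Ω → ℝ) : Prop :=
  (∀ x, MemLp (ξ x) 2 P) ∧
  ∀ R : E3 ≃ₗᵢ[ℝ] E3, IsRotation R →
    (∀ x, ∫ ω, ξ x ω ∂P = ∫ ω, ξ (rotate R x) ω ∂P) ∧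
    ∀ x y, ∫ ω, ξ x ω * ξ y ω ∂P = ∫ ω, ξ (rotate R x) ω * ξ (rotate R y) ω ∂P

/-- Strong isotropy: the finite-dimensional distributions are rotation invariant. -/
def IsStronglyIsotropic (P : Measure Ω) (ξ : S2 → Ω → ℝ) : Prop :=
  ∀ R : E3 ≃ₗᵢ[ℝ] E3, IsRotation R → ∀ (k : ℕ) (x : Fin k → S2),
    P.map (fun ω i => ξ (x i) ω) = P.map (fun ω i => ξ (rotate R (x i)) ω)

/-- The Fourier coefficients of a random field, which are complex random variables. -/
noncomputable def randomCoeff (ξ : S2 → Ω → ℝ) (ℓ : ℕ) (m : ℤ) (ω : Ω) : ℂ :=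
  sphericalCoeff (fun x => ξ x ω) ℓ m

/-- The angular power spectrum `C_ℓ = E |ξ̂_{ℓ,m}|²` of an isotropic field.  The value does not
depend on `m`; it is taken at `m = 0`. -/
noncomputable def angularPowerSpectrum (P : Measure Ω) (ξ : S2 → Ω → ℝ) (ℓ : ℕ) : ℝ :=
  ∫ ω, ‖randomCoeff ξ ℓ 0 ω‖ ^ 2 ∂P

/-! ### Expansions in spherical harmonics with random coefficients -/

/-- The partial sum `∑_{ℓ ≤ L} ∑_{|m| ≤ ℓ} a_{ℓ,m}(ω) Y_{ℓ,m}(x)`. -/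
noncomputable def partialSum (a : ℕ → ℤ → Ω → ℂ) (L : ℕ) (x : S2) (ω : Ω) : ℂ :=
  ∑ ℓ ∈ Finset.range (L + 1), ∑ m ∈ Finset.Icc (-(ℓ : ℤ)) ℓ, a ℓ m ω * sphericalHarmonic ℓ m x

/-- The random field `V` is the sum `∑ a_{ℓ,m} Y_{ℓ,m}` in `L²(Ω × S²)`. -/
def IsL2Sum (P : Measure Ω) (a : ℕ → ℤ → Ω → ℂ) (V : S2 → Ω → ℝ) : Prop :=
  IsRandomField V ∧ IsSquareIntegrable P V ∧
  Tendsto (fun L : ℕ =>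
      eLpNorm (fun p : Ω × S2 => partialSum a L p.2 p.1 - (V p.2 p.1 : ℂ)) 2
        (P.prod sphereMeasure)) atTop (𝓝 0)

/-- The random field `V` is, at every point of the sphere, the sum `∑ a_{ℓ,m} Y_{ℓ,m}(x)`
in `L²(Ω)`. -/
def IsPointwiseSum (P : Measure Ω) (a : ℕ → ℤ → Ω → ℂ) (V : S2 → Ω → ℝ) : Prop :=
  IsRandomField V ∧
  ∀ x, Tendsto (fun L : ℕ => eLpNorm (fun ω => partialSum a L x ω - (V x ω : ℂ)) 2 P)
    atTop (𝓝 0)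

/-! ### The noise -/

/-- A `Q`-Wiener process in the real space `L²(S²)`, started at time `τ`.  The last clause says
that `W t - W s` has the Gaussian law `N(0, (t - s) Q)`. -/
structure IsQWiener (P : Measure Ω) (τ : ℝ) (Q : L2S →L[ℝ] L2S) (W : ℝ → Ω → L2S) : Prop where
  isPositive : Q.IsPositive
  measurable : ∀ t, τ ≤ t → Measurable (W t)
  start : ∀ᵐ ω ∂P, W τ ω = 0
  continuous : ∀ᵐ ω ∂P, ContinuousOn (fun t => W t ω) (Set.Ici τ)
  indep : HasIndepIncrements (fun (t : Set.Ici τ) ω => W t ω) P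
  law : ∀ s t, τ ≤ s → s ≤ t → ∀ f : L2S,
    HasLaw (fun ω => inner ℝ f (W t ω - W s ω))
      (gaussianReal 0 (Real.toNNReal ((t - s) * inner ℝ (Q f) f))) P

/-- `Q Y_{ℓ,m} = A_ℓ Y_{ℓ,m}` for all `ℓ, m`, written for real and imaginary parts. -/
def HasHarmonicSpectrum (Q : L2S →L[ℝ] L2S) (A : ℕ → ℝ) : Prop :=
  ∀ (ℓ : ℕ) (m : ℤ), m ∈ Finset.Icc (-(ℓ : ℤ)) ℓ →
    Q (harmonicRe ℓ m) = A ℓ • harmonicRe ℓ m ∧ Q (harmonicIm ℓ m) = A ℓ • harmonicIm ℓ m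

/-- The coefficient `Ŵ_{ℓ,m,0}(s)` of the noise, with the clock started at the switching time:
`Ŵ_{ℓ,m,0}(s) = Ŵ_{ℓ,m,τ}(τ + s)`. -/
noncomputable def noiseCoeff (τ : ℝ) (W : ℝ → Ω → L2S) (ℓ : ℕ) (m : ℤ) (s : ℝ) (ω : Ω) : ℂ :=
  sphericalCoeff (W (τ + s) ω) ℓ m

/-! ### Wiener integrals -/

/-- A step function on `(0, T]`: the value `c i` on `(s i, s (i + 1)]` for `i < n`. -/
structure Step (T : ℝ) where
  n : ℕ
  s : ℕ → ℝ
  c : ℕ → ℝ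
  mono : Monotone s
  mem : ∀ i, s i ∈ Set.Icc 0 T

/-- The step function itself. -/
noncomputable def Step.toFun {T : ℝ} (h : Step T) (u : ℝ) : ℝ :=
  ∑ i ∈ Finset.range h.n, (Set.Ioc (h.s i) (h.s (i + 1))).indicator (fun _ => h.c i) u

/-- The integral of a step function against a process. -/
noncomputable def Step.integral {T : ℝ} (h : Step T) (B : ℝ → Ω → ℂ) (ω : Ω) : ℂ :=
  ∑ i ∈ Finset.range h.n, (h.c i : ℂ) * (B (h.s (i + 1)) ω - B (h.s i) ω)

/-- `X` is the Wiener integral `∫₀ᵀ g dB`: the `L²(Ω)` limit of the integrals of step functions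
that converge to `g` in `L²([0, T])`. -/
def IsWienerIntegral (P : Measure Ω) (T : ℝ) (g : ℝ → ℝ) (B : ℝ → Ω → ℂ) (X : Ω → ℂ) : Prop :=
  MemLp X 2 P ∧ ∃ h : ℕ → Step T,
    Tendsto (fun k => eLpNorm (fun u => (h k).toFun u - g u) 2
      (volume.restrict (Set.Icc 0 T))) atTop (𝓝 0) ∧
    Tendsto (fun k => eLpNorm (fun ω => (h k).integral B ω - X ω) 2 P) atTop (𝓝 0)

open Classical in
/-- The Wiener integral `∫₀ᵀ g dB` (a version of it; zero if there is none). -/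
noncomputable def wienerIntegral (P : Measure Ω) (T : ℝ) (g : ℝ → ℝ) (B : ℝ → Ω → ℂ) : Ω → ℂ :=
  if h : ∃ X, IsWienerIntegral P T g B X then h.choose else 0

/-! ### The coefficients of the two parts of the solution -/

/-- `E_α(-λ_ℓ t^α) ξ̂_{ℓ,m}`, the coefficients of the homogeneous solution at time `t`. -/
noncomputable def homCoeff (α t : ℝ) (ξ : S2 → Ω → ℝ) (ℓ : ℕ) (m : ℤ) (ω : Ω) : ℂ :=
  (mittagLeffler α (-eigenvalue ℓ * t ^ α) : ℂ) * randomCoeff ξ ℓ m ω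

/-- The coefficients of the inhomogeneous solution at time `t`: zero for `t ≤ τ`, and
`∫₀^{t-τ} E_α(-λ_ℓ (t - τ - s)^α) dŴ_{ℓ,m,0}(s)` for `t > τ`. -/
noncomputable def inhomCoeff (P : Measure Ω) (α τ t : ℝ) (W : ℝ → Ω → L2S) (ℓ : ℕ) (m : ℤ)
    (ω : Ω) : ℂ :=
  if t ≤ τ then 0
  else wienerIntegral P (t - τ)
    (fun s => mittagLeffler α (-eigenvalue ℓ * (t - τ - s) ^ α)) (noiseCoeff τ W ℓ m) ω

end Fields

end SphereDiffusion

/-! At time `t` the coefficients of `U` form a family of pairwise uncorrelated variables whose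
variance `v ℓ` depends on the degree only (`IsSpectralFamily`). Given this, the addition theorem
`harmonicKernel_eq` does most of the work: the sum over `m` of `Y_{ℓ,m}(x) conj Y_{ℓ,m}(y)` is
`(2ℓ+1) P_ℓ(⟨x,y⟩)`. On the diagonal this is `2ℓ+1`, so the `L²(Ω)` norm of a block of the expansion
does not depend on `x`, and `∑ (2ℓ+1) v ℓ < ∞` gives convergence uniformly in `x`, hence also in
`L²(Ω × S²)`. Off the diagonal it shows that the covariance of the sum depends on `⟨x,y⟩` only,
which is weak isotropy.

That the coefficients of `ξ` are uncorrelated is Schur's lemma, proved by hand in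
`sesqForm_harmonic`: rotations about the third axis kill pairs of different order, and
differentiating along rotations about the first axis gives ladder relations that kill pairs of
different degree and equate the diagonal values. The same lemma, applied to the surface measure
instead of the covariance kernel, gives orthonormality of the harmonics.

For the noise, the covariance of `W` makes each coefficient a complex process with covariance `A ℓ
min(s, t)`, and the Wiener isometry `HasBrownianCov.integral_wiener` turns it into `A ℓ σ²`.
Independence and centredness remove the cross terms. Summability of the resulting variances needs `0
≤ E_α(-x) ≤ 1`. This is obtained by realizing `E_α(-x)` as a limit of power series coefficients of
`(1-z)^(-1) / (1 + μ (1-z)^(-α))`, whose bounds follow from two convolution recursions.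

Gaussianity comes from one closed subspace of `L²(Ω)`, generated by all `ξ x` and all `⟨f, W s⟩`.
Its elements are centred Gaussian because characteristic functions are continuous in `L²`; it
contains the real and imaginary parts of all coefficients and hence every `V x`. Inside it
covariances determine joint laws, so weak isotropy implies strong isotropy. -/

namespace SphereDiffusion

/-! ### Bounds for the Mittag-Leffler function -/

/-- The coefficient of `z ^ n` in the binomial series of `(1 - z) ^ (-a)`. -/
noncomputable def binomCoeff (a : ℝ) : ℕ → ℝ
  | 0 => 1
  | n + 1 => binomCoeff a n * ((a + n) / (n + 1))

theorem binomCoeff_succ (a : ℝ) (n : ℕ) :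
    binomCoeff a (n + 1) = binomCoeff a n * ((a + n) / (n + 1)) := rfl

theorem succ_mul_binomCoeff_succ (a : ℝ) (n : ℕ) :
    ((n : ℝ) + 1) * binomCoeff a (n + 1) = (a + n) * binomCoeff a n := by
  rw [binomCoeff_succ]
  have : (n : ℝ) + 1 ≠ 0 := by positivity
  field_simp

/-- Compares coefficients in `(1-z)^(-a) (1-z)^(-b) = (1-z)^(-(a+b))`. -/
theorem binomCoeff_add (a b : ℝ) (n : ℕ) :
    ∑ p ∈ Finset.HasAntidiagonal.antidiagonal n, binomCoeff a p.1 * binomCoeff b p.2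
      = binomCoeff (a + b) n := by
  induction n with
  | zero => simp [binomCoeff]
  | succ n ih =>
    have hn : (n : ℝ) + 1 ≠ 0 := by positivity
    apply mul_left_cancel₀ hn
    rw [succ_mul_binomCoeff_succ, ← ih, Finset.mul_sum, Finset.mul_sum]
    -- On the antidiagonal `n + 1 = p.1 + p.2`. Each of the two parts loses its zero term and is
    -- shifted down by one, where the recursion of `succ_mul_binomCoeff_succ` applies.
    have h1 : ∑ p ∈ Finset.HasAntidiagonal.antidiagonal (n + 1),
        ((n : ℝ) + 1) * (binomCoeff a p.1 * binomCoeff b p.2)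
        = ∑ p ∈ Finset.HasAntidiagonal.antidiagonal (n + 1), (p.1 : ℝ) * (binomCoeff a p.1 * binomCoeff b p.2)
        + ∑ p ∈ Finset.HasAntidiagonal.antidiagonal (n + 1),
          (p.2 : ℝ) * (binomCoeff a p.1 * binomCoeff b p.2) := by
      rw [← Finset.sum_add_distrib]
      refine Finset.sum_congr rfl fun p hp => ?_
      have : (p.1 : ℝ) + p.2 = n + 1 := by exact_mod_cast Finset.HasAntidiagonal.mem_antidiagonal.1 hp
      rw [← this]; ring
    rw [h1, Finset.Nat.sum_antidiagonal_succ, Finset.Nat.sum_antidiagonal_succ']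
    simp only [Nat.cast_zero, zero_mul, zero_add, Nat.cast_add, Nat.cast_one]
    rw [← Finset.sum_add_distrib]
    refine Finset.sum_congr rfl fun p hp => ?_
    have : (p.1 : ℝ) + p.2 = n := by exact_mod_cast Finset.HasAntidiagonal.mem_antidiagonal.1 hp
    have e1 := succ_mul_binomCoeff_succ a p.1
    have e2 := succ_mul_binomCoeff_succ b p.2
    rw [← this]
    linear_combination binomCoeff b p.2 * e1 + binomCoeff a p.1 * e2

theorem binomCoeff_nonneg {a : ℝ} (ha : 0 ≤ a) (n : ℕ) : 0 ≤ binomCoeff a n := by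
  induction n with
  | zero => simp [binomCoeff]
  | succ n ih => rw [binomCoeff_succ]; positivity

theorem binomCoeff_one (n : ℕ) : binomCoeff 1 n = 1 := by
  induction n with
  | zero => simp [binomCoeff]
  | succ n ih =>
    rw [binomCoeff_succ, ih, one_mul, add_comm, div_self]
    positivity

/-- In the product defining the coefficient only the first factor `-a` is nonpositive. This sign
pattern of `(1-z)^a` drives the positivity proof below. -/
theorem binomCoeff_neg_nonpos {a : ℝ} (h0 : 0 ≤ a) (h1 : a ≤ 1) (n : ℕ) :
    binomCoeff (-a) (n + 1) ≤ 0 := by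
  induction n with
  | zero => simp [binomCoeff, h0]
  | succ n ih =>
    rw [binomCoeff_succ]
    refine mul_nonpos_of_nonpos_of_nonneg ih (div_nonneg ?_ (by positivity))
    push_cast
    have : (0 : ℝ) ≤ n := by positivity
    linarith

/-- Each factor is `1 + a / (n + 1) ≤ 1 + a`, so for fixed `n` the growth in `a` is polynomial. -/
theorem binomCoeff_le_pow {a : ℝ} (ha : 0 ≤ a) (n : ℕ) :
    binomCoeff (a + 1) n ≤ (1 + a) ^ n := by
  induction n with
  | zero => simp [binomCoeff]
  | succ n ih =>
    rw [binomCoeff_succ, pow_succ]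
    refine mul_le_mul ih ?_ (by positivity) (by positivity)
    rw [div_le_iff₀ (by positivity)]
    have : (0 : ℝ) ≤ n := by positivity
    nlinarith

theorem summable_geometric_mul_binomCoeff {α μ : ℝ} (h0 : 0 ≤ α) (h1 : α ≤ 1) (hμ : |μ| < 1)
    {b : ℝ} (hb0 : 0 ≤ b) (hb : b ≤ 1) (n : ℕ) :
    Summable fun j : ℕ => μ ^ j * binomCoeff (α * j + b + 1) n := by
  have hs : Summable fun j : ℕ => |μ| ^ j * ((j : ℝ) + 2) ^ n := by
    -- Shifting the index by two in `∑ j^n |μ|^j` requires division by `|μ|²`.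
    rcases eq_or_ne μ 0 with rfl | h
    · refine summable_of_ne_finset_zero (s := {0}) fun j hj => ?_
      rw [Finset.mem_singleton] at hj
      simp [hj]
    have := (summable_nat_add_iff 2).2
      (summable_pow_mul_geometric_of_norm_lt_one n (r := |μ|) (by simpa using hμ))
    refine (this.mul_left ((|μ| ^ 2)⁻¹)).congr fun j => ?_
    have : |μ| ≠ 0 := abs_ne_zero.2 h
    push_cast
    field_simp
    ring
  refine Summable.of_norm_bounded hs fun j => ?_
  have hj : (0 : ℝ) ≤ j := by positivity
  have hab : 0 ≤ α * j + b := by positivity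
  rw [norm_mul, norm_pow, Real.norm_eq_abs, Real.norm_eq_abs,
    abs_of_nonneg (binomCoeff_nonneg (by linarith) n)]
  gcongr
  refine (binomCoeff_le_pow hab n).trans ?_
  refine pow_le_pow_left₀ (by positivity) ?_ n
  nlinarith [mul_le_mul_of_nonneg_right h1 hj]

/-- The coefficients of the power series of `(1 - z) ^ (-1) / (1 + μ (1 - z) ^ (-α))`: a discrete
analogue of `t ↦ E_α (-μ t ^ α)`. -/
noncomputable def discreteMittagLeffler (α μ : ℝ) (n : ℕ) : ℝ :=
  ∑' j : ℕ, (-μ) ^ j * binomCoeff (α * j + 1) n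

theorem summable_discreteMittagLeffler {α μ : ℝ} (h0 : 0 ≤ α) (h1 : α ≤ 1) (hμ0 : 0 ≤ μ)
    (hμ : μ < 1) (n : ℕ) : Summable fun j : ℕ => (-μ) ^ j * binomCoeff (α * j + 1) n := by
  simpa using summable_geometric_mul_binomCoeff h0 h1 (μ := -μ)
    (by rwa [abs_neg, abs_of_nonneg hμ0]) le_rfl zero_le_one n

/-- Multiplication of the generating function by `(1-z)^(-b)`, read coefficientwise. The choices `b
= -α` and `b = α` produce the recursions behind the lower and the upper bound. -/
theorem hasSum_binomCoeff_mul_discreteMittagLeffler {α μ : ℝ} (h0 : 0 ≤ α) (h1 : α ≤ 1)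
    (hμ0 : 0 ≤ μ) (hμ : μ < 1) (b : ℝ) (n : ℕ) :
    HasSum (fun j : ℕ => (-μ) ^ j * binomCoeff (b + (α * j + 1)) n)
      (∑ p ∈ Finset.HasAntidiagonal.antidiagonal n,
        binomCoeff b p.1 * discreteMittagLeffler α μ p.2) := by
  have : (fun j : ℕ => (-μ) ^ j * binomCoeff (b + (α * j + 1)) n) = fun j : ℕ =>
      ∑ p ∈ Finset.HasAntidiagonal.antidiagonal n,
        binomCoeff b p.1 * ((-μ) ^ j * binomCoeff (α * j + 1) p.2) := by
    funext j
    rw [← binomCoeff_add, Finset.mul_sum]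
    exact Finset.sum_congr rfl fun p _ => by ring
  rw [this]
  exact hasSum_sum fun p _ => ((summable_discreteMittagLeffler h0 h1 hμ0 hμ p.2).hasSum).mul_left _

/-- The generating function `D` satisfies `(1-z)^α D + μ D = (1-z)^(α-1)`. All coefficients of
`(1-z)^α` except the constant one are nonpositive and those of `(1-z)^(α-1)` are nonnegative, so
solving for `(1 + μ) d_n` leaves only nonnegative terms. -/
theorem discreteMittagLeffler_nonneg {α μ : ℝ} (h0 : 0 ≤ α) (h1 : α ≤ 1) (hμ0 : 0 ≤ μ)
    (hμ : μ < 1) (n : ℕ) : 0 ≤ discreteMittagLeffler α μ n := by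
  induction n using Nat.strong_induction_on with
  | _ n ih =>
    have h := (hasSum_nat_add_iff' 1).2
      (hasSum_binomCoeff_mul_discreteMittagLeffler h0 h1 hμ0 hμ (-α) n)
    have h' := (summable_discreteMittagLeffler h0 h1 hμ0 hμ n).hasSum.mul_left (-μ)
    have e := h.unique (h'.congr_fun (fun j => ?_))
    · rw [Finset.Nat.sum_antidiagonal_eq_sum_range_succ_mk, Finset.sum_range_succ'] at e
      change _ = -μ * discreteMittagLeffler α μ n at e
      simp only [binomCoeff, Finset.range_one, Finset.sum_singleton, pow_zero, Nat.sub_zero,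
        Nat.cast_zero, mul_zero, zero_add, one_mul] at e
      have hpos : 0 ≤ binomCoeff (-α + 1) n := binomCoeff_nonneg (by linarith) n
      have hneg : ∑ k ∈ Finset.range n,
          binomCoeff (-α) (k + 1) * discreteMittagLeffler α μ (n - (k + 1)) ≤ 0 :=
        Finset.sum_nonpos fun k hk => mul_nonpos_of_nonpos_of_nonneg
          (binomCoeff_neg_nonpos h0 h1 k) (ih _ (by have := Finset.mem_range.1 hk; omega))
      simp only [binomCoeff] at hneg
      have : 0 ≤ (1 + μ) * discreteMittagLeffler α μ n := by linarith
      exact nonneg_of_mul_nonneg_right this (by linarith)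
    · push_cast
      rw [pow_succ, show -α + (α * ((j : ℝ) + 1) + 1) = α * j + 1 by ring]
      ring

/-- From `D = (1-z)^(-1) - μ (1-z)^(-α) D`: a nonnegative quantity is subtracted from `1`. -/
theorem discreteMittagLeffler_le_one {α μ : ℝ} (h0 : 0 ≤ α) (h1 : α ≤ 1) (hμ0 : 0 ≤ μ)
    (hμ : μ < 1) (n : ℕ) : discreteMittagLeffler α μ n ≤ 1 := by
  have h := (hasSum_nat_add_iff' 1).2 (summable_discreteMittagLeffler h0 h1 hμ0 hμ n).hasSum
  have h' := (hasSum_binomCoeff_mul_discreteMittagLeffler h0 h1 hμ0 hμ α n).mul_left (-μ)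
  have e := h.unique (h'.congr_fun (fun j => ?_))
  · change discreteMittagLeffler α μ n - _ = _ at e
    simp only [Finset.range_one, Finset.sum_singleton, pow_zero, Nat.cast_zero, mul_zero,
      zero_add, one_mul, binomCoeff_one] at e
    have : 0 ≤ ∑ p ∈ Finset.HasAntidiagonal.antidiagonal n,
        binomCoeff α p.1 * discreteMittagLeffler α μ p.2 :=
      Finset.sum_nonneg fun p _ => mul_nonneg (binomCoeff_nonneg h0 _)
        (discreteMittagLeffler_nonneg h0 h1 hμ0 hμ _)
    nlinarith
  · push_cast
    rw [pow_succ, show α + (α * (j : ℝ) + 1) = α * (j + 1) + 1 by ring]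
    ring

/-! ### Binomial coefficients, the Gamma function and the passage to the limit. -/

theorem binomCoeff_rpow_antitone {a : ℝ} (ha : 0 ≤ a) {m n : ℕ} (hm : 0 < m) (hmn : m ≤ n) :
    binomCoeff (a + 1) n * (n : ℝ) ^ (-a) ≤ binomCoeff (a + 1) m * (m : ℝ) ^ (-a) := by
  induction n, hmn using Nat.le_induction with
  | base => exact le_rfl
  | succ n hmn ih =>
    refine le_trans ?_ ih
    have hn : (0 : ℝ) < n := by exact_mod_cast hm.trans_le hmn
    rw [binomCoeff_succ, mul_assoc]
    refine mul_le_mul_of_nonneg_left ?_ (binomCoeff_nonneg (by linarith) n)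
    -- The ratio of consecutive terms is at most one because `1 + a/(n+1) ≤ exp (a/(n+1)) ≤ (1 +
    -- 1/n)^a`, the last inequality being `1/(n+1) ≤ log (1 + 1/n)`.
    have hlog : 1 - (((n : ℝ) + 1) / n)⁻¹ ≤ Real.log ((n + 1) / n) :=
      Real.one_sub_inv_le_log_of_pos (by positivity)
    have hx : (a + 1 + n) / (n + 1) ≤ (((n : ℝ) + 1) / n) ^ a := by
      rw [Real.rpow_def_of_pos (by positivity)]
      calc (a + 1 + n) / (n + 1) = a * (1 - (((n : ℝ) + 1) / n)⁻¹) + 1 := by field_simp; ring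
        _ ≤ Real.log ((n + 1) / n) * a + 1 := by nlinarith
        _ ≤ _ := Real.add_one_le_exp _
    push_cast
    rw [Real.rpow_neg (by positivity), Real.rpow_neg hn.le]
    rw [Real.div_rpow (by positivity) hn.le] at hx
    have p1 : 0 < ((n : ℝ) + 1) ^ a := by positivity
    have p2 : 0 < (n : ℝ) ^ a := by positivity
    calc _ ≤ ((n : ℝ) + 1) ^ a / (n : ℝ) ^ a * (((n : ℝ) + 1) ^ a)⁻¹ := by gcongr
      _ = _ := by field_simp

/-- This is Euler's limit for `Γ`. The product in `Real.GammaSeq` starts with the factor `a`, which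
is why `a = 0` is treated apart. -/
theorem tendsto_binomCoeff_rpow {a : ℝ} (ha : 0 ≤ a) :
    Tendsto (fun n : ℕ => binomCoeff (a + 1) n * (n : ℝ) ^ (-a)) atTop
      (𝓝 (1 / Real.Gamma (a + 1))) := by
  rcases ha.eq_or_lt with rfl | ha
  · simp [binomCoeff_one]
  have hp : ∀ n : ℕ, ∏ j ∈ Finset.range (n + 1), (a + j) = a * n.factorial * binomCoeff (a + 1) n := by
    intro n
    induction n with
    | zero => simp [binomCoeff]
    | succ n ih =>
      rw [Finset.prod_range_succ, ih, binomCoeff_succ, Nat.factorial_succ]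
      have : (n : ℝ) + 1 ≠ 0 := by positivity
      push_cast
      field_simp
      ring
  have h := ((Real.GammaSeq_tendsto_Gamma a).const_mul a).inv₀
    (mul_ne_zero ha.ne' (Real.Gamma_pos_of_pos ha).ne')
  rw [Real.Gamma_add_one ha.ne', one_div]
  refine h.congr' ?_
  filter_upwards [eventually_gt_atTop 0] with n hn
  have hn' : (0 : ℝ) < n := by exact_mod_cast hn
  rw [Real.GammaSeq, hp, Real.rpow_neg hn'.le]
  have : (0 : ℝ) < (n : ℝ) ^ a := by positivity
  have hf : (n.factorial : ℝ) ≠ 0 := by positivity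
  field_simp

/-- A decreasing sequence stays above its limit. Every fixed `m` thus yields a majorant for `1 / Γ`.
-/
theorem one_div_Gamma_le {a : ℝ} (ha : 0 ≤ a) {m : ℕ} (hm : 0 < m) :
    1 / Real.Gamma (a + 1) ≤ binomCoeff (a + 1) m * (m : ℝ) ^ (-a) :=
  le_of_tendsto (tendsto_binomCoeff_rpow ha)
    (eventually_atTop.2 ⟨m, fun _ hn => binomCoeff_rpow_antitone ha hm hn⟩)

theorem exists_mul_rpow_lt_one {α : ℝ} (hα : 0 < α) (x : ℝ) :
    ∃ m : ℕ, 0 < m ∧ ∀ n : ℕ, m ≤ n → x * (n : ℝ) ^ (-α) < 1 := by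
  have h : Tendsto (fun n : ℕ => x * (n : ℝ) ^ (-α)) atTop (𝓝 0) := by
    simpa using ((tendsto_rpow_neg_atTop hα).comp tendsto_natCast_atTop_atTop).const_mul x
  obtain ⟨m, hm⟩ := eventually_atTop.1 (h.eventually_lt_const zero_lt_one)
  exact ⟨m + 1, Nat.succ_pos m, fun n hn => hm n (by omega)⟩

theorem rpow_neg_mul_natCast (α : ℝ) (n j : ℕ) :
    (n : ℝ) ^ (-(α * j)) = ((n : ℝ) ^ (-α)) ^ j := by
  rw [← Real.rpow_natCast, ← Real.rpow_mul (by positivity)]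
  ring_nf

/-- Once `m` satisfies `|z| m^(-α) < 1`, the majorant from `one_div_Gamma_le` is a geometric
sequence times a polynomially growing coefficient. -/
theorem summable_mittagLeffler {α : ℝ} (h0 : 0 < α) (h1 : α ≤ 1) (z : ℝ) :
    Summable fun k : ℕ => z ^ k / Real.Gamma (α * k + 1) := by
  obtain ⟨m, hm, hx⟩ := exists_mul_rpow_lt_one h0 |z|
  have hm' : (0 : ℝ) < m := by exact_mod_cast hm
  have hp : 0 ≤ |z| * (m : ℝ) ^ (-α) := by positivity
  have hs : Summable fun j : ℕ => (|z| * (m : ℝ) ^ (-α)) ^ j * binomCoeff (α * j + 1) m := by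
    simpa using summable_geometric_mul_binomCoeff h0.le h1 (b := 0)
      (by rw [abs_of_nonneg hp]; exact hx m le_rfl) le_rfl zero_le_one m
  refine Summable.of_norm_bounded hs fun j => ?_
  have hj : 0 ≤ α * j := by positivity
  rw [norm_div, norm_pow, Real.norm_eq_abs, Real.norm_eq_abs,
    abs_of_pos (Real.Gamma_pos_of_pos (by linarith)), mul_pow, ← rpow_neg_mul_natCast,
    div_eq_mul_one_div, mul_assoc, mul_comm ((m : ℝ) ^ _)]
  gcongr
  exact one_div_Gamma_le hj hm

/-- Dominated convergence in `j`: the factor `n^(-αj)` coming from `μ^j` normalizes the coefficient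
to its limit `1 / Γ(αj + 1)`, and by monotonicity in `n` the terms at one large index `m` dominate
all later ones. -/
theorem tendsto_discreteMittagLeffler {α : ℝ} (h0 : 0 < α) (h1 : α ≤ 1) {x : ℝ} (hx : 0 ≤ x) :
    Tendsto (fun n : ℕ => discreteMittagLeffler α (x * (n : ℝ) ^ (-α)) n) atTop
      (𝓝 (mittagLeffler α (-x))) := by
  obtain ⟨m, hm, hx'⟩ := exists_mul_rpow_lt_one h0 x
  have hp : ∀ n : ℕ, 0 ≤ x * (n : ℝ) ^ (-α) := fun n => by positivity
  have hs : Summable fun j : ℕ => (x * (m : ℝ) ^ (-α)) ^ j * binomCoeff (α * j + 1) m := by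
    simpa using summable_geometric_mul_binomCoeff h0.le h1 (b := 0)
      (by rw [abs_of_nonneg (hp m)]; exact hx' m le_rfl) le_rfl zero_le_one m
  have hj : ∀ j : ℕ, 0 ≤ α * j := fun j => by positivity
  refine tendsto_tsum_of_dominated_convergence hs (fun j => ?_) ?_
  · have := (tendsto_binomCoeff_rpow (hj j)).const_mul ((-x) ^ j)
    rw [mul_one_div] at this
    refine this.congr fun n => ?_
    rw [rpow_neg_mul_natCast, ← neg_mul, mul_pow]
    ring
  · filter_upwards [eventually_ge_atTop m] with n hn j
    rw [norm_mul, norm_pow, Real.norm_eq_abs, Real.norm_eq_abs, abs_neg, abs_of_nonneg (hp n),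
      abs_of_nonneg (binomCoeff_nonneg (by linarith [hj j]) n)]
    have key := mul_le_mul_of_nonneg_left (binomCoeff_rpow_antitone (hj j) hm hn)
      (pow_nonneg hx j)
    rw [rpow_neg_mul_natCast, rpow_neg_mul_natCast] at key
    rw [mul_pow, mul_pow]
    linarith

/-- The Mittag-Leffler function takes values in `[0, 1]` on the negative half-line. -/
theorem mittagLeffler_neg_mem_Icc {α : ℝ} (h0 : 0 < α) (h1 : α ≤ 1) {x : ℝ} (hx : 0 ≤ x) :
    mittagLeffler α (-x) ∈ Set.Icc (0 : ℝ) 1 := by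
  obtain ⟨m, hm, hx'⟩ := exists_mul_rpow_lt_one h0 x
  refine isClosed_Icc.mem_of_tendsto (tendsto_discreteMittagLeffler h0 h1 hx) ?_
  filter_upwards [eventually_ge_atTop m] with n hn
  exact ⟨discreteMittagLeffler_nonneg h0.le h1 (by positivity) (hx' n hn) n,
    discreteMittagLeffler_le_one h0.le h1 (by positivity) (hx' n hn) n⟩

theorem continuous_mittagLeffler {α : ℝ} (h0 : 0 < α) (h1 : α ≤ 1) :
    Continuous (mittagLeffler α) := by
  refine continuous_iff_continuousAt.2 fun z => ?_
  have hc : ContinuousOn (mittagLeffler α) (Metric.ball 0 (|z| + 1)) := by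
    refine continuousOn_tsum (fun k => by fun_prop)
      (summable_mittagLeffler h0 h1 (|z| + 1)) fun k w hw => ?_
    have hk : 0 < α * k + 1 := by positivity
    rw [norm_div, norm_pow, Real.norm_eq_abs (Real.Gamma _), abs_of_pos (Real.Gamma_pos_of_pos hk)]
    have := Real.Gamma_pos_of_pos hk
    rw [mem_ball_zero_iff] at hw
    gcongr
  exact hc.continuousAt (Metric.isOpen_ball.mem_nhds (by simp))

/-! ### Rotations about the coordinate axes -/

/-- The rotation by the angle `φ` about the first coordinate axis. -/
noncomputable def rotX (φ : ℝ) : E3 ≃ₗᵢ[ℝ] E3 :=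
  LinearIsometry.toLinearIsometryEquiv
    { toFun := fun x => !₂[x 0, Real.cos φ * x 1 - Real.sin φ * x 2,
        Real.sin φ * x 1 + Real.cos φ * x 2]
      map_add' := fun x y => by ext i; fin_cases i <;> simp <;> ring
      map_smul' := fun c x => by ext i; fin_cases i <;> simp <;> ring
      norm_map' := fun x => by
        have h := Real.sin_sq_add_cos_sq φ
        simp only [EuclideanSpace.norm_eq, LinearMap.coe_mk, AddHom.coe_mk, Fin.sum_univ_three,
          Real.norm_eq_abs, sq_abs]
        congr 1
        simp
        linear_combination (x 1 ^ 2 + x 2 ^ 2) * h } rfl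

/-- The rotation by the angle `φ` about the third coordinate axis. -/
noncomputable def rotZ (φ : ℝ) : E3 ≃ₗᵢ[ℝ] E3 :=
  LinearIsometry.toLinearIsometryEquiv
    { toFun := fun x => !₂[Real.cos φ * x 0 - Real.sin φ * x 1,
        Real.sin φ * x 0 + Real.cos φ * x 1, x 2]
      map_add' := fun x y => by ext i; fin_cases i <;> simp <;> ring
      map_smul' := fun c x => by ext i; fin_cases i <;> simp <;> ring
      norm_map' := fun x => by
        have h := Real.sin_sq_add_cos_sq φ
        simp only [EuclideanSpace.norm_eq, LinearMap.coe_mk, AddHom.coe_mk, Fin.sum_univ_three,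
          Real.norm_eq_abs, sq_abs]
        congr 1
        simp
        linear_combination (x 0 ^ 2 + x 1 ^ 2) * h } rfl

theorem rotX_apply (φ : ℝ) (x : E3) :
    rotX φ x = !₂[x 0, Real.cos φ * x 1 - Real.sin φ * x 2,
      Real.sin φ * x 1 + Real.cos φ * x 2] := rfl

theorem rotZ_apply (φ : ℝ) (x : E3) :
    rotZ φ x = !₂[Real.cos φ * x 0 - Real.sin φ * x 1,
      Real.sin φ * x 0 + Real.cos φ * x 1, x 2] := rfl

theorem isRotation_rotX (φ : ℝ) : IsRotation (rotX φ) := by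
  rw [IsRotation, ← LinearMap.det_toMatrix (EuclideanSpace.basisFun (Fin 3) ℝ).toBasis,
    Matrix.det_fin_three]
  simp [LinearMap.toMatrix_apply, rotX_apply]
  linear_combination Real.sin_sq_add_cos_sq φ

theorem isRotation_rotZ (φ : ℝ) : IsRotation (rotZ φ) := by
  rw [IsRotation, ← LinearMap.det_toMatrix (EuclideanSpace.basisFun (Fin 3) ℝ).toBasis,
    Matrix.det_fin_three]
  simp [LinearMap.toMatrix_apply, rotZ_apply]
  linear_combination Real.sin_sq_add_cos_sq φ

theorem coe_rotate (R : E3 ≃ₗᵢ[ℝ] E3) (x : S2) : (rotate R x : E3) = R x := rfl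

theorem continuous_rotate (R : E3 ≃ₗᵢ[ℝ] E3) : Continuous (rotate R) :=
  Continuous.subtype_mk (R.continuous.comp continuous_subtype_val) _

theorem inner_rotate (R : E3 ≃ₗᵢ[ℝ] E3) (x y : S2) :
    inner ℝ (rotate R x : E3) (rotate R y : E3) = inner ℝ (x : E3) (y : E3) :=
  R.inner_map_map _ _

theorem sum_sq_coord (x : S2) : (x : E3) 0 ^ 2 + (x : E3) 1 ^ 2 + (x : E3) 2 ^ 2 = 1 := by
  have h : ‖(x : E3)‖ = 1 := by simp
  rw [EuclideanSpace.norm_eq, Real.sqrt_eq_one, Fin.sum_univ_three] at h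
  simpa using h

/-! ### The associated Legendre functions -/

open Polynomial in
-- With `w = (X² - 1)^ℓ` one has `(X² - 1) w' = 2ℓ X w`. The case `k = 0` is the derivative of this
-- identity, and each further case is the derivative of the previous one.
theorem derivative_iterate_X_sq_sub_one_pow (ℓ k : ℕ) :
    (X ^ 2 - 1 : ℝ[X]) * derivative^[k + 2] ((X ^ 2 - 1) ^ ℓ)
      + C (2 * ((k : ℝ) + 1) - 2 * ℓ) * X * derivative^[k + 1] ((X ^ 2 - 1) ^ ℓ)
      + C (((k : ℝ) + 1) * (k - 2 * ℓ)) * derivative^[k] ((X ^ 2 - 1) ^ ℓ) = 0 := by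
  induction k with
  | zero =>
    have h : (X ^ 2 - 1 : ℝ[X]) * derivative ((X ^ 2 - 1) ^ ℓ)
        = C (2 * (ℓ : ℝ)) * X * (X ^ 2 - 1) ^ ℓ := by
      cases ℓ with
      | zero => simp
      | succ n =>
        rw [derivative_pow_succ]
        simp only [derivative_sub, derivative_X_pow, derivative_one, map_mul, map_natCast,
          map_add, map_one, map_ofNat, Nat.cast_add, Nat.cast_one, Nat.cast_ofNat]
        ring
    have h' := congrArg derivative h
    simp only [derivative_mul, derivative_sub, derivative_X_pow, derivative_one, derivative_C,
      derivative_X] at h'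
    simp only [Function.iterate_succ, Function.iterate_zero, Function.comp_apply, id]
    simp only [map_mul, map_natCast, map_sub, map_ofNat, Nat.cast_zero,
      zero_add, mul_one, one_mul, zero_sub, map_neg] at h' ⊢
    linear_combination h'
  | succ k ih =>
    have h' := congrArg derivative ih
    simp only [derivative_add, derivative_mul, derivative_sub, derivative_X_pow, derivative_one,
      derivative_C, derivative_X, ← Function.iterate_succ_apply' derivative, derivative_zero] at h'
    simp only [map_mul, map_natCast, map_sub, map_add, map_one, map_ofNat, Nat.cast_add,
      Nat.cast_one, Nat.succ_eq_add_one, add_assoc] at h' ⊢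
    norm_num at h' ⊢
    linear_combination h'

/-- The value at `z` of the `m`-th derivative of the Legendre polynomial. -/
noncomputable def legendreDeriv (ℓ m : ℕ) (z : ℝ) : ℝ :=
  (Polynomial.derivative^[m] (legendre ℓ)).eval z

/-- The preceding identity at `k = m + ℓ`, since `P_ℓ^(m)` is a multiple of the `(m + ℓ)`-th
derivative of `(X² - 1)^ℓ`. -/
theorem legendreDeriv_ode (ℓ m : ℕ) (z : ℝ) :
    (1 - z ^ 2) * legendreDeriv ℓ (m + 2) z = 2 * (m + 1) * z * legendreDeriv ℓ (m + 1) z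
      - ((ℓ : ℝ) * (ℓ + 1) - m * (m + 1)) * legendreDeriv ℓ m z := by
  have h := congrArg (Polynomial.eval z) (derivative_iterate_X_sq_sub_one_pow ℓ (m + ℓ))
  have e : ∀ j, legendreDeriv ℓ j z = (2 ^ ℓ * (ℓ.factorial : ℝ))⁻¹ *
      (Polynomial.derivative^[j + ℓ] ((Polynomial.X ^ 2 - 1) ^ ℓ)).eval z := by
    intro j
    rw [legendreDeriv, legendre, Polynomial.iterate_derivative_C_mul,
      ← Function.iterate_add_apply, Polynomial.eval_mul, Polynomial.eval_C]
  rw [e, e, e, show m + 2 + ℓ = m + ℓ + 2 by ring, show m + 1 + ℓ = m + ℓ + 1 by ring]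
  simp only [Polynomial.eval_add, Polynomial.eval_mul, Polynomial.eval_sub, Polynomial.eval_pow,
    Polynomial.eval_X, Polynomial.eval_one, Polynomial.eval_C, Polynomial.eval_zero] at h
  push_cast at h
  linear_combination (-(2 ^ ℓ * (ℓ.factorial : ℝ))⁻¹) * h

theorem legendreDeriv_of_lt {ℓ m : ℕ} (h : ℓ < m) (z : ℝ) : legendreDeriv ℓ m z = 0 := by
  rw [legendreDeriv, Polynomial.iterate_derivative_eq_zero, Polynomial.eval_zero]
  refine lt_of_le_of_lt ?_ h
  rw [legendre]
  refine (Polynomial.natDegree_C_mul_le _ _).trans ?_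
  refine (Polynomial.natDegree_iterate_derivative _ _).trans ?_
  have : ((Polynomial.X ^ 2 - 1 : Polynomial ℝ) ^ ℓ).natDegree ≤ ℓ * 2 :=
    Polynomial.natDegree_pow_le_of_le ℓ (by compute_degree)
  omega

theorem hasDerivAt_legendreDeriv (ℓ m : ℕ) (z : ℝ) :
    HasDerivAt (legendreDeriv ℓ m) (legendreDeriv ℓ (m + 1) z) z := by
  unfold legendreDeriv
  rw [Function.iterate_succ_apply']
  exact Polynomial.hasDerivAt _ z

/-! ### The ladder relations for spherical harmonics -/

/-- The coefficient `√(ℓ (ℓ + 1) - m (m + 1))` of the ladder operators. -/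
noncomputable def ladderCoeff (ℓ : ℕ) (m : ℤ) : ℝ :=
  Real.sqrt ((ℓ : ℝ) * (ℓ + 1) - m * (m + 1))

/-- The normalizing constant of `Y_{ℓ,m}`. -/
noncomputable def harmonicNorm (ℓ m : ℕ) : ℝ :=
  Real.sqrt ((2 * ℓ + 1) * ((ℓ - m).factorial : ℝ) / ((ℓ + m).factorial : ℝ))

/-- The quotient of the two radicands is `(ℓ - m)(ℓ + m + 1) = ℓ(ℓ+1) - m(m+1)`. -/
theorem harmonicNorm_eq {ℓ m : ℕ} (h : m < ℓ) :
    harmonicNorm ℓ m = ladderCoeff ℓ m * harmonicNorm ℓ (m + 1) := by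
  obtain ⟨d, rfl⟩ := Nat.exists_eq_add_of_lt h
  rw [harmonicNorm, harmonicNorm, ladderCoeff, ← Real.sqrt_mul]
  · congr 1
    rw [show m + d + 1 - m = d + 1 by omega, show m + d + 1 - (m + 1) = d by omega,
      show m + d + 1 + (m + 1) = (m + d + 1 + m) + 1 by ring, Nat.factorial_succ,
      Nat.factorial_succ (m + d + 1 + m)]
    have h1 : ((m + d + 1 + m).factorial : ℝ) ≠ 0 := by positivity
    push_cast
    field_simp
    ring
  · push_cast
    have : (0 : ℝ) ≤ m := by positivity
    have : (0 : ℝ) ≤ d := by positivity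
    nlinarith [mul_nonneg (Nat.cast_nonneg (α := ℝ) m) (Nat.cast_nonneg (α := ℝ) d)]

/-- The ladder stops at the top: the radicand is nonpositive and `Real.sqrt` then takes its default
value zero. -/
theorem ladderCoeff_of_le {ℓ : ℕ} {m : ℤ} (h : (ℓ : ℤ) ≤ m) : ladderCoeff ℓ m = 0 := by
  refine Real.sqrt_eq_zero_of_nonpos ?_
  have : (ℓ : ℝ) ≤ m := by exact_mod_cast h
  have : (0 : ℝ) ≤ ℓ := by positivity
  nlinarith

/-- The symmetry that matches the ladder with `Y_{ℓ,-m} = (-1)^m conj Y_{ℓ,m}`; it also gives the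
vanishing at the bottom, `m = -ℓ - 1`. -/
theorem ladderCoeff_neg (ℓ : ℕ) (m : ℤ) : ladderCoeff ℓ (-m - 1) = ladderCoeff ℓ m := by
  rw [ladderCoeff, ladderCoeff]
  push_cast
  ring_nf

theorem ladderCoeff_sq {ℓ : ℕ} {m : ℤ} (h0 : -(ℓ : ℤ) - 1 ≤ m) (h1 : m ≤ ℓ) :
    ladderCoeff ℓ m ^ 2 = (ℓ : ℝ) * (ℓ + 1) - m * (m + 1) := by
  refine Real.sq_sqrt ?_
  have h0 : -(ℓ : ℝ) - 1 ≤ m := by exact_mod_cast h0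
  have h1 : (m : ℝ) ≤ ℓ := by exact_mod_cast h1
  nlinarith

theorem sphericalHarmonicNat_eq (ℓ m : ℕ) (x : S2) :
    sphericalHarmonicNat ℓ m x = ((harmonicNorm ℓ m * ((-1) ^ m *
      legendreDeriv ℓ m ((x : E3) 2)) : ℝ) : ℂ) *
      (((x : E3) 0 : ℂ) + Complex.I * ((x : E3) 1 : ℂ)) ^ m := rfl

/-- The truncated subtraction in `(ℓ - m)!` is harmless here because the derivative of the Legendre
polynomial already vanishes. -/
theorem sphericalHarmonicNat_of_lt {ℓ m : ℕ} (h : ℓ < m) (x : S2) :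
    sphericalHarmonicNat ℓ m x = 0 := by
  rw [sphericalHarmonicNat_eq, legendreDeriv_of_lt h]
  simp

/-- Chain rule along the rotation: the coordinates have the derivatives `x₀' = 0`, `x₁' = -x₂`, `x₂'
= x₁`. -/
theorem hasDerivAt_sphericalHarmonicNat_aux (ℓ m : ℕ) (x : S2) (φ : ℝ) :
    HasDerivAt (fun ψ => sphericalHarmonicNat ℓ m (rotate (rotX ψ) x))
      (((harmonicNorm ℓ m * (-1) ^ m : ℝ) : ℂ) *
        (((legendreDeriv ℓ (m + 1) ((rotate (rotX φ) x : E3) 2) : ℝ) : ℂ)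
          * ((rotate (rotX φ) x : E3) 1 : ℂ)
          * (((rotate (rotX φ) x : E3) 0 : ℂ)
            + Complex.I * ((rotate (rotX φ) x : E3) 1 : ℂ)) ^ m
        - ((legendreDeriv ℓ m ((rotate (rotX φ) x : E3) 2) : ℝ) : ℂ)
          * (m * (((rotate (rotX φ) x : E3) 0 : ℂ)
            + Complex.I * ((rotate (rotX φ) x : E3) 1 : ℂ)) ^ (m - 1)
            * (Complex.I * ((rotate (rotX φ) x : E3) 2 : ℂ))))) φ := by
  have d2 : HasDerivAt (fun ψ => (rotate (rotX ψ) x : E3) 2) ((rotate (rotX φ) x : E3) 1) φ := by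
    have := ((Real.hasDerivAt_sin φ).mul_const ((x : E3) 1)).add
      ((Real.hasDerivAt_cos φ).mul_const ((x : E3) 2))
    refine (this.congr_deriv ?_).congr_of_eventuallyEq (Eventually.of_forall fun ψ => ?_)
    · simp [coe_rotate, rotX_apply]
      ring
    · simp [coe_rotate, rotX_apply]
  have d1 : HasDerivAt (fun ψ => (rotate (rotX ψ) x : E3) 1) (-(rotate (rotX φ) x : E3) 2) φ := by
    have := ((Real.hasDerivAt_cos φ).mul_const ((x : E3) 1)).sub
      ((Real.hasDerivAt_sin φ).mul_const ((x : E3) 2))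
    refine (this.congr_deriv ?_).congr_of_eventuallyEq (Eventually.of_forall fun ψ => ?_)
    · simp [coe_rotate, rotX_apply]
      ring
    · simp [coe_rotate, rotX_apply]
  have d0 : HasDerivAt (fun ψ => ((rotate (rotX ψ) x : E3) 0 : ℂ)) 0 φ := by
    have : (fun ψ => ((rotate (rotX ψ) x : E3) 0 : ℂ)) = fun _ => ((x : E3) 0 : ℂ) := by
      funext ψ; simp [coe_rotate, rotX_apply]
    rw [this]
    exact hasDerivAt_const _ _
  have dl := ((hasDerivAt_legendreDeriv ℓ m _).comp φ d2).ofReal_comp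
  have dw := (d0.add (d1.ofReal_comp.const_mul Complex.I)).pow m
  have := (dl.mul dw).const_mul ((harmonicNorm ℓ m * (-1) ^ m : ℝ) : ℂ)
  refine (this.congr_deriv ?_).congr_of_eventuallyEq (Eventually.of_forall fun ψ => ?_)
  · simp only [Function.comp_apply, Pi.add_apply, Pi.pow_apply]
    push_cast
    ring
  · simp only [sphericalHarmonicNat_eq, Pi.mul_apply, Function.comp_apply, Pi.add_apply,
      Pi.pow_apply]
    push_cast
    ring

theorem hasDerivAt_sphericalHarmonicNat_succ (ℓ m : ℕ) (x : S2) (φ : ℝ) :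
    HasDerivAt (fun ψ => sphericalHarmonicNat ℓ (m + 1) (rotate (rotX ψ) x))
      (Complex.I / 2 * (ladderCoeff ℓ (m + 1) *
          sphericalHarmonicNat ℓ (m + 2) (rotate (rotX φ) x)
        + ladderCoeff ℓ m * sphericalHarmonicNat ℓ m (rotate (rotX φ) x))) φ := by
  refine (hasDerivAt_sphericalHarmonicNat_aux ℓ (m + 1) x φ).congr_deriv ?_
  generalize rotate (rotX φ) x = y
  rcases lt_or_ge ℓ (m + 1) with h | h
  -- For `m ≥ ℓ` the harmonics of orders `m + 1` and `m + 2` vanish. The one of order `m` need not,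
  -- but its ladder coefficient does.
  · rw [legendreDeriv_of_lt h, legendreDeriv_of_lt (by omega),
      sphericalHarmonicNat_of_lt (by omega), ladderCoeff_of_le (m := (m : ℤ)) (by omega)]
    simp
  have hN := harmonicNorm_eq (ℓ := ℓ) (m := m) (by omega)
  have ha := ladderCoeff_sq (ℓ := ℓ) (m := (m : ℤ)) (by omega) (by omega)
  -- When `ℓ = m + 1` the relation between the norming constants is not available, but then
  -- `P_ℓ^(m+2) = 0`.
  have hup : ladderCoeff ℓ (m + 1) * harmonicNorm ℓ (m + 2) * legendreDeriv ℓ (m + 2) ((y : E3) 2)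
      = harmonicNorm ℓ (m + 1) * legendreDeriv ℓ (m + 2) ((y : E3) 2) := by
    rcases h.lt_or_eq with h | h
    · rw [harmonicNorm_eq h]
      norm_cast
    · rw [legendreDeriv_of_lt (by omega)]
      simp
  have hode := legendreDeriv_ode ℓ m ((y : E3) 2)
  have hs := sum_sq_coord y
  simp only [sphericalHarmonicNat_eq]
  rw [hN]
  generalize legendreDeriv ℓ m ((y : E3) 2) = p0 at *
  generalize legendreDeriv ℓ (m + 1) ((y : E3) 2) = p1 at *
  generalize legendreDeriv ℓ (m + 2) ((y : E3) 2) = p2 at *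
  generalize (y : E3) 0 = y0 at *
  generalize (y : E3) 1 = y1 at *
  generalize (y : E3) 2 = y2 at *
  generalize harmonicNorm ℓ (m + 1) = N1 at *
  generalize harmonicNorm ℓ (m + 2) = N2 at *
  have hI := Complex.I_sq
  replace hup := congrArg (fun r : ℝ => (r : ℂ)) hup
  replace ha := congrArg (fun r : ℝ => (r : ℂ)) ha
  replace hode := congrArg (fun r : ℝ => (r : ℂ)) hode
  replace hs := congrArg (fun r : ℝ => (r : ℂ)) hs
  push_cast at hup ha hode hs ⊢
  set a1 : ℂ := (ladderCoeff ℓ (m + 1) : ℂ)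
  set a0 : ℂ := (ladderCoeff ℓ m : ℂ)
  -- What remains after removing common factors is the Legendre equation together with `1 - y₂² =
  -- y₀² + y₁²` on the sphere.
  have key : (p2 : ℂ) * y1 * (y0 + Complex.I * y1) - p1 * ((m + 1) * (Complex.I * y2))
      = -(Complex.I / 2) * (p2 * (y0 + Complex.I * y1) ^ 2 + a0 ^ 2 * p0) := by
    rw [ha]
    linear_combination (Complex.I / 2) * hode + (Complex.I / 2 * p2) * hs
      + (p2 * (y0 * y1 * 1 + Complex.I * y1 ^ 2 / 2)) * hI
  linear_combination (N1 * (-1) ^ (m + 1) * (y0 + Complex.I * y1) ^ m) * key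
    - (Complex.I / 2) * (-1) ^ (m + 2) * (y0 + Complex.I * y1) ^ (m + 2) * hup

/-- At order zero lowering leads to `Y_{ℓ,-1} = -conj Y_{ℓ,1}`, so this case is separate; only `w -
conj w = 2i Im w` for `w = x₀ + i x₁` is used. -/
theorem hasDerivAt_sphericalHarmonicNat_zero (ℓ : ℕ) (x : S2) (φ : ℝ) :
    HasDerivAt (fun ψ => sphericalHarmonicNat ℓ 0 (rotate (rotX ψ) x))
      (Complex.I / 2 * (ladderCoeff ℓ 0 * sphericalHarmonicNat ℓ 1 (rotate (rotX φ) x)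
        - ladderCoeff ℓ 0 * conj (sphericalHarmonicNat ℓ 1 (rotate (rotX φ) x)))) φ := by
  refine (hasDerivAt_sphericalHarmonicNat_aux ℓ 0 x φ).congr_deriv ?_
  generalize rotate (rotX φ) x = y
  have hup : ladderCoeff ℓ 0 * harmonicNorm ℓ 1 * legendreDeriv ℓ 1 ((y : E3) 2)
      = harmonicNorm ℓ 0 * legendreDeriv ℓ 1 ((y : E3) 2) := by
    rcases Nat.eq_zero_or_pos ℓ with h | h
    · rw [legendreDeriv_of_lt (by omega)]
      simp
    · rw [harmonicNorm_eq h]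
      norm_cast
  replace hup := congrArg (fun r : ℝ => (r : ℂ)) hup
  simp only [sphericalHarmonicNat_eq, map_mul, map_add, Complex.conj_ofReal, Complex.conj_I, map_pow]
  push_cast at hup ⊢
  linear_combination (-((y : E3) 1 : ℂ)) * hup
     + (ladderCoeff ℓ 0 * harmonicNorm ℓ 1 * legendreDeriv ℓ 1 ((y : E3) 2) * ((y : E3) 1 : ℂ)) * Complex.I_sq

theorem sphericalHarmonic_natCast (ℓ m : ℕ) (x : S2) :
    sphericalHarmonic ℓ (m : ℤ) x = sphericalHarmonicNat ℓ m x := by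
  simp [sphericalHarmonic]

theorem sphericalHarmonicNat_zero_real (ℓ : ℕ) (x : S2) :
    conj (sphericalHarmonicNat ℓ 0 x) = sphericalHarmonicNat ℓ 0 x := by
  rw [sphericalHarmonicNat_eq]
  simp only [pow_zero, mul_one, Complex.conj_ofReal]

theorem sphericalHarmonic_neg (ℓ : ℕ) (m : ℤ) (x : S2) :
    sphericalHarmonic ℓ (-m) x = (-1) ^ m.natAbs * conj (sphericalHarmonic ℓ m x) := by
  have h1 : ∀ k : ℕ, (-1 : ℂ) ^ k * (-1) ^ k = 1 := fun k => by
    rw [← mul_pow]; simp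
  rcases lt_trichotomy m 0 with h | rfl | h
  · rw [sphericalHarmonic, sphericalHarmonic, if_pos (by omega), if_neg (by omega)]
    simp only [Int.natAbs_neg, map_mul, map_pow, map_neg, map_one, Complex.conj_conj]
    rw [← mul_assoc, h1, one_mul]
  · simp [sphericalHarmonic, sphericalHarmonicNat_zero_real]
  · rw [sphericalHarmonic, sphericalHarmonic, if_neg (by omega), if_pos (by omega)]
    simp

/-- The derivative along the rotations about the first axis raises and lowers the order. -/
theorem hasDerivAt_sphericalHarmonic (ℓ : ℕ) (m : ℤ) (x : S2) (φ : ℝ) :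
    HasDerivAt (fun ψ => sphericalHarmonic ℓ m (rotate (rotX ψ) x))
      (Complex.I / 2 * (ladderCoeff ℓ m * sphericalHarmonic ℓ (m + 1) (rotate (rotX φ) x)
        + ladderCoeff ℓ (m - 1) * sphericalHarmonic ℓ (m - 1) (rotate (rotX φ) x))) φ := by
  have hpos : ∀ k : ℕ, HasDerivAt (fun ψ => sphericalHarmonic ℓ k (rotate (rotX ψ) x))
      (Complex.I / 2 * (ladderCoeff ℓ k * sphericalHarmonic ℓ (k + 1) (rotate (rotX φ) x)
        + ladderCoeff ℓ (k - 1) * sphericalHarmonic ℓ (k - 1) (rotate (rotX φ) x))) φ := by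
    intro k
    cases k with
    | zero =>
      have h := hasDerivAt_sphericalHarmonicNat_zero ℓ x φ
      have e1 := sphericalHarmonic_natCast ℓ 1 (rotate (rotX φ) x)
      have e2 := sphericalHarmonic_neg ℓ 1 (rotate (rotX φ) x)
      have e3 := ladderCoeff_neg ℓ 0
      simp only [Nat.cast_zero, zero_add, zero_sub, Nat.cast_one, neg_zero, Int.natAbs_one,
        pow_one] at e1 e2 e3 ⊢
      rw [e2, e3, e1]
      refine (h.congr_deriv (by ring)).congr_of_eventuallyEq (Eventually.of_forall fun ψ => ?_)
      exact sphericalHarmonic_natCast ℓ 0 _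
    | succ k =>
      have h := hasDerivAt_sphericalHarmonicNat_succ ℓ k x φ
      have e1 := sphericalHarmonic_natCast ℓ (k + 2) (rotate (rotX φ) x)
      have e2 := sphericalHarmonic_natCast ℓ k (rotate (rotX φ) x)
      rw [show ((k + 1 : ℕ) : ℤ) + 1 = ((k + 2 : ℕ) : ℤ) by push_cast; ring,
        show ((k + 1 : ℕ) : ℤ) - 1 = ((k : ℕ) : ℤ) by push_cast; ring, e1, e2]
      simp only [sphericalHarmonic_natCast]
      exact_mod_cast h
  rcases le_or_gt 0 m with h | h
  · lift m to ℕ using h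
    exact hpos m
  -- Negative orders follow by conjugation: raising and lowering change places, and the sign of
  -- `conj (i/2)` is compensated by `(-1)^(k ± 1) = -(-1)^k`.
  · obtain ⟨k, rfl⟩ : ∃ k : ℕ, m = -(k : ℤ) := ⟨m.natAbs, by omega⟩
    have hk : ∀ j : ℤ, j = k + 1 ∨ j = k - 1 → ((-1 : ℂ) ^ j.natAbs) = -(-1) ^ k := by
      rintro j (rfl | rfl)
      · rw [show ((k : ℤ) + 1).natAbs = k + 1 by omega, pow_succ]; ring
      · obtain ⟨n, rfl⟩ : ∃ n, k = n + 1 := ⟨k - 1, by omega⟩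
        rw [show (((n + 1 : ℕ) : ℤ) - 1).natAbs = n by omega, pow_succ]; ring
    have hd := ((hpos k).star).const_mul ((-1 : ℂ) ^ k)
    have e1 := sphericalHarmonic_neg ℓ (k - 1) (rotate (rotX φ) x)
    have e2 := sphericalHarmonic_neg ℓ (k + 1) (rotate (rotX φ) x)
    rw [hk _ (Or.inr rfl)] at e1
    rw [hk _ (Or.inl rfl)] at e2
    rw [show -(k : ℤ) + 1 = -(k - 1) by ring, show -(k : ℤ) - 1 = -(k + 1) by ring, e1, e2,
      show -((k : ℤ) + 1) = -k - 1 by ring, ladderCoeff_neg,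
      show -(k : ℤ) = -(k - 1) - 1 by ring, ladderCoeff_neg]
    refine (hd.congr_deriv ?_).congr_of_eventuallyEq (Eventually.of_forall fun ψ => ?_)
    · simp only [star_mul', star_add, RCLike.star_def, Complex.conj_ofReal, map_div₀,
        Complex.conj_I, map_ofNat]
      ring
    · rw [show -((k : ℤ) - 1) - 1 = -k by ring]
      simp [sphericalHarmonic_neg]

theorem sphericalHarmonic_rotZ (ℓ : ℕ) (m : ℤ) (φ : ℝ) (x : S2) :
    sphericalHarmonic ℓ m (rotate (rotZ φ) x)
      = Complex.exp (m * φ * Complex.I) * sphericalHarmonic ℓ m x := by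
  have hpos : ∀ k : ℕ, sphericalHarmonic ℓ k (rotate (rotZ φ) x)
      = Complex.exp (k * φ * Complex.I) * sphericalHarmonic ℓ k x := by
    intro k
    rw [sphericalHarmonic_natCast, sphericalHarmonic_natCast, sphericalHarmonicNat_eq,
      sphericalHarmonicNat_eq, coe_rotate, rotZ_apply]
    have : (((Real.cos φ * (x : E3) 0 - Real.sin φ * (x : E3) 1 : ℝ) : ℂ)
        + Complex.I * ((Real.sin φ * (x : E3) 0 + Real.cos φ * (x : E3) 1 : ℝ) : ℂ))
        = Complex.exp (φ * Complex.I) * ((x : E3) 0 + Complex.I * (x : E3) 1) := by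
      rw [Complex.exp_mul_I]
      push_cast
      linear_combination (-(Complex.sin φ * ((x : E3) 1 : ℂ))) * Complex.I_sq
    simp only [Matrix.cons_val, this]
    rw [mul_pow, ← Complex.exp_nat_mul]
    ring_nf
  rcases le_or_gt 0 m with h | h
  · lift m to ℕ using h
    exact_mod_cast hpos m
  · obtain ⟨k, rfl⟩ : ∃ k : ℕ, m = -(k : ℤ) := ⟨m.natAbs, by omega⟩
    rw [sphericalHarmonic_neg, sphericalHarmonic_neg, hpos, map_mul, ← Complex.exp_conj]
    simp
    ring

/-! ### The addition theorem -/

/-- The north pole. -/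
noncomputable def north : S2 := ⟨!₂[0, 0, 1], by simp [EuclideanSpace.norm_eq, Fin.sum_univ_three]⟩

theorem coe_north : (north : E3) = !₂[0, 0, 1] := rfl

theorem inner_north (x : S2) : inner ℝ (x : E3) (north : E3) = (x : E3) 2 := by
  simp [coe_north, PiLp.inner_apply, Fin.sum_univ_three]

theorem exists_rotate_eq_north (y : S2) :
    ∃ φ θ : ℝ, rotate (rotX θ) (rotate (rotZ φ) y) = north := by
  obtain ⟨ψ, h0, h1⟩ : ∃ ψ : ℝ, (y : E3) 0 = Real.sqrt ((y : E3) 0 ^ 2 + (y : E3) 1 ^ 2) * Real.cos ψ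
      ∧ (y : E3) 1 = Real.sqrt ((y : E3) 0 ^ 2 + (y : E3) 1 ^ 2) * Real.sin ψ := by
    have hn : ‖(⟨(y : E3) 0, (y : E3) 1⟩ : ℂ)‖ = Real.sqrt ((y : E3) 0 ^ 2 + (y : E3) 1 ^ 2) := by
      rw [Complex.norm_def, Complex.normSq_mk]; ring_nf
    refine ⟨Complex.arg ⟨(y : E3) 0, (y : E3) 1⟩, ?_, ?_⟩
    · rw [← hn, Complex.norm_mul_cos_arg]
    · rw [← hn, Complex.norm_mul_sin_arg]
  set r := Real.sqrt ((y : E3) 0 ^ 2 + (y : E3) 1 ^ 2) with hr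
  have hrr : r ^ 2 + (y : E3) 2 ^ 2 = 1 := by
    rw [hr, Real.sq_sqrt (by positivity)]; exact sum_sq_coord y
  obtain ⟨θ, h2, h3⟩ : ∃ θ : ℝ, (y : E3) 2 = Real.cos θ ∧ r = Real.sin θ := by
    have hn : ‖(⟨(y : E3) 2, r⟩ : ℂ)‖ = 1 := by
      rw [Complex.norm_def, Complex.normSq_mk, Real.sqrt_eq_one]; linarith
    refine ⟨Complex.arg ⟨(y : E3) 2, r⟩, ?_, ?_⟩
    · have := Complex.norm_mul_cos_arg ⟨(y : E3) 2, r⟩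
      rw [hn, one_mul] at this; exact this.symm
    · have := Complex.norm_mul_sin_arg ⟨(y : E3) 2, r⟩
      rw [hn, one_mul] at this; exact this.symm
  -- The first rotation must bring the point into the plane of the second and third axes, the one in
  -- which `rotX` acts; `θ` is then the colatitude.
  refine ⟨Real.pi / 2 - ψ, θ, Subtype.ext ?_⟩
  rw [coe_rotate, coe_rotate, rotX_apply, rotZ_apply, coe_north, Real.cos_pi_div_two_sub,
    Real.sin_pi_div_two_sub]
  have hψ := Real.sin_sq_add_cos_sq ψ
  have e0 : Real.sin ψ * (y : E3) 0 - Real.cos ψ * (y : E3) 1 = 0 := by rw [h0, h1]; ring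
  have e1 : Real.cos ψ * (y : E3) 0 + Real.sin ψ * (y : E3) 1 = r := by
    rw [h0, h1]; linear_combination r * hψ
  ext i
  fin_cases i
  · simpa using e0
  · simp [e1, ← h2, ← h3]; ring
  · simp [e1, ← h2, ← h3]; linarith

/-- The reproducing kernel of the spherical harmonics of degree `ℓ`. -/
noncomputable def harmonicKernel (ℓ : ℕ) (x y : S2) : ℂ :=
  ∑ m ∈ Finset.Icc (-(ℓ : ℤ)) ℓ, sphericalHarmonic ℓ m x * conj (sphericalHarmonic ℓ m y)

/-- Telescoping. It will be applied to ladder terms, which vanish at both ends. -/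
theorem sum_Icc_sub_shift (ℓ : ℕ) (h : ℤ → ℂ) (h0 : h (-ℓ - 1) = 0) (h1 : h ℓ = 0) :
    ∑ m ∈ Finset.Icc (-(ℓ : ℤ)) ℓ, (h m - h (m - 1)) = 0 := by
  have key : ∀ n : ℕ, ∑ m ∈ Finset.Icc (-(ℓ : ℤ)) (-ℓ + n), (h m - h (m - 1))
      = h (-ℓ + n) - h (-ℓ - 1) := by
    intro n
    induction n with
    | zero => simp
    | succ n ih =>
      have : Finset.Icc (-(ℓ : ℤ)) (-ℓ + (n + 1 : ℕ))
          = insert (-(ℓ : ℤ) + (n + 1 : ℕ)) (Finset.Icc (-(ℓ : ℤ)) (-ℓ + n)) := by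
        ext j; simp only [Finset.mem_insert, Finset.mem_Icc]; push_cast; omega
      rw [this, Finset.sum_insert (by simp), ih,
        show -(ℓ : ℤ) + (n + 1 : ℕ) - 1 = -ℓ + n by push_cast; ring]
      ring
  have := key (2 * ℓ)
  rw [show -(ℓ : ℤ) + (2 * ℓ : ℕ) = ℓ by push_cast; ring, h0, h1] at this
  simpa using this

theorem rotate_rotX_zero (z : S2) : rotate (rotX 0) z = z := by
  refine Subtype.ext ?_
  rw [coe_rotate, rotX_apply]
  ext i
  fin_cases i <;> simp

/-- The derivative in `φ` is zero: the ladder relations turn it into a telescoping sum whose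
boundary terms carry the vanishing coefficients at `m = ℓ` and `m = -ℓ - 1`. -/
theorem harmonicKernel_rotX (ℓ : ℕ) (φ : ℝ) (x y : S2) :
    harmonicKernel ℓ (rotate (rotX φ) x) (rotate (rotX φ) y) = harmonicKernel ℓ x y := by
  have hd : ∀ ψ, HasDerivAt
      (fun ψ => harmonicKernel ℓ (rotate (rotX ψ) x) (rotate (rotX ψ) y)) 0 ψ := by
    intro ψ
    have := HasDerivAt.fun_sum (u := Finset.Icc (-(ℓ : ℤ)) ℓ) fun m _ =>
      (hasDerivAt_sphericalHarmonic ℓ m x ψ).mul (hasDerivAt_sphericalHarmonic ℓ m y ψ).star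
    refine this.congr_deriv ?_
    have hs := sum_Icc_sub_shift ℓ (fun m => Complex.I / 2 * ladderCoeff ℓ m *
        (sphericalHarmonic ℓ (m + 1) (rotate (rotX ψ) x)
          * conj (sphericalHarmonic ℓ m (rotate (rotX ψ) y))
        - sphericalHarmonic ℓ m (rotate (rotX ψ) x)
          * conj (sphericalHarmonic ℓ (m + 1) (rotate (rotX ψ) y))))
      (by
        have := ladderCoeff_neg ℓ ℓ
        rw [ladderCoeff_of_le le_rfl] at this
        simp [this])
      (by simp [ladderCoeff_of_le le_rfl])
    rw [← hs]
    refine Finset.sum_congr rfl fun m _ => ?_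
    simp only [star_mul', star_add, RCLike.star_def, Complex.conj_ofReal, map_div₀,
      Complex.conj_I, map_ofNat, sub_add_cancel]
    ring
  have h := is_const_of_deriv_eq_zero (fun ψ => (hd ψ).differentiableAt)
    (fun ψ => (hd ψ).deriv) φ 0
  simpa only [rotate_rotX_zero] using h

theorem exp_mul_conj_exp (a : ℝ) :
    Complex.exp (a * Complex.I) * conj (Complex.exp (a * Complex.I)) = 1 := by
  rw [Complex.mul_conj, Complex.normSq_eq_norm_sq, Complex.norm_exp_ofReal_mul_I]
  simp

theorem harmonicKernel_rotZ (ℓ : ℕ) (φ : ℝ) (x y : S2) :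
    harmonicKernel ℓ (rotate (rotZ φ) x) (rotate (rotZ φ) y) = harmonicKernel ℓ x y := by
  refine Finset.sum_congr rfl fun m _ => ?_
  rw [sphericalHarmonic_rotZ, sphericalHarmonic_rotZ, map_mul]
  have := exp_mul_conj_exp (m * φ)
  push_cast at this
  linear_combination (sphericalHarmonic ℓ m x * conj (sphericalHarmonic ℓ m y)) * this

theorem sphericalHarmonic_north (ℓ : ℕ) {m : ℤ} (hm : m ≠ 0) :
    sphericalHarmonic ℓ m north = 0 := by
  have : sphericalHarmonicNat ℓ m.natAbs north = 0 := by
    rw [sphericalHarmonicNat_eq, coe_north]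
    simp [hm]
  rw [sphericalHarmonic, this]
  simp

theorem sphericalHarmonic_zero (ℓ : ℕ) (x : S2) :
    sphericalHarmonic ℓ 0 x = ((Real.sqrt (2 * ℓ + 1) * legendreDeriv ℓ 0 ((x : E3) 2) : ℝ) : ℂ) := by
  have := sphericalHarmonic_natCast ℓ 0 x
  rw [Nat.cast_zero] at this
  rw [this, sphericalHarmonicNat_eq, harmonicNorm]
  have h : (ℓ.factorial : ℝ) ≠ 0 := by positivity
  simp [h]

theorem harmonicKernel_north (ℓ : ℕ) (x : S2) :
    harmonicKernel ℓ x north = sphericalHarmonic ℓ 0 x * conj (sphericalHarmonic ℓ 0 north) := by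
  refine Finset.sum_eq_single_of_mem 0 (by simp) fun m _ hm => ?_
  rw [sphericalHarmonic_north ℓ hm]
  simp

/-- Since `(X² - 1)^ℓ = (X - 1)^ℓ (X + 1)^ℓ`, its `ℓ`-th Taylor coefficient at `1` is `2^ℓ`. -/
theorem legendreDeriv_zero_one (ℓ : ℕ) : legendreDeriv ℓ 0 1 = 1 := by
  have h := congrArg (Polynomial.eval 1)
    (congrFun (Polynomial.factorial_smul_hasseDeriv (R := ℝ) ℓ)
      ((Polynomial.X ^ 2 - 1) ^ ℓ))
  have h2 : (Polynomial.hasseDeriv ℓ ((Polynomial.X ^ 2 - 1 : Polynomial ℝ) ^ ℓ)).eval 1 = 2 ^ ℓ := by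
    rw [← Polynomial.taylor_coeff, Polynomial.taylor_apply]
    have : ((Polynomial.X ^ 2 - 1 : Polynomial ℝ) ^ ℓ).comp (Polynomial.X + Polynomial.C 1)
        = (Polynomial.X + Polynomial.C 2) ^ ℓ * Polynomial.X ^ ℓ := by
      rw [← mul_pow]
      simp only [Polynomial.pow_comp, Polynomial.sub_comp, Polynomial.X_comp, Polynomial.one_comp,
        map_one]
      congr 1
      rw [show (Polynomial.C (2 : ℝ)) = 2 from rfl]
      ring
    rw [this]
    have := Polynomial.coeff_mul_X_pow ((Polynomial.X + Polynomial.C (2 : ℝ)) ^ ℓ) ℓ 0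
    rw [zero_add] at this
    rw [this, Polynomial.coeff_zero_eq_eval_zero]
    simp
  simp only [LinearMap.smul_apply, Polynomial.eval_smul] at h
  rw [h2] at h
  rw [legendreDeriv, Function.iterate_zero, id, legendre, Polynomial.eval_mul, Polynomial.eval_C, ← h]
  have hf : (ℓ.factorial : ℝ) ≠ 0 := by positivity
  rw [nsmul_eq_mul]
  field_simp

/-- The addition theorem. -/
theorem harmonicKernel_eq (ℓ : ℕ) (x y : S2) :
    harmonicKernel ℓ x y =
      (((2 * ℓ + 1) * legendreDeriv ℓ 0 (inner ℝ (x : E3) (y : E3)) : ℝ) : ℂ) := by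
  -- Both sides are invariant under the two families of rotations, so `y` may be moved to the north
  -- pole, where only `m = 0` survives.
  obtain ⟨φ, θ, h⟩ := exists_rotate_eq_north y
  rw [← harmonicKernel_rotZ ℓ φ, ← harmonicKernel_rotX ℓ θ, ← inner_rotate (rotZ φ),
    ← inner_rotate (rotX θ), h, harmonicKernel_north, inner_north, sphericalHarmonic_zero,
    sphericalHarmonic_zero, Complex.conj_ofReal, coe_north]
  have : Real.sqrt (2 * ℓ + 1) * Real.sqrt (2 * ℓ + 1) = 2 * ℓ + 1 :=
    Real.mul_self_sqrt (by positivity)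
  simp only [Matrix.cons_val, legendreDeriv_zero_one]
  replace this := congrArg (fun r : ℝ => (r : ℂ)) this
  push_cast at this ⊢
  linear_combination (legendreDeriv ℓ 0
    ((rotate (rotX θ) (rotate (rotZ φ) x) : E3) 2) : ℂ) * this

/-- The kernel is a function of `⟨x, y⟩`, which extends the invariance from the two axes to all
linear isometries. -/
theorem harmonicKernel_rotate (ℓ : ℕ) (R : E3 ≃ₗᵢ[ℝ] E3) (x y : S2) :
    harmonicKernel ℓ (rotate R x) (rotate R y) = harmonicKernel ℓ x y := by
  rw [harmonicKernel_eq, harmonicKernel_eq, inner_rotate]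

theorem harmonicKernel_self (ℓ : ℕ) (x : S2) : harmonicKernel ℓ x x = 2 * ℓ + 1 := by
  rw [harmonicKernel_eq, real_inner_self_eq_norm_sq]
  simp [legendreDeriv_zero_one]

/-! ### Invariance of the surface measure -/

open scoped Pointwise in
-- `Measure.toSphere` is defined through the volume of the cone over a set; `R` maps cones to cones
-- and preserves Lebesgue measure.
theorem map_rotate_sphereMeasure (R : E3 ≃ₗᵢ[ℝ] E3) :
    sphereMeasure.map (rotate R) = sphereMeasure := by
  have hm : Measurable (rotate R) := (continuous_rotate R).measurable
  have : ((volume : Measure E3).toSphere).map (rotate R) = (volume : Measure E3).toSphere := by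
    ext s hs
    rw [Measure.map_apply hm hs, Measure.toSphere_apply' _ (hm hs), Measure.toSphere_apply' _ hs]
    congr 1
    have himg : Set.Ioo (0 : ℝ) 1 • ((↑) '' s : Set E3)
        = R '' (Set.Ioo (0 : ℝ) 1 • ((↑) '' (rotate R ⁻¹' s) : Set E3)) := by
      ext v
      constructor
      · rintro ⟨c, hc, _, ⟨x, hx, rfl⟩, rfl⟩
        refine ⟨c • (rotate R.symm x : E3), ⟨c, hc, _, ⟨rotate R.symm x, ?_, rfl⟩, rfl⟩, ?_⟩
        · have : rotate R (rotate R.symm x) = x := Subtype.ext (R.apply_symm_apply _)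
          rwa [Set.mem_preimage, this]
        · rw [map_smul, coe_rotate, R.apply_symm_apply]
      · rintro ⟨_, ⟨c, hc, _, ⟨x, hx, rfl⟩, rfl⟩, rfl⟩
        exact ⟨c, hc, _, ⟨rotate R x, hx, rfl⟩, by simp [coe_rotate]⟩
    rw [himg]
    have := R.measurePreserving.measure_preimage_equiv (f := R.toMeasurableEquiv)
      (R '' (Set.Ioo (0 : ℝ) 1 • ((↑) '' (rotate R ⁻¹' s) : Set E3)))
    rw [← this]
    congr 1
    exact (Set.preimage_image_eq _ R.injective).symm
  rw [sphereMeasure, Measure.map_smul, this]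

theorem measurePreserving_rotate (R : E3 ≃ₗᵢ[ℝ] E3) :
    MeasurePreserving (rotate R) sphereMeasure sphereMeasure :=
  ⟨(continuous_rotate R).measurable, map_rotate_sphereMeasure R⟩

/-! ### Rotation invariant sesquilinear forms -/

theorem exists_norm_le_of_continuous {f : S2 → ℂ} (hf : Continuous f) :
    ∃ C : ℝ, 0 ≤ C ∧ ∀ x, ‖f x‖ ≤ C := by
  obtain ⟨C, hC⟩ := isCompact_univ.exists_bound_of_continuousOn hf.continuousOn
  exact ⟨max C 0, le_max_right _ _, fun x => (hC x (Set.mem_univ x)).trans (le_max_left _ _)⟩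

section Forms

variable {Z : Type*} [MeasurableSpace Z]

/-- The form `∫ w conj(f ∘ a) (g ∘ b) dν`. -/
noncomputable def sesqForm (ν : Measure Z) (w : Z → ℂ) (a b : Z → S2) (f g : S2 → ℂ) : ℂ :=
  ∫ ζ, w ζ * (conj (f (a ζ)) * g (b ζ)) ∂ν

/-- Rotation invariance of the form `sesqForm`. -/
structure IsInvariantForm (ν : Measure Z) (w : Z → ℂ) (a b : Z → S2) : Prop where
  integrable : Integrable w ν
  measurable_left : Measurable a
  measurable_right : Measurable b
  invariant : ∀ R, IsRotation R → ∀ f g : S2 → ℂ, Continuous f → Continuous g →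
    sesqForm ν w a b (fun x => f (rotate R x)) (fun x => g (rotate R x)) = sesqForm ν w a b f g

variable {ν : Measure Z} {w : Z → ℂ} {a b : Z → S2}

theorem IsInvariantForm.integrable_mul (h : IsInvariantForm ν w a b) {f g : S2 → ℂ}
    (hf : Continuous f) (hg : Continuous g) :
    Integrable (fun ζ => w ζ * (conj (f (a ζ)) * g (b ζ))) ν := by
  obtain ⟨C, hC0, hC⟩ := exists_norm_le_of_continuous hf
  obtain ⟨D, hD0, hD⟩ := exists_norm_le_of_continuous hg
  refine h.integrable.mul_bdd (c := C * D) ?_ (Eventually.of_forall fun ζ => ?_)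
  · exact (((Complex.continuous_conj.comp hf).measurable.comp h.measurable_left).mul
      (hg.measurable.comp h.measurable_right)).aestronglyMeasurable
  · rw [norm_mul, RCLike.norm_conj]
    exact mul_le_mul (hC _) (hD _) (norm_nonneg _) hC0

theorem hasDerivAt_integral_conj_mul {u u' v v' : ℝ → Z → ℂ} {C C' D D' : ℝ}
    (hw : Integrable w ν) (hC0 : 0 ≤ C) (hC0' : 0 ≤ C')
    (hC : ∀ ψ ζ, ‖u ψ ζ‖ ≤ C) (hC' : ∀ ψ ζ, ‖u' ψ ζ‖ ≤ C')
    (hD : ∀ ψ ζ, ‖v ψ ζ‖ ≤ D) (hD' : ∀ ψ ζ, ‖v' ψ ζ‖ ≤ D')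
    (hi : ∀ ψ, Integrable (fun ζ => w ζ * (conj (u ψ ζ) * v ψ ζ)) ν)
    (hi' : Integrable (fun ζ => w ζ * (conj (u' 0 ζ) * v 0 ζ)) ν)
    (hi'' : Integrable (fun ζ => w ζ * (conj (u 0 ζ) * v' 0 ζ)) ν)
    (hu : ∀ ζ ψ, HasDerivAt (fun ψ => u ψ ζ) (u' ψ ζ) ψ)
    (hv : ∀ ζ ψ, HasDerivAt (fun ψ => v ψ ζ) (v' ψ ζ) ψ) :
    HasDerivAt (fun ψ => ∫ ζ, w ζ * (conj (u ψ ζ) * v ψ ζ) ∂ν)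
      (∫ ζ, (w ζ * (conj (u' 0 ζ) * v 0 ζ) + w ζ * (conj (u 0 ζ) * v' 0 ζ)) ∂ν) 0 := by
  refine (hasDerivAt_integral_of_dominated_loc_of_deriv_le (s := Set.univ)
    (F' := fun ψ ζ => w ζ * (conj (u' ψ ζ) * v ψ ζ) + w ζ * (conj (u ψ ζ) * v' ψ ζ))
    (bound := fun ζ => ‖w ζ‖ * (C' * D) + ‖w ζ‖ * (C * D')) Filter.univ_mem
    (Eventually.of_forall fun ψ => (hi ψ).aestronglyMeasurable) (hi 0)
    (hi'.add hi'').aestronglyMeasurable (Eventually.of_forall fun ζ ψ _ => ?_)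
    ((hw.norm.mul_const _).add (hw.norm.mul_const _))
    (Eventually.of_forall fun ζ ψ _ => ?_)).2
  · refine (norm_add_le _ _).trans (add_le_add ?_ ?_)
    · rw [norm_mul, norm_mul, RCLike.norm_conj]
      exact mul_le_mul_of_nonneg_left (mul_le_mul (hC' _ _) (hD _ _) (norm_nonneg _) hC0')
        (norm_nonneg _)
    · rw [norm_mul, norm_mul, RCLike.norm_conj]
      exact mul_le_mul_of_nonneg_left (mul_le_mul (hC _ _) (hD' _ _) (norm_nonneg _) hC0)
        (norm_nonneg _)
  · refine (((hu ζ ψ).star.mul (hv ζ ψ)).const_mul (w ζ)).congr_deriv ?_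
    simp only [mul_add, RCLike.star_def]

/-- Infinitesimal invariance: the form is constant along `rotX ψ`, and its derivative at `ψ = 0` is
computed under the integral sign. -/
theorem IsInvariantForm.deriv_eq_zero (h : IsInvariantForm ν w a b) {f f' g g' : S2 → ℂ}
    (hf : Continuous f) (hf' : Continuous f') (hg : Continuous g) (hg' : Continuous g')
    (hdf : ∀ x φ, HasDerivAt (fun ψ => f (rotate (rotX ψ) x)) (f' (rotate (rotX φ) x)) φ)
    (hdg : ∀ x φ, HasDerivAt (fun ψ => g (rotate (rotX ψ) x)) (g' (rotate (rotX φ) x)) φ) :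
    sesqForm ν w a b f' g + sesqForm ν w a b f g' = 0 := by
  obtain ⟨C, hC0, hC⟩ := exists_norm_le_of_continuous hf
  obtain ⟨C', hC0', hC'⟩ := exists_norm_le_of_continuous hf'
  obtain ⟨D, -, hD⟩ := exists_norm_le_of_continuous hg
  obtain ⟨D', -, hD'⟩ := exists_norm_le_of_continuous hg'
  have hi : ∀ {u v : S2 → ℂ}, Continuous u → Continuous v → ∀ ψ : ℝ, Integrable (fun ζ =>
      w ζ * (conj (u (rotate (rotX ψ) (a ζ))) * v (rotate (rotX ψ) (b ζ)))) ν := by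
    intro u v hu hv ψ
    have hR := continuous_rotate (rotX ψ)
    exact h.integrable_mul (f := fun x => u (rotate (rotX ψ) x))
      (g := fun x => v (rotate (rotX ψ) x)) (hu.comp hR) (hv.comp hR)
  have hd := hasDerivAt_integral_conj_mul (ν := ν) (w := w)
    (u := fun ψ ζ => f (rotate (rotX ψ) (a ζ))) (u' := fun ψ ζ => f' (rotate (rotX ψ) (a ζ)))
    (v := fun ψ ζ => g (rotate (rotX ψ) (b ζ))) (v' := fun ψ ζ => g' (rotate (rotX ψ) (b ζ)))
    h.integrable hC0 hC0' (fun _ _ => hC _) (fun _ _ => hC' _) (fun _ _ => hD _) (fun _ _ => hD' _)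
    (hi hf hg) (hi hf' hg 0) (hi hf hg' 0) (fun ζ ψ => hdf (a ζ) ψ) (fun ζ ψ => hdg (b ζ) ψ)
  have hconst : (fun ψ : ℝ => ∫ ζ, w ζ * (conj (f (rotate (rotX ψ) (a ζ))) *
      g (rotate (rotX ψ) (b ζ))) ∂ν) = fun _ => sesqForm ν w a b f g :=
    funext fun ψ => h.invariant _ (isRotation_rotX ψ) f g hf hg
  rw [hconst] at hd
  have e := hd.unique (hasDerivAt_const _ _)
  simp only [rotate_rotX_zero] at e
  rw [sesqForm, sesqForm, ← integral_add (h.integrable_mul hf' hg) (h.integrable_mul hf hg'), ← e]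

theorem sesqForm_harmonic_of_ne (h : IsInvariantForm ν w a b) (ℓ ℓ' : ℕ) {m m' : ℤ}
    (hm : m ≠ m') :
    sesqForm ν w a b (sphericalHarmonic ℓ m) (sphericalHarmonic ℓ' m') = 0 := by
  have hne : ((m' - m : ℤ) : ℝ) ≠ 0 := by exact_mod_cast sub_ne_zero.2 hm.symm
  have e := h.invariant _ (isRotation_rotZ (Real.pi / (m' - m : ℤ))) _ _
    (continuous_sphericalHarmonic ℓ m) (continuous_sphericalHarmonic ℓ' m')
  have e2 : sesqForm ν w a b
      (fun x => sphericalHarmonic ℓ m (rotate (rotZ (Real.pi / (m' - m : ℤ))) x))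
      (fun x => sphericalHarmonic ℓ' m' (rotate (rotZ (Real.pi / (m' - m : ℤ))) x))
      = -sesqForm ν w a b (sphericalHarmonic ℓ m) (sphericalHarmonic ℓ' m') := by
    rw [sesqForm, sesqForm, ← integral_neg]
    refine integral_congr_ae (Eventually.of_forall fun ζ => ?_)
    simp only [sphericalHarmonic_rotZ, map_mul, ← Complex.exp_conj, Complex.conj_ofReal,
      Complex.conj_I, map_intCast]
    -- The angle is chosen so that the two phases multiply to `exp (iπ) = -1`, which makes the form
    -- equal to its own negative.
    have : Complex.exp (m * (Real.pi / (m' - m : ℤ) : ℝ) * -Complex.I)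
        * Complex.exp (m' * (Real.pi / (m' - m : ℤ) : ℝ) * Complex.I) = -1 := by
      rw [← Complex.exp_add, ← Complex.exp_pi_mul_I]
      congr 1
      have hne' : ((m' - m : ℤ) : ℂ) ≠ 0 := by exact_mod_cast sub_ne_zero.2 hm.symm
      push_cast at hne' ⊢
      field_simp
      ring
    linear_combination (w ζ * (conj (sphericalHarmonic ℓ m (a ζ)) *
      sphericalHarmonic ℓ' m' (b ζ))) * this
  rw [e2] at e
  exact self_eq_neg.1 e.symm

theorem sesqForm_add_left (h : IsInvariantForm ν w a b) {f f' g : S2 → ℂ} (hf : Continuous f)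
    (hf' : Continuous f') (hg : Continuous g) (c c' d : ℂ) :
    sesqForm ν w a b (fun x => d * (c * f x + c' * f' x)) g
      = conj d * (conj c * sesqForm ν w a b f g + conj c' * sesqForm ν w a b f' g) := by
  simp only [sesqForm]
  rw [← integral_const_mul, ← integral_const_mul, ← integral_add, ← integral_const_mul]
  · refine integral_congr_ae (Eventually.of_forall fun ζ => ?_)
    simp only [map_mul, map_add]
    ring
  · exact (h.integrable_mul hf hg).const_mul _
  · exact (h.integrable_mul hf' hg).const_mul _

theorem sesqForm_add_right (h : IsInvariantForm ν w a b) {f g g' : S2 → ℂ} (hf : Continuous f)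
    (hg : Continuous g) (hg' : Continuous g') (c c' d : ℂ) :
    sesqForm ν w a b f (fun x => d * (c * g x + c' * g' x))
      = d * (c * sesqForm ν w a b f g + c' * sesqForm ν w a b f g') := by
  simp only [sesqForm]
  rw [← integral_const_mul, ← integral_const_mul, ← integral_add, ← integral_const_mul]
  · refine integral_congr_ae (Eventually.of_forall fun ζ => ?_)
    ring
  · exact (h.integrable_mul hf hg).const_mul _
  · exact (h.integrable_mul hf hg').const_mul _

/-- `deriv_eq_zero` applied to two harmonics; the sign between the sides comes from `conj (i/2) =
-i/2` in the first argument. -/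
theorem sesqForm_ladder (h : IsInvariantForm ν w a b) (ℓ ℓ' : ℕ) (m m' : ℤ) :
    ladderCoeff ℓ m * sesqForm ν w a b (sphericalHarmonic ℓ (m + 1)) (sphericalHarmonic ℓ' m')
      + ladderCoeff ℓ (m - 1) *
        sesqForm ν w a b (sphericalHarmonic ℓ (m - 1)) (sphericalHarmonic ℓ' m')
    = ladderCoeff ℓ' m' * sesqForm ν w a b (sphericalHarmonic ℓ m) (sphericalHarmonic ℓ' (m' + 1))
      + ladderCoeff ℓ' (m' - 1) *
        sesqForm ν w a b (sphericalHarmonic ℓ m) (sphericalHarmonic ℓ' (m' - 1)) := by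
  have hc := continuous_sphericalHarmonic
  have e := h.deriv_eq_zero (hc ℓ m)
    (f' := fun x => Complex.I / 2 * (ladderCoeff ℓ m * sphericalHarmonic ℓ (m + 1) x
        + ladderCoeff ℓ (m - 1) * sphericalHarmonic ℓ (m - 1) x))
    (continuous_const.mul ((continuous_const.mul (hc _ _)).add (continuous_const.mul (hc _ _))))
    (hc ℓ' m')
    (g' := fun x => Complex.I / 2 * (ladderCoeff ℓ' m' * sphericalHarmonic ℓ' (m' + 1) x
        + ladderCoeff ℓ' (m' - 1) * sphericalHarmonic ℓ' (m' - 1) x))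
    (continuous_const.mul ((continuous_const.mul (hc _ _)).add (continuous_const.mul (hc _ _))))
    (hasDerivAt_sphericalHarmonic ℓ m) (hasDerivAt_sphericalHarmonic ℓ' m')
  rw [sesqForm_add_left h (hc _ _) (hc _ _) (hc _ _),
    sesqForm_add_right h (hc _ _) (hc _ _) (hc _ _)] at e
  simp only [map_div₀, Complex.conj_I, map_ofNat, Complex.conj_ofReal] at e
  linear_combination (2 * Complex.I) * e + (ladderCoeff ℓ m *
      sesqForm ν w a b (sphericalHarmonic ℓ (m + 1)) (sphericalHarmonic ℓ' m')
      + ladderCoeff ℓ (m - 1) *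
        sesqForm ν w a b (sphericalHarmonic ℓ (m - 1)) (sphericalHarmonic ℓ' m')
    - ladderCoeff ℓ' m' * sesqForm ν w a b (sphericalHarmonic ℓ m) (sphericalHarmonic ℓ' (m' + 1))
      - ladderCoeff ℓ' (m' - 1) *
        sesqForm ν w a b (sphericalHarmonic ℓ m) (sphericalHarmonic ℓ' (m' - 1))) * Complex.I_sq

/-- In `sesqForm_ladder` with `m' = m + 1`, the terms of unequal order drop out and one term remains
on each side. -/
theorem sesqForm_ladder_up (h : IsInvariantForm ν w a b) (ℓ ℓ' : ℕ) (m : ℤ) :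
    ladderCoeff ℓ m *
        sesqForm ν w a b (sphericalHarmonic ℓ (m + 1)) (sphericalHarmonic ℓ' (m + 1))
      = ladderCoeff ℓ' m * sesqForm ν w a b (sphericalHarmonic ℓ m) (sphericalHarmonic ℓ' m) := by
  have e := sesqForm_ladder h ℓ ℓ' m (m + 1)
  rw [sesqForm_harmonic_of_ne h ℓ ℓ' (show m - 1 ≠ m + 1 by omega),
    sesqForm_harmonic_of_ne h ℓ ℓ' (show m ≠ m + 1 + 1 by omega), add_sub_cancel_right] at e
  simpa using e

theorem sesqForm_ladder_down (h : IsInvariantForm ν w a b) (ℓ ℓ' : ℕ) (m : ℤ) :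
    ladderCoeff ℓ m * sesqForm ν w a b (sphericalHarmonic ℓ m) (sphericalHarmonic ℓ' m)
      = ladderCoeff ℓ' m *
        sesqForm ν w a b (sphericalHarmonic ℓ (m + 1)) (sphericalHarmonic ℓ' (m + 1)) := by
  have e := sesqForm_ladder h ℓ ℓ' (m + 1) m
  rw [sesqForm_harmonic_of_ne h ℓ ℓ' (show m + 1 + 1 ≠ m by omega),
    sesqForm_harmonic_of_ne h ℓ ℓ' (show m + 1 ≠ m - 1 by omega), add_sub_cancel_right] at e
  simpa using e

/-- An invariant form is a multiple of the identity on each space of spherical harmonics, and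
these spaces are orthogonal for it. -/
theorem sesqForm_harmonic (h : IsInvariantForm ν w a b) {ℓ ℓ' : ℕ} {m m' : ℤ}
    (hm : m ∈ Finset.Icc (-(ℓ : ℤ)) ℓ) (hm' : m' ∈ Finset.Icc (-(ℓ' : ℤ)) ℓ') :
    sesqForm ν w a b (sphericalHarmonic ℓ m) (sphericalHarmonic ℓ' m')
      = if ℓ = ℓ' ∧ m = m' then
          sesqForm ν w a b (sphericalHarmonic ℓ 0) (sphericalHarmonic ℓ 0) else 0 := by
  rw [Finset.mem_Icc] at hm hm'
  rcases ne_or_eq m m' with hmm | rfl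
  · rw [sesqForm_harmonic_of_ne h ℓ ℓ' hmm, if_neg (fun q => hmm q.2)]
  rcases ne_or_eq ℓ ℓ' with hl | rfl
  · rw [if_neg (fun q => hl q.1)]
    have e1 := sesqForm_ladder_up h ℓ ℓ' m
    have e2 := sesqForm_ladder_down h ℓ ℓ' m
    have s1 := congrArg (fun r : ℝ => (r : ℂ))
      (ladderCoeff_sq (ℓ := ℓ) (m := m) (by omega) (by omega))
    have s2 := congrArg (fun r : ℝ => (r : ℂ))
      (ladderCoeff_sq (ℓ := ℓ') (m := m) (by omega) (by omega))
    push_cast at s1 s2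
    -- This is the difference of the eigenvalues `ℓ(ℓ+1) - ℓ'(ℓ'+1)`, equal to the difference of the
    -- squared ladder coefficients. Eliminating the form of order `m + 1` from the up and down
    -- relations leaves it times the form of order `m`.
    have hne : ((ℓ : ℂ) - ℓ') * ((ℓ : ℂ) + ℓ' + 1) ≠ 0 := by
      refine mul_ne_zero (sub_ne_zero.2 (by exact_mod_cast hl)) ?_
      exact_mod_cast Nat.succ_ne_zero (ℓ + ℓ')
    refine (mul_eq_zero.1 (?_ : (((ℓ : ℂ) - ℓ') * ((ℓ : ℂ) + ℓ' + 1)) * _ = 0)).resolve_left hne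
    linear_combination (ladderCoeff ℓ m : ℂ) * e2 + (ladderCoeff ℓ' m : ℂ) * e1
      - sesqForm ν w a b (sphericalHarmonic ℓ m) (sphericalHarmonic ℓ' m) * (s1 - s2)
  · rw [if_pos ⟨rfl, rfl⟩]
    -- For equal degrees the common ladder coefficient is positive strictly below the top order and
    -- can be cancelled.
    have step : ∀ j : ℤ, -(ℓ : ℤ) ≤ j → j < ℓ →
        sesqForm ν w a b (sphericalHarmonic ℓ (j + 1)) (sphericalHarmonic ℓ (j + 1))
          = sesqForm ν w a b (sphericalHarmonic ℓ j) (sphericalHarmonic ℓ j) := by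
      intro j h1 h2
      refine mul_left_cancel₀ ?_ (sesqForm_ladder_up h ℓ ℓ j)
      have : 0 < ladderCoeff ℓ j := by
        refine Real.sqrt_pos.2 ?_
        have h1 : -(ℓ : ℝ) ≤ j := by exact_mod_cast h1
        have h2 : (j : ℝ) + 1 ≤ ℓ := by exact_mod_cast h2
        nlinarith
      exact_mod_cast this.ne'
    have up : ∀ k : ℕ, k ≤ ℓ →
        sesqForm ν w a b (sphericalHarmonic ℓ k) (sphericalHarmonic ℓ k)
          = sesqForm ν w a b (sphericalHarmonic ℓ 0) (sphericalHarmonic ℓ 0) := by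
      intro k hk
      induction k with
      | zero => rfl
      | succ k ih =>
        rw [← ih (by omega), ← step k (by omega) (by omega)]
        norm_cast
    have down : ∀ k : ℕ, k ≤ ℓ →
        sesqForm ν w a b (sphericalHarmonic ℓ (-k)) (sphericalHarmonic ℓ (-k))
          = sesqForm ν w a b (sphericalHarmonic ℓ 0) (sphericalHarmonic ℓ 0) := by
      intro k hk
      induction k with
      | zero => rfl
      | succ k ih =>
        rw [← ih (by omega), show -(k : ℤ) = -((k + 1 : ℕ) : ℤ) + 1 by push_cast; ring,
          step _ (by omega) (by omega)]
    rcases le_or_gt 0 m with h0 | h0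
    · lift m to ℕ using h0
      exact up m (by omega)
    · obtain ⟨k, rfl⟩ : ∃ k : ℕ, m = -(k : ℤ) := ⟨m.natAbs, by omega⟩
      exact down k (by omega)

end Forms

theorem isInvariantForm_sphereMeasure :
    IsInvariantForm sphereMeasure (fun _ => 1) id id where
  integrable := integrable_const _
  measurable_left := measurable_id
  measurable_right := measurable_id
  invariant R _ f g hf hg := by
    have := (measurePreserving_rotate R).integral_comp' (f := 
      (Homeomorph.toMeasurableEquiv 
        ⟨⟨rotate R, rotate R.symm, fun x => Subtype.ext (R.symm_apply_apply _),
          fun x => Subtype.ext (R.apply_symm_apply _)⟩, continuous_rotate R,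
          continuous_rotate R.symm⟩))
      (fun x => 1 * (conj (f x) * g x))
    exact this

/-- The spherical harmonics are orthonormal. -/
theorem integral_conj_harmonic_mul {ℓ ℓ' : ℕ} {m m' : ℤ}
    (hm : m ∈ Finset.Icc (-(ℓ : ℤ)) ℓ) (hm' : m' ∈ Finset.Icc (-(ℓ' : ℤ)) ℓ') :
    ∫ x, conj (sphericalHarmonic ℓ m x) * sphericalHarmonic ℓ' m' x ∂sphereMeasure
      = if ℓ = ℓ' ∧ m = m' then 1 else 0 := by
  have h := isInvariantForm_sphereMeasure
  have key : ∀ {ℓ ℓ' : ℕ} {m m' : ℤ}, sesqForm sphereMeasure (fun _ => 1) id id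
      (sphericalHarmonic ℓ m) (sphericalHarmonic ℓ' m')
      = ∫ x, conj (sphericalHarmonic ℓ m x) * sphericalHarmonic ℓ' m' x ∂sphereMeasure := by
    intro ℓ ℓ' m m'
    simp [sesqForm]
  have h1 : sesqForm sphereMeasure (fun _ => 1) id id
      (sphericalHarmonic ℓ 0) (sphericalHarmonic ℓ 0) = 1 := by
    -- The constant is found by integrating the addition theorem on the diagonal: `2ℓ + 1` equal
    -- terms sum to `2ℓ + 1`.
    have hi : ∫ x, harmonicKernel ℓ x x ∂sphereMeasure = 2 * ℓ + 1 := by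
      simp [harmonicKernel_self]
    have hs : ∫ x, harmonicKernel ℓ x x ∂sphereMeasure = (2 * ℓ + 1) *
        sesqForm sphereMeasure (fun _ => 1) id id
          (sphericalHarmonic ℓ 0) (sphericalHarmonic ℓ 0) := by
      simp only [harmonicKernel]
      rw [integral_finsetSum]
      · rw [Finset.sum_congr rfl (g := fun _ => sesqForm sphereMeasure (fun _ => 1) id id
          (sphericalHarmonic ℓ 0) (sphericalHarmonic ℓ 0))]
        · rw [Finset.sum_const, Int.card_Icc, nsmul_eq_mul]
          congr 1
          rw [show ((ℓ : ℤ) + 1 - -ℓ).toNat = 2 * ℓ + 1 by omega]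
          push_cast
          ring
        · intro m hm
          have := sesqForm_harmonic h hm hm
          rw [if_pos ⟨rfl, rfl⟩, key] at this
          rw [← this]
          exact integral_congr_ae (Eventually.of_forall fun x => mul_comm _ _)
      · intro m _
        have := h.integrable_mul (continuous_sphericalHarmonic ℓ m) (continuous_sphericalHarmonic ℓ m)
        refine this.congr (Eventually.of_forall fun x => ?_)
        simp [mul_comm]
    have hne : (2 * (ℓ : ℂ) + 1) ≠ 0 := by exact_mod_cast Nat.succ_ne_zero (2 * ℓ)
    rw [hi] at hs
    exact mul_left_cancel₀ hne (by rw [← hs, mul_one])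
  rw [← key, sesqForm_harmonic h hm hm', h1]

/-! ### Convergence in the square mean -/

section SquareMean

variable {X : Type*} [MeasurableSpace X] {ρ : Measure X} {𝕜 : Type*} [RCLike 𝕜]

theorem integral_mul_conj_eq_inner {f g : X → 𝕜} (hf : MemLp f 2 ρ) (hg : MemLp g 2 ρ) :
    ∫ x, f x * (starRingEnd 𝕜) (g x) ∂ρ = inner 𝕜 (hg.toLp g) (hf.toLp f) := by
  rw [L2.inner_def]
  refine integral_congr_ae ?_
  filter_upwards [hf.coeFn_toLp, hg.coeFn_toLp] with x h1 h2
  rw [h1, h2, RCLike.inner_apply]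

theorem integral_mul_conj_tendsto {f g : ℕ → X → 𝕜} {f' g' : X → 𝕜}
    (hf : ∀ n, MemLp (f n) 2 ρ) (hg : ∀ n, MemLp (g n) 2 ρ) (hf' : MemLp f' 2 ρ)
    (hg' : MemLp g' 2 ρ)
    (h1 : Tendsto (fun n => eLpNorm (f n - f') 2 ρ) atTop (𝓝 0))
    (h2 : Tendsto (fun n => eLpNorm (g n - g') 2 ρ) atTop (𝓝 0)) :
    Tendsto (fun n => ∫ x, f n x * (starRingEnd 𝕜) (g n x) ∂ρ) atTop
      (𝓝 (∫ x, f' x * (starRingEnd 𝕜) (g' x) ∂ρ)) := by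
  simp only [integral_mul_conj_eq_inner (hf _) (hg _), integral_mul_conj_eq_inner hf' hg']
  exact ((Lp.tendsto_Lp_iff_tendsto_eLpNorm'' g hg g' hg').2 h2).inner
    ((Lp.tendsto_Lp_iff_tendsto_eLpNorm'' f hf f' hf').2 h1)

theorem eLpNorm_two_eq {f : X → 𝕜} (hf : MemLp f 2 ρ) :
    eLpNorm f 2 ρ = ENNReal.ofReal (Real.sqrt (∫ x, ‖f x‖ ^ 2 ∂ρ)) := by
  rw [hf.eLpNorm_eq_integral_rpow_norm two_ne_zero ENNReal.ofNat_ne_top, Real.sqrt_eq_rpow]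
  simp

theorem integrable_mul_conj {f g : X → 𝕜} (hf : MemLp f 2 ρ) (hg : MemLp g 2 ρ) :
    Integrable (fun x => f x * (starRingEnd 𝕜) (g x)) ρ :=
  MemLp.integrable_mul hf (hg.star)

theorem ae_eq_of_tendsto_eLpNorm {f : ℕ → X → 𝕜} {g h : X → 𝕜}
    (hf : ∀ n, AEStronglyMeasurable (f n) ρ) (hg : AEStronglyMeasurable g ρ)
    (hh : AEStronglyMeasurable h ρ)
    (h1 : Tendsto (fun n => eLpNorm (f n - g) 2 ρ) atTop (𝓝 0))
    (h2 : Tendsto (fun n => eLpNorm (f n - h) 2 ρ) atTop (𝓝 0)) : g =ᵐ[ρ] h := by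
  have h0 : eLpNorm (g - h) 2 ρ = 0 := by
    refine le_antisymm ?_ zero_le
    have h3 := h1.add h2
    rw [add_zero] at h3
    refine ge_of_tendsto' h3 fun n => ?_
    have e : g - h = (f n - h) - (f n - g) := by abel
    rw [e, add_comm]
    exact eLpNorm_sub_le ((hf n).sub hh) ((hf n).sub hg) one_le_two
  rw [eLpNorm_eq_zero_iff (hg.sub hh) two_ne_zero] at h0
  filter_upwards [h0] with x hx
  exact sub_eq_zero.1 hx

theorem memLp_of_tendsto_eLpNorm {f : ℕ → X → 𝕜} {g : X → 𝕜} (hf : ∀ n, MemLp (f n) 2 ρ)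
    (hg : AEStronglyMeasurable g ρ)
    (h : Tendsto (fun n => eLpNorm (f n - g) 2 ρ) atTop (𝓝 0)) : MemLp g 2 ρ := by
  obtain ⟨n, hn⟩ := (h.eventually_lt_const (u := 1) zero_lt_one).exists
  have : MemLp (f n - g) 2 ρ := ⟨(hf n).1.sub hg, hn.trans ENNReal.one_lt_top⟩
  simpa using (hf n).sub this

end SquareMean

/-- The surface measure has total mass one, so a bound uniform in `x` survives integration over the
sphere. -/
theorem eLpNorm_prod_le {Ω : Type*} [MeasurableSpace Ω] {P : Measure Ω} [SFinite P]
    {F : Ω × S2 → ℂ} (hF : AEStronglyMeasurable F (P.prod sphereMeasure)) {ε : ℝ≥0∞}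
    (h : ∀ x, eLpNorm (fun ω => F (ω, x)) 2 P ≤ ε) :
    eLpNorm F 2 (P.prod sphereMeasure) ≤ ε := by
  rw [eLpNorm_eq_lintegral_rpow_enorm_toReal two_ne_zero ENNReal.ofNat_ne_top,
    lintegral_prod_symm _ (hF.enorm.pow_const _)]
  have h' : ∀ x, ∫⁻ ω, ‖F (ω, x)‖ₑ ^ (2 : ℝ≥0∞).toReal ∂P ≤ ε ^ (2 : ℝ≥0∞).toReal := by
    intro x
    have hx := h x
    rw [eLpNorm_eq_lintegral_rpow_enorm_toReal two_ne_zero ENNReal.ofNat_ne_top] at hx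
    have := ENNReal.rpow_le_rpow (z := (2 : ℝ≥0∞).toReal) hx (by simp)
    rwa [← ENNReal.rpow_mul, one_div, inv_mul_cancel₀ (by simp), ENNReal.rpow_one] at this
  calc _ ≤ (∫⁻ _ : S2, ε ^ (2 : ℝ≥0∞).toReal ∂sphereMeasure) ^ (1 / (2 : ℝ≥0∞).toReal) :=
        ENNReal.rpow_le_rpow (lintegral_mono h') (by simp)
    _ = ε := by
        rw [lintegral_const, measure_univ, mul_one, ← ENNReal.rpow_mul, one_div,
          mul_inv_cancel₀ (by simp), ENNReal.rpow_one]

/-! ### Expansions with uncorrelated coefficients -/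

section Expansion

/-- The sum `∑_{ℓ ∈ F} ∑_{|m| ≤ ℓ} a_{ℓ,m}(ω) Y_{ℓ,m}(x)`. -/
noncomputable def degreeSum {Ω : Type*} (a : ℕ → ℤ → Ω → ℂ) (F : Finset ℕ) (x : S2) (ω : Ω) : ℂ :=
  ∑ ℓ ∈ F, ∑ m ∈ Finset.Icc (-(ℓ : ℤ)) ℓ, a ℓ m ω * sphericalHarmonic ℓ m x

theorem partialSum_eq_degreeSum {Ω : Type*} (a : ℕ → ℤ → Ω → ℂ) (L : ℕ) :
    partialSum a L = degreeSum a (Finset.range (L + 1)) := rfl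

theorem integral_partialSum_mul_conj {Ω : Type*} (a : ℕ → ℤ → Ω → ℂ) {ℓ : ℕ} {m : ℤ}
    (hm : m ∈ Finset.Icc (-(ℓ : ℤ)) ℓ) {L : ℕ}
    (hL : ℓ ≤ L) (ω : Ω) :
    ∫ x, partialSum a L x ω * conj (sphericalHarmonic ℓ m x) ∂sphereMeasure = a ℓ m ω := by
  have hi : ∀ (ℓ' : ℕ) (m' : ℤ), Integrable (fun x => a ℓ' m' ω * (conj (sphericalHarmonic ℓ m x) *
      sphericalHarmonic ℓ' m' x)) sphereMeasure := by
    intro ℓ' m'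
    have := isInvariantForm_sphereMeasure.integrable_mul (continuous_sphericalHarmonic ℓ m)
      (continuous_sphericalHarmonic ℓ' m')
    exact (this.const_mul (a ℓ' m' ω)).congr (Eventually.of_forall fun x => by simp)
  calc ∫ x, partialSum a L x ω * conj (sphericalHarmonic ℓ m x) ∂sphereMeasure
      = ∫ x, ∑ ℓ' ∈ Finset.range (L + 1), ∑ m' ∈ Finset.Icc (-(ℓ' : ℤ)) ℓ',
          a ℓ' m' ω * (conj (sphericalHarmonic ℓ m x) *
            sphericalHarmonic ℓ' m' x) ∂sphereMeasure := by
        refine integral_congr_ae (Eventually.of_forall fun x => ?_)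
        simp only [partialSum, Finset.sum_mul]
        exact Finset.sum_congr rfl fun p _ => Finset.sum_congr rfl fun q _ => by ring
    _ = ∑ ℓ' ∈ Finset.range (L + 1), ∑ m' ∈ Finset.Icc (-(ℓ' : ℤ)) ℓ',
          a ℓ' m' ω * (if ℓ = ℓ' ∧ m = m' then 1 else 0) := by
        rw [integral_finsetSum _ fun ℓ' _ => integrable_finsetSum _ fun m' _ => hi ℓ' m']
        refine Finset.sum_congr rfl fun ℓ' _ => ?_
        rw [integral_finsetSum _ fun m' _ => hi ℓ' m']
        refine Finset.sum_congr rfl fun m' hm' => ?_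
        rw [integral_const_mul, integral_conj_harmonic_mul hm hm']
    _ = a ℓ m ω := by
        rw [Finset.sum_eq_single_of_mem ℓ (Finset.mem_range.2 (by omega)),
          Finset.sum_eq_single_of_mem m hm]
        · simp
        · intro m' _ hne
          rw [if_neg (fun q => hne q.2.symm), mul_zero]
        · intro ℓ' _ hne
          exact Finset.sum_eq_zero fun m' _ => by rw [if_neg (fun q => hne q.1.symm), mul_zero]

variable {Ω : Type*} [MeasurableSpace Ω] {P : Measure Ω}

/-- The family `a` consists of square integrable, uncorrelated coefficients of a real field, with
angular power spectrum `v`. -/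
structure IsSpectralFamily (P : Measure Ω) (a : ℕ → ℤ → Ω → ℂ) (v : ℕ → ℝ) : Prop where
  memLp : ∀ (ℓ : ℕ) (m : ℤ), m ∈ Finset.Icc (-(ℓ : ℤ)) ℓ → MemLp (a ℓ m) 2 P
  cov : ∀ (ℓ ℓ' : ℕ) (m m' : ℤ), m ∈ Finset.Icc (-(ℓ : ℤ)) ℓ → m' ∈ Finset.Icc (-(ℓ' : ℤ)) ℓ' →
    ∫ ω, a ℓ m ω * conj (a ℓ' m' ω) ∂P = if ℓ = ℓ' ∧ m = m' then (v ℓ : ℂ) else 0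
  real : ∀ (ℓ : ℕ) (m : ℤ), m ∈ Finset.Icc (-(ℓ : ℤ)) ℓ →
    ∀ᵐ ω ∂P, a ℓ (-m) ω = (-1) ^ m.natAbs * conj (a ℓ m ω)
  summable : Summable fun ℓ : ℕ => (2 * (ℓ : ℝ) + 1) * v ℓ

namespace IsSpectralFamily

variable {a : ℕ → ℤ → Ω → ℂ} {v : ℕ → ℝ} (h : IsSpectralFamily P a v)

include h in
theorem memLp_degreeSum (F : Finset ℕ) (x : S2) : MemLp (degreeSum a F x) 2 P :=
  memLp_finsetSum F fun ℓ _ => memLp_finsetSum _ fun m hm => (h.memLp ℓ m hm).mul_const _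

include h in
-- Only the diagonal covariances survive, and as they do not depend on `m` the harmonics assemble
-- into the kernel.
theorem integral_degreeSum (F : Finset ℕ) (x y : S2) :
    ∫ ω, degreeSum a F x ω * conj (degreeSum a F y ω) ∂P
      = ∑ ℓ ∈ F, (v ℓ : ℂ) * harmonicKernel ℓ x y := by
  let I : Finset (Σ _ : ℕ, ℤ) := F.sigma fun ℓ => Finset.Icc (-(ℓ : ℤ)) ℓ
  have hI : ∀ p ∈ I, p.2 ∈ Finset.Icc (-(p.1 : ℤ)) p.1 := fun p hp => (Finset.mem_sigma.1 hp).2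
  have hs : ∀ z ω, degreeSum a F z ω = ∑ p ∈ I, a p.1 p.2 ω * sphericalHarmonic p.1 p.2 z :=
    fun z ω => (Finset.sum_sigma F (fun ℓ => Finset.Icc (-(ℓ : ℤ)) ℓ)
      fun p => a p.1 p.2 ω * sphericalHarmonic p.1 p.2 z).symm
  have hint : ∀ p ∈ I, ∀ q ∈ I, Integrable (fun ω =>
      (a p.1 p.2 ω * conj (a q.1 q.2 ω)) *
        (sphericalHarmonic p.1 p.2 x * conj (sphericalHarmonic q.1 q.2 y))) P := fun p hp q hq =>
    (integrable_mul_conj (h.memLp _ _ (hI p hp)) (h.memLp _ _ (hI q hq))).mul_const _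
  calc ∫ ω, degreeSum a F x ω * conj (degreeSum a F y ω) ∂P
      = ∫ ω, ∑ p ∈ I, ∑ q ∈ I, (a p.1 p.2 ω * conj (a q.1 q.2 ω)) *
        (sphericalHarmonic p.1 p.2 x * conj (sphericalHarmonic q.1 q.2 y)) ∂P := by
        refine integral_congr_ae (Eventually.of_forall fun ω => ?_)
        simp only [hs, map_sum, Finset.sum_mul_sum, map_mul]
        exact Finset.sum_congr rfl fun p _ => Finset.sum_congr rfl fun q _ => by ring
    _ = ∑ p ∈ I, ∑ q ∈ I, (if p = q then (v p.1 : ℂ) else 0) *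
        (sphericalHarmonic p.1 p.2 x * conj (sphericalHarmonic q.1 q.2 y)) := by
        rw [integral_finsetSum _ fun p hp => integrable_finsetSum _ (hint p hp)]
        refine Finset.sum_congr rfl fun p hp => ?_
        rw [integral_finsetSum _ (hint p hp)]
        refine Finset.sum_congr rfl fun q hq => ?_
        rw [integral_mul_const, h.cov _ _ _ _ (hI p hp) (hI q hq)]
        congr 2
        rw [Sigma.ext_iff, heq_iff_eq]
    _ = ∑ p ∈ I, (v p.1 : ℂ) *
        (sphericalHarmonic p.1 p.2 x * conj (sphericalHarmonic p.1 p.2 y)) := by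
        refine Finset.sum_congr rfl fun p hp => ?_
        rw [Finset.sum_eq_single_of_mem p hp fun q _ hq => by rw [if_neg hq.symm, zero_mul],
          if_pos rfl]
    _ = _ := by
        rw [Finset.sum_sigma]
        simp only [harmonicKernel, Finset.mul_sum]

include h in
-- The right-hand side is free of `x` because `harmonicKernel ℓ x x = 2ℓ + 1`; this is the source of
-- uniform convergence.
theorem eLpNorm_degreeSum (F : Finset ℕ) (x : S2) :
    eLpNorm (degreeSum a F x) 2 P
      = ENNReal.ofReal (Real.sqrt (∑ ℓ ∈ F, (2 * (ℓ : ℝ) + 1) * v ℓ)) := by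
  rw [eLpNorm_two_eq (h.memLp_degreeSum F x)]
  congr 2
  have e := h.integral_degreeSum F x x
  simp only [harmonicKernel_self] at e
  have : ∫ ω, degreeSum a F x ω * conj (degreeSum a F x ω) ∂P
      = ((∫ ω, ‖degreeSum a F x ω‖ ^ 2 ∂P : ℝ) : ℂ) := by
    rw [← integral_complex_ofReal]
    exact integral_congr_ae (Eventually.of_forall fun ω => by simp [Complex.mul_conj'])
  rw [this] at e
  apply Complex.ofReal_injective
  rw [e]
  push_cast
  exact Finset.sum_congr rfl fun ℓ _ => mul_comm _ _

include h in
theorem exists_eLpNorm_sub_lt {ε : ℝ} (hε : 0 < ε) : ∃ N : ℕ, ∀ L L' : ℕ, N ≤ L → N ≤ L' →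
    ∀ x, eLpNorm (partialSum a L x - partialSum a L' x) 2 P < ENNReal.ofReal ε := by
  obtain ⟨s, hs⟩ := summable_iff_vanishing_norm.1 h.summable (ε ^ 2) (by positivity)
  obtain ⟨N, hN⟩ := s.exists_nat_subset_range
  have key : ∀ L L' : ℕ, N ≤ L → L ≤ L' → ∀ x,
      eLpNorm (partialSum a L' x - partialSum a L x) 2 P < ENNReal.ofReal ε := by
    intro L L' hL hLL x
    have hsub : partialSum a L' x - partialSum a L x
        = degreeSum a (Finset.Ico (L + 1) (L' + 1)) x := by
      funext ω
      simp only [Pi.sub_apply, partialSum_eq_degreeSum, degreeSum]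
      rw [Finset.sum_Ico_eq_sub _ (by omega)]
    rw [hsub, h.eLpNorm_degreeSum]
    refine (ENNReal.ofReal_lt_ofReal_iff hε).2 ?_
    rw [Real.sqrt_lt' hε]
    refine (le_abs_self _).trans_lt (hs _ ?_)
    rw [Finset.disjoint_left]
    intro j hj hjs
    have h1 := Finset.mem_Ico.1 hj
    have h2 := Finset.mem_range.1 (hN hjs)
    omega
  refine ⟨N, fun L L' hL hL' x => ?_⟩
  rcases le_total L L' with hl | hl
  · rw [eLpNorm_sub_comm]
    exact key L L' hL hl x
  · exact key L' L hL' hl x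

include h in
-- Conjugation of the sum amounts to the reindexing `m ↦ -m`.
theorem ae_im_partialSum (L : ℕ) (x : S2) : ∀ᵐ ω ∂P, (partialSum a L x ω).im = 0 := by
  have hall : ∀ᵐ ω ∂P, ∀ ℓ : ℕ, ∀ m : ℤ, m ∈ Finset.Icc (-(ℓ : ℤ)) ℓ →
      a ℓ (-m) ω = (-1) ^ m.natAbs * conj (a ℓ m ω) := by
    rw [ae_all_iff]; intro ℓ
    rw [ae_all_iff]; intro m
    by_cases hm : m ∈ Finset.Icc (-(ℓ : ℤ)) ℓ
    · filter_upwards [h.real ℓ m hm] with ω hω _ using hω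
    · exact Eventually.of_forall fun ω hm' => absurd hm' hm
  filter_upwards [hall] with ω hω
  rw [← Complex.conj_eq_iff_im, partialSum, map_sum]
  refine Finset.sum_congr rfl fun ℓ _ => ?_
  rw [map_sum]
  refine Finset.sum_nbij' (fun m => -m) (fun m => -m) ?_ ?_ (by simp) (by simp) ?_
  · intro m hm; rw [Finset.mem_Icc] at hm ⊢; omega
  · intro m hm; rw [Finset.mem_Icc] at hm ⊢; omega
  · intro m hm
    rw [hω ℓ m hm, sphericalHarmonic_neg, map_mul]
    have : (-1 : ℂ) ^ m.natAbs * (-1) ^ m.natAbs = 1 := by rw [← mul_pow]; simp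
    linear_combination (-(conj (a ℓ m ω) * conj (sphericalHarmonic ℓ m x))) * this

include h in
/-- The expansion has a sum at every point of the sphere, uniformly in the square mean. -/
theorem exists_uniform_sum : ∃ V : S2 → Ω → ℝ, IsRandomField V ∧
    ∀ ε : ℝ, 0 < ε → ∃ N : ℕ, ∀ L, N ≤ L → ∀ x,
      eLpNorm (fun ω => partialSum a L x ω - (V x ω : ℂ)) 2 P ≤ ENNReal.ofReal ε := by
  -- The coefficients are only almost everywhere measurable; joint measurability of the limit field
  -- requires measurable versions, and their exceptional null set does not depend on `x`.
  have hb : ∀ (ℓ : ℕ) (m : ℤ), ∃ b : Ω → ℂ, Measurable b ∧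
      (m ∈ Finset.Icc (-(ℓ : ℤ)) ℓ → a ℓ m =ᵐ[P] b) := by
    intro ℓ m
    by_cases hm : m ∈ Finset.Icc (-(ℓ : ℤ)) ℓ
    · exact ⟨(h.memLp ℓ m hm).1.mk, (h.memLp ℓ m hm).1.stronglyMeasurable_mk.measurable,
        fun _ => (h.memLp ℓ m hm).1.ae_eq_mk⟩
    · exact ⟨0, measurable_const, fun hm' => absurd hm' hm⟩
  choose b hbm hba using hb
  have hab : ∀ᵐ ω ∂P, ∀ x L, partialSum a L x ω = partialSum b L x ω := by
    have hall : ∀ᵐ ω ∂P, ∀ ℓ : ℕ, ∀ m : ℤ, m ∈ Finset.Icc (-(ℓ : ℤ)) ℓ → a ℓ m ω = b ℓ m ω := by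
      rw [ae_all_iff]; intro ℓ
      rw [ae_all_iff]; intro m
      by_cases hm : m ∈ Finset.Icc (-(ℓ : ℤ)) ℓ
      · filter_upwards [hba ℓ m hm] with ω hω _ using hω
      · exact Eventually.of_forall fun ω hm' => absurd hm' hm
    filter_upwards [hall] with ω hω x L
    exact Finset.sum_congr rfl fun ℓ _ => Finset.sum_congr rfl fun m hm => by rw [hω ℓ m hm]
  have hN := fun k : ℕ => h.exists_eLpNorm_sub_lt (ε := (1 / 2 : ℝ) ^ k) (by positivity)
  choose N hN using hN
  -- Adding up the thresholds makes `φ n` exceed all `N k` with `k ≤ n`.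
  let φ : ℕ → ℕ := fun k => ∑ j ∈ Finset.range (k + 1), N j
  have hφ : ∀ k n, k ≤ n → N k ≤ φ n := fun k n hkn =>
    Finset.single_le_sum (f := N) (fun _ _ => Nat.zero_le _) (Finset.mem_range.2 (by omega))
  have hmeas : ∀ L, Measurable fun p : Ω × S2 => partialSum b L p.2 p.1 := by
    intro L
    refine Finset.measurable_fun_sum _ fun ℓ _ => Finset.measurable_fun_sum _ fun m _ => ?_
    exact ((hbm ℓ m).comp measurable_fst).mul
      ((continuous_sphericalHarmonic ℓ m).measurable.comp measurable_snd)
  -- Almost sure limit along a subsequence with summable errors. Where no limit exists `limUnder`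
  -- takes a default value, and the resulting function is still jointly measurable.
  let V : S2 → Ω → ℝ := fun x ω => limUnder atTop fun k => (partialSum b (φ k) x ω).re
  have hV : IsRandomField V :=
    (StronglyMeasurable.limUnder (l := atTop) (f := fun (k : ℕ) (p : Ω × S2) =>
      (partialSum b (φ k) p.2 p.1).re)
      fun k => (Complex.measurable_re.comp (hmeas (φ k))).stronglyMeasurable).measurable
  have hm : ∀ L x, AEStronglyMeasurable (partialSum a L x) P := fun L x =>
    (h.memLp_degreeSum _ x).1
  have hB : ∑' k : ℕ, ENNReal.ofReal ((1 / 2 : ℝ) ^ k) ≠ ⊤ := by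
    rw [← ENNReal.ofReal_tsum_of_nonneg (fun k => by positivity)
      (summable_geometric_of_lt_one (by norm_num) (by norm_num))]
    exact ENNReal.ofReal_ne_top
  have hcau : ∀ x, ∀ k n m : ℕ, k ≤ n → k ≤ m →
      eLpNorm (partialSum a (φ n) x - partialSum a (φ m) x) 2 P < ENNReal.ofReal ((1 / 2 : ℝ) ^ k) :=
    fun x k n m hn hm => hN k _ _ (hφ k n hn) (hφ k m hm) x
  have hlim : ∀ x, ∀ᵐ ω ∂P,
      Tendsto (fun k => partialSum a (φ k) x ω) atTop (𝓝 (V x ω : ℂ)) := by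
    intro x
    filter_upwards [Lp.ae_tendsto_of_cauchy_eLpNorm (fun k => hm (φ k) x) one_le_two hB (hcau x),
      hab, ae_all_iff.2 fun L => h.ae_im_partialSum L x] with ω ⟨l, hl⟩ hω him
    have hre : Tendsto (fun k => (partialSum b (φ k) x ω).re) atTop (𝓝 l.re) := by
      simp only [← hω]
      exact (Complex.continuous_re.tendsto l).comp hl
    have him' : l.im = 0 := by
      refine tendsto_nhds_unique ((Complex.continuous_im.tendsto l).comp hl) ?_
      simp only [Function.comp_def, him]
      exact tendsto_const_nhds
    have : (V x ω : ℂ) = l := by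
      refine Complex.ext ?_ ?_
      · rw [Complex.ofReal_re]; exact hre.limUnder_eq
      · rw [Complex.ofReal_im, him']
    rwa [this]
  have hconv : ∀ x, Tendsto (fun k => eLpNorm (partialSum a (φ k) x - fun ω => (V x ω : ℂ)) 2 P)
      atTop (𝓝 0) := fun x =>
    Lp.cauchy_tendsto_of_tendsto (fun k => hm (φ k) x) _ hB (hcau x) (hlim x)
  refine ⟨V, hV, fun ε hε => ?_⟩
  obtain ⟨k, hk⟩ := exists_pow_lt_of_lt_one hε (show (1 / 2 : ℝ) < 1 by norm_num)
  refine ⟨N k, fun L hL x => ?_⟩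
  have hVx : AEStronglyMeasurable (fun ω => (V x ω : ℂ)) P :=
    (Complex.measurable_ofReal.comp (hV.comp measurable_prodMk_right)).aestronglyMeasurable
  have h3 := (hconv x).const_add (ENNReal.ofReal ε)
  rw [add_zero] at h3
  refine ge_of_tendsto h3 ?_
  filter_upwards [eventually_ge_atTop k] with n hn
  -- The bound along the full sequence comes from comparison with `φ n` and letting `n` tend to
  -- infinity.
  have e : (fun ω => partialSum a L x ω - (V x ω : ℂ))
      = (partialSum a L x - partialSum a (φ n) x)
        + (partialSum a (φ n) x - fun ω => (V x ω : ℂ)) := by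
    funext ω; simp
  rw [e]
  refine (eLpNorm_add_le ((hm _ x).sub (hm _ x)) ((hm _ x).sub hVx) one_le_two).trans ?_
  gcongr
  exact ((hN k L (φ n) hL (hφ k n hn) x).trans_le (ENNReal.ofReal_le_ofReal hk.le)).le

include h in
theorem memLp_partialSum_prod [IsFiniteMeasure P] (L : ℕ) :
    MemLp (fun p : Ω × S2 => partialSum a L p.2 p.1) 2 (P.prod sphereMeasure) := by
  refine memLp_finsetSum _ fun ℓ _ => memLp_finsetSum _ fun m hm => ?_
  obtain ⟨C, -, hC⟩ := exists_norm_le_of_continuous (continuous_sphericalHarmonic ℓ m)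
  refine ((h.memLp ℓ m hm).comp_fst sphereMeasure).of_le_mul (c := C) ?_
    (Eventually.of_forall fun p => ?_)
  · exact ((h.memLp ℓ m hm).1.comp_fst).mul
      ((continuous_sphericalHarmonic ℓ m).measurable.comp measurable_snd).aestronglyMeasurable
  · rw [norm_mul, mul_comm]
    exact mul_le_mul_of_nonneg_right (hC _) (norm_nonneg _)

include h in
/-- The expansion has a sum both pointwise and in the square mean over `Ω × S²`. -/
theorem exists_isPointwiseSum_isL2Sum [IsFiniteMeasure P] :
    ∃ V : S2 → Ω → ℝ, IsPointwiseSum P a V ∧ IsL2Sum P a V := by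
  obtain ⟨V, hV, hu⟩ := h.exists_uniform_sum
  have hVc : Measurable fun p : Ω × S2 => (V p.2 p.1 : ℂ) := Complex.measurable_ofReal.comp hV
  have conv : ∀ {f : ℕ → ℝ≥0∞}, (∀ ε : ℝ, 0 < ε → ∃ N : ℕ, ∀ L, N ≤ L → f L ≤ ENNReal.ofReal ε) →
      Tendsto f atTop (𝓝 0) := by
    intro f hf
    rw [ENNReal.tendsto_atTop_zero]
    intro ε hε
    rcases eq_or_ne ε ⊤ with rfl | hε'
    · exact ⟨0, fun _ _ => le_top⟩
    · obtain ⟨N, hN⟩ := hf ε.toReal (ENNReal.toReal_pos hε.ne' hε')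
      exact ⟨N, fun L hL => by simpa [ENNReal.ofReal_toReal hε'] using hN L hL⟩
  have hL2 : Tendsto (fun L : ℕ =>
      eLpNorm (fun p : Ω × S2 => partialSum a L p.2 p.1 - (V p.2 p.1 : ℂ)) 2
        (P.prod sphereMeasure)) atTop (𝓝 0) := by
    refine conv fun ε hε => ?_
    obtain ⟨N, hN⟩ := hu ε hε
    exact ⟨N, fun L hL => eLpNorm_prod_le
      ((h.memLp_partialSum_prod L).1.sub hVc.aestronglyMeasurable) (hN L hL)⟩
  refine ⟨V, ⟨hV, fun x => conv fun ε hε => ?_⟩, hV, ?_, hL2⟩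
  · obtain ⟨N, hN⟩ := hu ε hε
    exact ⟨N, fun L hL => hN L hL x⟩
  · have := memLp_of_tendsto_eLpNorm (fun L => h.memLp_partialSum_prod L)
      hVc.aestronglyMeasurable hL2
    simpa [IsSquareIntegrable] using this.re

include h in
theorem memLp_of_isPointwiseSum {V : S2 → Ω → ℝ} (hV : IsPointwiseSum P a V) (x : S2) :
    MemLp (fun ω => (V x ω : ℂ)) 2 P :=
  memLp_of_tendsto_eLpNorm (fun L => h.memLp_degreeSum (Finset.range (L + 1)) x)
    (Complex.measurable_ofReal.comp (hV.1.comp measurable_prodMk_right)).aestronglyMeasurable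
    (hV.2 x)

include h in
theorem tendsto_integral_mul {V : S2 → Ω → ℝ} (hV : IsPointwiseSum P a V) (x y : S2) :
    Tendsto (fun L : ℕ => ∑ ℓ ∈ Finset.range (L + 1), (v ℓ : ℂ) * harmonicKernel ℓ x y) atTop
      (𝓝 ((∫ ω, V x ω * V y ω ∂P : ℝ) : ℂ)) := by
  have := integral_mul_conj_tendsto (fun L => h.memLp_degreeSum (Finset.range (L + 1)) x)
    (fun L => h.memLp_degreeSum (Finset.range (L + 1)) y) (h.memLp_of_isPointwiseSum hV x)
    (h.memLp_of_isPointwiseSum hV y) (hV.2 x) (hV.2 y)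
  simp only [h.integral_degreeSum, Complex.conj_ofReal, ← Complex.ofReal_mul] at this
  rwa [integral_complex_ofReal] at this

include h in
-- The covariance of `V` is the limit of sums of kernels, each of which is invariant.
theorem integral_mul_rotate {V : S2 → Ω → ℝ} (hV : IsPointwiseSum P a V) (R : E3 ≃ₗᵢ[ℝ] E3)
    (x y : S2) :
    ∫ ω, V x ω * V y ω ∂P = ∫ ω, V (rotate R x) ω * V (rotate R y) ω ∂P := by
  have h1 := h.tendsto_integral_mul hV (rotate R x) (rotate R y)
  simp only [harmonicKernel_rotate] at h1
  exact_mod_cast tendsto_nhds_unique (h.tendsto_integral_mul hV x y) h1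

include h in
theorem ae_eq_of_isPointwiseSum_of_isL2Sum [IsFiniteMeasure P] {V U : S2 → Ω → ℝ}
    (hV : IsPointwiseSum P a V) (hU : IsL2Sum P a U) :
    ∀ᵐ p ∂(P.prod sphereMeasure), V p.2 p.1 = U p.2 p.1 := by
  -- A third field that is a sum in both senses serves as a bridge: it agrees with `V` at each `x`
  -- almost surely, hence almost everywhere by Fubini, and with `U` by uniqueness of limits in `L²`.
  obtain ⟨V', hV', hL⟩ := h.exists_isPointwiseSum_isL2Sum
  have hc : ∀ {W : S2 → Ω → ℝ}, IsRandomField W → Measurable fun p : Ω × S2 => (W p.2 p.1 : ℂ) :=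
    fun hW => Complex.measurable_ofReal.comp hW
  have e1 : ∀ᵐ p ∂(P.prod sphereMeasure), V p.2 p.1 = V' p.2 p.1 := by
    have hx : ∀ x, ∀ᵐ ω ∂P, V x ω = V' x ω := by
      intro x
      have := ae_eq_of_tendsto_eLpNorm
        (fun L => (h.memLp_degreeSum (Finset.range (L + 1)) x).1)
        (h.memLp_of_isPointwiseSum hV x).1 (h.memLp_of_isPointwiseSum hV' x).1 (hV.2 x) (hV'.2 x)
      filter_upwards [this] with ω hω
      exact_mod_cast hω
    have hms : MeasurableSet {q : S2 × Ω | V q.1 q.2 = V' q.1 q.2} :=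
      measurableSet_eq_fun (hV.1.comp measurable_swap) (hV'.1.comp measurable_swap)
    have := (Measure.ae_prod_iff_ae_ae (μ := sphereMeasure) (ν := P) hms).2
      (Eventually.of_forall hx)
    exact (Measure.measurePreserving_swap (μ := P) (ν := sphereMeasure)).quasiMeasurePreserving.ae
      this
  have e2 := ae_eq_of_tendsto_eLpNorm (fun L => (h.memLp_partialSum_prod L).1)
    (hc hV'.1).aestronglyMeasurable (hc hU.1).aestronglyMeasurable hL.2.2 hU.2.2
  filter_upwards [e1, e2] with p h1 h2
  rw [h1]
  exact_mod_cast h2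

include h in
/-- The Fourier coefficients of the sum of the expansion are its coefficients. -/
theorem randomCoeff_ae_eq [IsProbabilityMeasure P] {U : S2 → Ω → ℝ} (hU : IsL2Sum P a U)
    {ℓ : ℕ} {m : ℤ}
    (hm : m ∈ Finset.Icc (-(ℓ : ℤ)) ℓ) : ∀ᵐ ω ∂P, randomCoeff U ℓ m ω = a ℓ m ω := by
  obtain ⟨C, hC0, hC⟩ := exists_norm_le_of_continuous (continuous_sphericalHarmonic ℓ m)
  have hUc : MemLp (fun p : Ω × S2 => (U p.2 p.1 : ℂ)) 2 (P.prod sphereMeasure) := hU.2.1.ofReal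
  have hYm : Measurable fun x => conj (sphericalHarmonic ℓ m x) :=
    (Complex.continuous_conj.comp (continuous_sphericalHarmonic ℓ m)).measurable
  have hint : ∀ {f : S2 → ℂ}, Integrable f sphereMeasure →
      Integrable (fun x => f x * conj (sphericalHarmonic ℓ m x)) sphereMeasure := fun hf =>
    hf.mul_bdd (c := C) hYm.aestronglyMeasurable
      (Eventually.of_forall fun x => by rw [RCLike.norm_conj]; exact hC x)
  have hUi : ∀ᵐ ω ∂P, Integrable (fun x => (U x ω : ℂ)) sphereMeasure :=
    (hUc.integrable one_le_two).prod_right_ae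
  -- For `L ≥ ℓ` the partial sum has exact coefficient `a ℓ m`, so the error is the coefficient of
  -- the remainder, and taking a coefficient is bounded from `L²(Ω × S²)` to `L¹(Ω)`.
  have hbd : ∀ L, ℓ ≤ L → ∫⁻ ω, ‖a ℓ m ω - randomCoeff U ℓ m ω‖ₑ ∂P
      ≤ ENNReal.ofReal C * eLpNorm (fun p : Ω × S2 => partialSum a L p.2 p.1 - (U p.2 p.1 : ℂ)) 2
        (P.prod sphereMeasure) := by
    intro L hL
    have hD := (h.memLp_partialSum_prod L).sub hUc
    have hDm : AEStronglyMeasurable (fun p : Ω × S2 => partialSum a L p.2 p.1 - (U p.2 p.1 : ℂ))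
      (P.prod sphereMeasure) := hD.1
    calc ∫⁻ ω, ‖a ℓ m ω - randomCoeff U ℓ m ω‖ₑ ∂P
        ≤ ∫⁻ ω, ∫⁻ x, ENNReal.ofReal C * ‖partialSum a L x ω - (U x ω : ℂ)‖ₑ ∂sphereMeasure ∂P := by
          refine lintegral_mono_ae ?_
          filter_upwards [hUi, ((h.memLp_partialSum_prod L).integrable one_le_two).prod_right_ae]
            with ω h1 h2
          have e : a ℓ m ω - randomCoeff U ℓ m ω = ∫ x, (partialSum a L x ω - (U x ω : ℂ)) *
              conj (sphericalHarmonic ℓ m x) ∂sphereMeasure := by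
            rw [← integral_partialSum_mul_conj a hm hL ω, randomCoeff, sphericalCoeff,
              ← integral_sub (hint h2) (hint h1)]
            exact integral_congr_ae (Eventually.of_forall fun x => by ring)
          rw [e]
          refine (enorm_integral_le_lintegral_enorm _).trans (lintegral_mono fun x => ?_)
          rw [enorm_mul, mul_comm]
          gcongr
          rw [← ofReal_norm, RCLike.norm_conj]
          exact ENNReal.ofReal_le_ofReal (hC x)
      _ = ENNReal.ofReal C * eLpNorm (fun p : Ω × S2 => partialSum a L p.2 p.1 - (U p.2 p.1 : ℂ)) 1
            (P.prod sphereMeasure) := by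
          rw [eLpNorm_one_eq_lintegral_enorm, lintegral_prod _ hDm.enorm,
            ← lintegral_const_mul'' _ hDm.enorm.lintegral_prod_right']
          refine lintegral_congr_ae ?_
          filter_upwards [hDm.prodMk_left] with ω hω
          exact lintegral_const_mul'' _ hω.enorm
      _ ≤ _ := by
          gcongr
          exact eLpNorm_le_eLpNorm_of_exponent_le one_le_two hDm
  have h0 : ∫⁻ ω, ‖a ℓ m ω - randomCoeff U ℓ m ω‖ₑ ∂P = 0 := by
    refine le_antisymm ?_ zero_le
    have := ENNReal.Tendsto.const_mul (a := ENNReal.ofReal C) hU.2.2 (Or.inr ENNReal.ofReal_ne_top)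
    rw [mul_zero] at this
    refine ge_of_tendsto this ?_
    filter_upwards [eventually_ge_atTop ℓ] with L hL using hbd L hL
  have hrm : AEStronglyMeasurable (randomCoeff U ℓ m) P := by
    have : Measurable fun p : Ω × S2 => (U p.2 p.1 : ℂ) * conj (sphericalHarmonic ℓ m p.2) :=
      (Complex.measurable_ofReal.comp hU.1).mul (hYm.comp measurable_snd)
    exact this.stronglyMeasurable.integral_prod_right.aestronglyMeasurable
  have hd : AEMeasurable (fun ω => ‖a ℓ m ω - randomCoeff U ℓ m ω‖ₑ) P :=
    ((h.memLp ℓ m hm).1.sub hrm).enorm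
  rw [lintegral_eq_zero_iff' hd] at h0
  filter_upwards [h0] with ω hω
  have : a ℓ m ω - randomCoeff U ℓ m ω = 0 := by simpa using hω
  exact (sub_eq_zero.1 this).symm

end IsSpectralFamily

end Expansion

/-! ### Gaussian subspaces of `L²(Ω)` -/

section GaussianSubspace

variable {Ω : Type*} [MeasurableSpace Ω] {P : Measure Ω}

theorem inner_toLp {f g : Ω → ℝ} (hf : MemLp f 2 P) (hg : MemLp g 2 P) :
    inner ℝ (hf.toLp f) (hg.toLp g) = ∫ ω, f ω * g ω ∂P := by
  rw [← integral_mul_conj_eq_inner hg hf]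
  simp [mul_comm]

theorem norm_toLp_sq {f : Ω → ℝ} (hf : MemLp f 2 P) :
    ‖hf.toLp f‖ ^ 2 = ∫ ω, f ω ^ 2 ∂P := by
  rw [← real_inner_self_eq_norm_sq, inner_toLp]
  simp [sq]

/-- The function `f` represents an element of the subspace `H` of `L²(Ω)`. -/
def InSpace (H : Submodule ℝ (Lp ℝ 2 P)) (f : Ω → ℝ) : Prop :=
  ∃ hf : MemLp f 2 P, hf.toLp f ∈ H

namespace InSpace

variable {H : Submodule ℝ (Lp ℝ 2 P)} {f g : Ω → ℝ}

theorem congr (hf : InSpace H f) (h : f =ᵐ[P] g) : InSpace H g := by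
  obtain ⟨h1, h2⟩ := hf
  exact ⟨h1.ae_eq h, by rwa [← MemLp.toLp_congr h1 (h1.ae_eq h) h]⟩

theorem zero : InSpace H (fun _ : Ω => (0 : ℝ)) :=
  ⟨MemLp.zero, by rw [show MemLp.toLp (fun _ : Ω => (0 : ℝ)) MemLp.zero = (0 : Lp ℝ 2 P) from
    MemLp.toLp_zero _]; exact H.zero_mem⟩

theorem add (hf : InSpace H f) (hg : InSpace H g) : InSpace H (fun ω => f ω + g ω) := by
  obtain ⟨h1, h2⟩ := hf
  obtain ⟨h3, h4⟩ := hg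
  exact ⟨h1.add h3, H.add_mem h2 h4⟩

theorem const_mul (hf : InSpace H f) (c : ℝ) : InSpace H (fun ω => c * f ω) := by
  obtain ⟨h1, h2⟩ := hf
  exact ⟨h1.const_mul c, H.smul_mem c h2⟩

theorem sub (hf : InSpace H f) (hg : InSpace H g) : InSpace H (fun ω => f ω - g ω) :=
  (hf.add (hg.const_mul (-1))).congr (Eventually.of_forall fun ω => by ring)

theorem sum {ι : Type*} (s : Finset ι) {F : ι → Ω → ℝ} (hF : ∀ i ∈ s, InSpace H (F i)) :
    InSpace H (fun ω => ∑ i ∈ s, F i ω) := by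
  classical
  induction s using Finset.induction_on with
  | empty => simpa using zero
  | insert i s hi ih =>
    simp only [Finset.sum_insert hi]
    exact (hF i (Finset.mem_insert_self i s)).add
      (ih fun j hj => hF j (Finset.mem_insert_of_mem hj))

theorem of_tendsto (hH : IsClosed (H : Set (Lp ℝ 2 P))) {F : ℕ → Ω → ℝ}
    (hF : ∀ n, InSpace H (F n)) (hf : AEStronglyMeasurable f P)
    (h : Tendsto (fun n => eLpNorm (F n - f) 2 P) atTop (𝓝 0)) : InSpace H f := by
  choose h1 h2 using hF
  have hm : MemLp f 2 P := memLp_of_tendsto_eLpNorm h1 hf h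
  exact ⟨hm, hH.mem_of_tendsto ((Lp.tendsto_Lp_iff_tendsto_eLpNorm'' F h1 f hm).2 h)
    (Eventually.of_forall h2)⟩

end InSpace

/-- All elements of the subspace `H` of `L²(Ω)` are centred Gaussian random variables. -/
def IsGaussianSubspace (H : Submodule ℝ (Lp ℝ 2 P)) : Prop :=
  ∀ u ∈ H, ∀ s : ℝ, ∫ ω, Complex.exp (Complex.I * (s * u ω : ℝ)) ∂P
    = Complex.exp (-(s ^ 2 * ‖u‖ ^ 2 / 2 : ℝ))

/-- Uses `|exp (ix) - 1| ≤ |x|` and `L¹ ≤ L²`. The characteristic function is thereby Lipschitz on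
`L²(Ω)`. -/
theorem norm_integral_exp_sub_le [IsProbabilityMeasure P] (s : ℝ) (u v : Lp ℝ 2 P) :
    ‖∫ ω, Complex.exp (Complex.I * (s * u ω : ℝ)) ∂P
      - ∫ ω, Complex.exp (Complex.I * (s * v ω : ℝ)) ∂P‖ ≤ |s| * ‖u - v‖ := by
  have hi : ∀ w : Lp ℝ 2 P, Integrable (fun ω => Complex.exp (Complex.I * (s * w ω : ℝ))) P := by
    intro w
    have hm : AEStronglyMeasurable (fun ω => Complex.exp (Complex.I * (s * w ω : ℝ))) P :=
      (by fun_prop : Continuous fun x : ℝ =>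
        Complex.exp (Complex.I * (s * x : ℝ))).comp_aestronglyMeasurable
        (Lp.aestronglyMeasurable w)
    refine Integrable.of_bound hm 1 (Eventually.of_forall fun ω => ?_)
    rw [mul_comm, Complex.norm_exp_ofReal_mul_I]
  have hd : MemLp (fun ω => u ω - v ω) 2 P := (Lp.memLp u).sub (Lp.memLp v)
  rw [← integral_sub (hi u) (hi v)]
  calc _ ≤ ∫ ω, |s| * ‖u ω - v ω‖ ∂P := by
        refine norm_integral_le_of_norm_le ((hd.integrable one_le_two).norm.const_mul _)
          (Eventually.of_forall fun ω => ?_)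
        have e : Complex.exp (Complex.I * (s * u ω : ℝ)) - Complex.exp (Complex.I * (s * v ω : ℝ))
            = Complex.exp ((s * v ω : ℝ) * Complex.I) *
              (Complex.exp (Complex.I * (s * (u ω - v ω) : ℝ)) - 1) := by
          rw [mul_sub, mul_one, ← Complex.exp_add]
          push_cast
          ring_nf
        rw [e, norm_mul, Complex.norm_exp_ofReal_mul_I, one_mul]
        refine Real.norm_exp_I_mul_ofReal_sub_one_le.trans ?_
        rw [norm_mul, Real.norm_eq_abs]
    _ = |s| * ∫ ω, ‖u ω - v ω‖ ∂P := integral_const_mul _ _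
    _ ≤ |s| * ‖u - v‖ := by
        gcongr
        have h1 : ∫ ω, ‖u ω - v ω‖ ∂P = (eLpNorm (fun ω => u ω - v ω) 1 P).toReal := by
          rw [eLpNorm_one_eq_lintegral_enorm, integral_norm_eq_lintegral_enorm hd.1]
        have h2 : ‖u - v‖ = (eLpNorm (fun ω => u ω - v ω) 2 P).toReal := by
          rw [Lp.norm_def]
          exact congrArg _ (eLpNorm_congr_ae (Lp.coeFn_sub u v))
        rw [h1, h2]
        exact ENNReal.toReal_mono hd.2.ne (eLpNorm_le_eLpNorm_of_exponent_le one_le_two hd.1)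

/-- For fixed `s` both sides of the defining identity are continuous in `L²`, so it holds on a
closed set. -/
theorem IsGaussianSubspace.topologicalClosure [IsProbabilityMeasure P]
    {H : Submodule ℝ (Lp ℝ 2 P)} (hH : IsGaussianSubspace H) :
    IsGaussianSubspace H.topologicalClosure := by
  intro u hu s
  have hc : Continuous fun u : Lp ℝ 2 P => ∫ ω, Complex.exp (Complex.I * (s * u ω : ℝ)) ∂P := by
    refine LipschitzWith.continuous (K := ⟨|s|, abs_nonneg s⟩) (LipschitzWith.of_dist_le_mul ?_)
    intro u v
    rw [dist_eq_norm, dist_eq_norm]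
    exact norm_integral_exp_sub_le s u v
  have hd : Continuous fun u : Lp ℝ 2 P => Complex.exp (-(s ^ 2 * ‖u‖ ^ 2 / 2 : ℝ)) := by
    fun_prop
  have hcl : IsClosed {u : Lp ℝ 2 P | ∫ ω, Complex.exp (Complex.I * (s * u ω : ℝ)) ∂P
      = Complex.exp (-(s ^ 2 * ‖u‖ ^ 2 / 2 : ℝ))} := isClosed_eq hc hd
  have hu' : u ∈ closure (H : Set (Lp ℝ 2 P)) := hu
  exact closure_minimal (fun v hv => hH v hv s) hcl hu'

theorem IsGaussianSubspace.charFun_eq {H : Submodule ℝ (Lp ℝ 2 P)} (hH : IsGaussianSubspace H)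
    {f : Ω → ℝ} (hf : InSpace H f) (s : ℝ) :
    charFun (P.map f) s = Complex.exp (-(s ^ 2 * (∫ ω, f ω ^ 2 ∂P) / 2 : ℝ)) := by
  obtain ⟨h1, h2⟩ := hf
  rw [← norm_toLp_sq h1, ← hH _ h2 s, charFun_apply_real,
    integral_map h1.1.aemeasurable (by fun_prop)]
  refine integral_congr_ae ?_
  filter_upwards [h1.coeFn_toLp] with ω hω
  rw [hω]
  push_cast
  ring_nf

theorem IsGaussianSubspace.map_eq [IsProbabilityMeasure P] {H : Submodule ℝ (Lp ℝ 2 P)}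
    (hH : IsGaussianSubspace H) {f : Ω → ℝ} (hf : InSpace H f) :
    P.map f = gaussianReal 0 (∫ ω, f ω ^ 2 ∂P).toNNReal := by
  have hm : AEMeasurable f P := hf.1.1.aemeasurable
  have := Measure.isProbabilityMeasure_map hm
  refine Measure.ext_of_charFun ?_
  funext s
  rw [hH.charFun_eq hf, charFun_gaussianReal,
    Real.coe_toNNReal _ (integral_nonneg fun ω => sq_nonneg _)]
  push_cast
  ring_nf

theorem IsGaussianSubspace.integral_eq_zero [IsProbabilityMeasure P]
    {H : Submodule ℝ (Lp ℝ 2 P)} (hH : IsGaussianSubspace H) {f : Ω → ℝ} (hf : InSpace H f) :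
    ∫ ω, f ω ∂P = 0 := by
  have h := integral_map (μ := P) (f := id) hf.1.1.aemeasurable (by fun_prop)
  rw [hH.map_eq hf] at h
  simpa using h.symm

theorem clm_pi_apply {ι : Type*} [Fintype ι] [DecidableEq ι] (l : (ι → ℝ) →L[ℝ] ℝ) (x : ι → ℝ) :
    l x = ∑ i, l (Pi.single i 1) * x i := by
  conv_lhs => rw [pi_eq_sum_univ' x, map_sum]
  exact Finset.sum_congr rfl fun i _ => by rw [map_smul, smul_eq_mul, mul_comm]

theorem InSpace.clm {H : Submodule ℝ (Lp ℝ 2 P)} {ι : Type*} [Fintype ι] {V : ι → Ω → ℝ}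
    (hV : ∀ i, InSpace H (V i)) (l : (ι → ℝ) →L[ℝ] ℝ) :
    InSpace H (fun ω => l (fun i => V i ω)) := by
  classical
  refine (InSpace.sum Finset.univ fun i _ => (hV i).const_mul (l (Pi.single i 1))).congr
    (Eventually.of_forall fun ω => ?_)
  exact (clm_pi_apply l fun i => V i ω).symm

/-- Every linear functional of finitely many values lies in `H` again and so is Gaussian. -/
theorem IsGaussianSubspace.isGaussianProcess [IsProbabilityMeasure P]
    {H : Submodule ℝ (Lp ℝ 2 P)} (hH : IsGaussianSubspace H) {T : Type*} {V : T → Ω → ℝ}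
    (hV : ∀ x, InSpace H (V x)) : IsGaussianProcess V P := by
  refine ⟨fun I => ⟨isGaussian_of_map_eq_gaussianReal fun l =>
    ⟨0, (∫ ω, l (fun i : I => V i ω) ^ 2 ∂P).toNNReal, ?_⟩⟩⟩
  rw [← hH.map_eq (InSpace.clm (fun i : I => hV i) l)]
  change (P.map fun ω (i : I) => V i ω).map l = _
  rw [AEMeasurable.map_map_of_aemeasurable (by fun_prop)
      (aemeasurable_pi_lambda (fun ω (i : I) => V i ω) fun i => (hV i).1.1.aemeasurable)]
  rfl

/-- In a Gaussian subspace, covariances determine the joint laws. -/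
theorem IsGaussianSubspace.map_pi_eq [IsProbabilityMeasure P]
    {H : Submodule ℝ (Lp ℝ 2 P)} (hH : IsGaussianSubspace H) {ι : Type*} [Fintype ι]
    {V V' : ι → Ω → ℝ} (hV : ∀ i, InSpace H (V i)) (hV' : ∀ i, InSpace H (V' i))
    (hcov : ∀ i j, ∫ ω, V i ω * V j ω ∂P = ∫ ω, V' i ω * V' j ω ∂P) :
    P.map (fun ω i => V i ω) = P.map (fun ω i => V' i ω) := by
  classical
  have sq : ∀ {U : ι → Ω → ℝ}, (∀ i, InSpace H (U i)) → ∀ l : (ι → ℝ) →L[ℝ] ℝ,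
      ∫ ω, l (fun i => U i ω) ^ 2 ∂P = ∑ i, ∑ j,
        (l (Pi.single i 1) * l (Pi.single j 1)) * ∫ ω, U i ω * U j ω ∂P := by
    intro U hU l
    have hi : ∀ i j, Integrable
        (fun ω => (l (Pi.single i 1) * l (Pi.single j 1)) * (U i ω * U j ω)) P :=
      fun i j => (MemLp.integrable_mul (hU i).1 (hU j).1).const_mul _
    have e : ∀ ω, l (fun i => U i ω) ^ 2
        = ∑ i, ∑ j, (l (Pi.single i 1) * l (Pi.single j 1)) * (U i ω * U j ω) := by
      intro ω
      rw [clm_pi_apply, sq, Finset.sum_mul_sum]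
      exact Finset.sum_congr rfl fun i _ => Finset.sum_congr rfl fun j _ => by ring
    simp only [e]
    rw [integral_finsetSum _ fun i _ => integrable_finsetSum _ fun j _ => hi i j]
    refine Finset.sum_congr rfl fun i _ => ?_
    rw [integral_finsetSum _ fun j _ => hi i j]
    exact Finset.sum_congr rfl fun j _ => integral_const_mul _ _
  -- The joint characteristic function at `l` is that of the real variable `l(U)` at `1`, and hence
  -- depends on the second moment of `l(U)` alone.
  have cf : ∀ {U : ι → Ω → ℝ}, (∀ i, InSpace H (U i)) → ∀ l : (ι → ℝ) →L[ℝ] ℝ,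
      charFunDual (P.map fun ω i => U i ω) l
        = Complex.exp (-(1 ^ 2 * (∫ ω, l (fun i => U i ω) ^ 2 ∂P) / 2 : ℝ)) := by
    intro U hU l
    have hm : AEMeasurable (fun ω i => U i ω) P :=
      aemeasurable_pi_lambda _ fun i => (hU i).1.1.aemeasurable
    rw [← hH.charFun_eq (InSpace.clm hU l), charFunDual_apply, charFun_apply_real,
      integral_map hm (by fun_prop),
      integral_map (InSpace.clm hU l).1.1.aemeasurable (by fun_prop)]
    simp
  have hm : ∀ {U : ι → Ω → ℝ}, (∀ i, InSpace H (U i)) → AEMeasurable (fun ω i => U i ω) P :=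
    fun hU => aemeasurable_pi_lambda _ fun i => (hU i).1.1.aemeasurable
  have := Measure.isProbabilityMeasure_map (hm hV)
  have := Measure.isProbabilityMeasure_map (hm hV')
  refine Measure.ext_of_charFunDual ?_
  funext l
  rw [cf hV, cf hV', sq hV, sq hV']
  simp only [hcov]

/-- The linear span of a centred Gaussian process is a Gaussian subspace. -/
theorem isGaussianSubspace_span [IsProbabilityMeasure P] {T : Type*} {Z : T → Ω → ℝ}
    (hZ : IsGaussianProcess Z P) (h2 : ∀ i, MemLp (Z i) 2 P) (h0 : ∀ i, ∫ ω, Z i ω ∂P = 0) :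
    IsGaussianSubspace (Submodule.span ℝ (Set.range fun i => (h2 i).toLp (Z i))) := by
  intro u hu s
  obtain ⟨c, hc⟩ := Finsupp.mem_span_range_iff_exists_finsupp.1 hu
  let f : Ω → ℝ := fun ω => ∑ i ∈ c.support, c i * Z i ω
  have hf : MemLp f 2 P := memLp_finsetSum _ fun i _ => (h2 i).const_mul (c i)
  have hu : hf.toLp f = u := by
    rw [← hc]
    refine Lp.ext (hf.coeFn_toLp.trans ?_)
    rw [Finsupp.sum]
    refine EventuallyEq.trans ?_ (Lp.coeFn_finsetSum _ _).symm
    have : ∀ᵐ ω ∂P, ∀ i ∈ c.support, (c i • (h2 i).toLp (Z i) : Lp ℝ 2 P) ω = c i * Z i ω := by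
      rw [Finset.eventually_all]
      intro i _
      filter_upwards [Lp.coeFn_smul (c i) ((h2 i).toLp (Z i)), (h2 i).coeFn_toLp] with ω e1 e2
      rw [e1, Pi.smul_apply, e2, smul_eq_mul]
    filter_upwards [this] with ω hω
    rw [Finset.sum_apply]
    exact (Finset.sum_congr rfl hω).symm
  -- A finite combination is a continuous linear image of a finite-dimensional marginal of the
  -- process.
  have hg : HasGaussianLaw f P := by
    let l : (c.support → ℝ) →L[ℝ] ℝ := ∑ i : c.support, c i • ContinuousLinearMap.proj i
    have e : f = l ∘ fun ω => c.support.restrict (Z · ω) := by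
      funext ω
      simp only [f, l, Function.comp, sum_apply, FunLike.coe_smul,
        Pi.smul_apply, ContinuousLinearMap.proj_apply, Finset.restrict_def, smul_eq_mul]
      exact (Finset.sum_coe_sort c.support fun i => c i * Z i ω).symm
    rw [e]
    exact (hZ.hasGaussianLaw _).map l
  have hm : ∫ ω, f ω ∂P = 0 := by
    simp only [f]
    rw [integral_finsetSum _ fun i _ => ((h2 i).integrable one_le_two).const_mul _]
    exact Finset.sum_eq_zero fun i _ => by rw [integral_const_mul, h0, mul_zero]
  have hv : Var[f; P] = ‖u‖ ^ 2 := by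
    rw [variance_of_integral_eq_zero hf.1.aemeasurable hm, ← hu, norm_toLp_sq]
  have hl := hg.map_eq_gaussianReal
  rw [hm, hv] at hl
  have hcf := congrArg (fun μ => charFun μ s) hl
  rw [charFun_gaussianReal, charFun_apply_real,
    integral_map hf.1.aemeasurable (by fun_prop), Real.coe_toNNReal _ (by positivity)] at hcf
  calc _ = ∫ ω, Complex.exp (s * f ω * Complex.I) ∂P := by
        refine integral_congr_ae ?_
        rw [← hu]
        filter_upwards [hf.coeFn_toLp] with ω hω
        rw [hω]
        push_cast
        ring_nf
    _ = _ := by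
        rw [hcf]
        push_cast
        ring_nf

end GaussianSubspace

/-! ### The Fourier coefficients of a random field -/

section RandomCoeff

variable {Ω : Type*} [MeasurableSpace Ω] {P : Measure Ω} {ξ : S2 → Ω → ℝ}

theorem sphericalCoeff_neg (f : S2 → ℝ) (ℓ : ℕ) (m : ℤ) :
    sphericalCoeff f ℓ (-m) = (-1) ^ m.natAbs * conj (sphericalCoeff f ℓ m) := by
  rw [sphericalCoeff, sphericalCoeff, ← integral_conj, ← integral_const_mul]
  refine integral_congr_ae (Eventually.of_forall fun x => ?_)
  simp only [sphericalHarmonic_neg, map_mul, map_pow, map_neg, map_one, Complex.conj_conj,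
    Complex.conj_ofReal]
  ring

theorem measurable_conj_sphericalHarmonic (ℓ : ℕ) (m : ℤ) :
    Measurable fun x => conj (sphericalHarmonic ℓ m x) :=
  (Complex.continuous_conj.comp (continuous_sphericalHarmonic ℓ m)).measurable

theorem stronglyMeasurable_randomCoeff (hξ : IsRandomField ξ) (ℓ : ℕ) (m : ℤ) :
    StronglyMeasurable (randomCoeff ξ ℓ m) := by
  have : Measurable fun p : Ω × S2 => (ξ p.2 p.1 : ℂ) * conj (sphericalHarmonic ℓ m p.2) :=
    (Complex.measurable_ofReal.comp hξ).mul
      ((measurable_conj_sphericalHarmonic ℓ m).comp measurable_snd)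
  exact this.stronglyMeasurable.integral_prod_right

/-- Pointwise in `ω` the coefficient is at most a constant times the `L²(S²)` norm of the field;
Tonelli then applies. -/
theorem memLp_randomCoeff [SFinite P] (hξ : IsRandomField ξ) (hs : IsSquareIntegrable P ξ)
    (ℓ : ℕ) (m : ℤ) : MemLp (randomCoeff ξ ℓ m) 2 P := by
  refine ⟨(stronglyMeasurable_randomCoeff hξ ℓ m).aestronglyMeasurable, ?_⟩
  obtain ⟨C, hC0, hC⟩ := exists_norm_le_of_continuous (continuous_sphericalHarmonic ℓ m)
  have hm : ∀ ω, Measurable fun x => ξ x ω := fun ω => hξ.comp measurable_prodMk_left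
  have hb : ∀ ω, ‖randomCoeff ξ ℓ m ω‖ₑ
      ≤ ENNReal.ofReal C * eLpNorm (fun x => ξ x ω) 2 sphereMeasure := by
    intro ω
    calc ‖randomCoeff ξ ℓ m ω‖ₑ
        ≤ ∫⁻ x, ENNReal.ofReal C * ‖ξ x ω‖ₑ ∂sphereMeasure := by
          refine (enorm_integral_le_lintegral_enorm _).trans (lintegral_mono fun x => ?_)
          rw [enorm_mul, mul_comm, ← ofReal_norm (conj (sphericalHarmonic ℓ m x)),
            RCLike.norm_conj, ← ofReal_norm (ξ x ω : ℂ), Complex.norm_real, ofReal_norm]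
          gcongr
          · rw [← ofReal_norm]
            exact ENNReal.ofReal_le_ofReal (hC x)
          · rw [ofReal_norm]
      _ = ENNReal.ofReal C * eLpNorm (fun x => ξ x ω) 1 sphereMeasure := by
          rw [eLpNorm_one_eq_lintegral_enorm, lintegral_const_mul' _ _ ENNReal.ofReal_ne_top]
      _ ≤ _ := by
          gcongr
          exact eLpNorm_le_eLpNorm_of_exponent_le one_le_two (hm ω).aestronglyMeasurable
  rw [eLpNorm_lt_top_iff_lintegral_rpow_enorm_lt_top two_ne_zero ENNReal.ofNat_ne_top]
  have h2 := (eLpNorm_lt_top_iff_lintegral_rpow_enorm_lt_top two_ne_zero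
    ENNReal.ofNat_ne_top).1 hs.2
  rw [lintegral_prod _ (hs.1.enorm.pow_const _)] at h2
  calc ∫⁻ ω, ‖randomCoeff ξ ℓ m ω‖ₑ ^ (2 : ℝ≥0∞).toReal ∂P
      ≤ ∫⁻ ω, ENNReal.ofReal C ^ (2 : ℝ≥0∞).toReal *
          ∫⁻ x, ‖ξ x ω‖ₑ ^ (2 : ℝ≥0∞).toReal ∂sphereMeasure ∂P := by
        refine lintegral_mono fun ω => ?_
        refine (ENNReal.rpow_le_rpow (hb ω) (by simp)).trans_eq ?_
        rw [ENNReal.mul_rpow_of_nonneg _ _ (by simp),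
          eLpNorm_eq_lintegral_rpow_enorm_toReal two_ne_zero ENNReal.ofNat_ne_top,
          ← ENNReal.rpow_mul, one_div, inv_mul_cancel₀ (by simp), ENNReal.rpow_one]
    _ = ENNReal.ofReal C ^ (2 : ℝ≥0∞).toReal *
          ∫⁻ ω, ∫⁻ x, ‖ξ x ω‖ₑ ^ (2 : ℝ≥0∞).toReal ∂sphereMeasure ∂P :=
        lintegral_const_mul' _ _ (ENNReal.rpow_ne_top_of_nonneg (by simp) ENNReal.ofReal_ne_top)
    _ < ⊤ := ENNReal.mul_lt_top
        (ENNReal.rpow_lt_top_of_nonneg (by simp) ENNReal.ofReal_ne_top) h2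

/-- Fubini's theorem for the moments of the Fourier coefficients. -/
theorem integral_randomCoeff_mul_conj [IsProbabilityMeasure P] (hs : IsSquareIntegrable P ξ)
    {Z : Ω → ℂ} (hZ : MemLp Z 2 P) (ℓ : ℕ) (m : ℤ) :
    ∫ ω, randomCoeff ξ ℓ m ω * conj (Z ω) ∂P
      = ∫ x, (∫ ω, (ξ x ω : ℂ) * conj (Z ω) ∂P) * conj (sphericalHarmonic ℓ m x)
          ∂sphereMeasure := by
  obtain ⟨C, -, hC⟩ := exists_norm_le_of_continuous (continuous_sphericalHarmonic ℓ m)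
  have hi : Integrable (fun p : Ω × S2 => (ξ p.2 p.1 : ℂ) * conj (Z p.1) *
      conj (sphericalHarmonic ℓ m p.2)) (P.prod sphereMeasure) := by
    refine Integrable.mul_bdd (c := C) (integrable_mul_conj (𝕜 := ℂ)
      (f := fun p : Ω × S2 => (ξ p.2 p.1 : ℂ)) (MemLp.ofReal hs)
      (hZ.comp_fst sphereMeasure)) ?_ (Eventually.of_forall fun p => ?_)
    · exact ((measurable_conj_sphericalHarmonic ℓ m).comp measurable_snd).aestronglyMeasurable
    · rw [RCLike.norm_conj]
      exact hC _
  calc ∫ ω, randomCoeff ξ ℓ m ω * conj (Z ω) ∂P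
      = ∫ ω, ∫ x, (ξ x ω : ℂ) * conj (Z ω) * conj (sphericalHarmonic ℓ m x) ∂sphereMeasure ∂P := by
        refine integral_congr_ae (Eventually.of_forall fun ω => ?_)
        simp only [randomCoeff, sphericalCoeff]
        rw [← integral_mul_const]
        exact integral_congr_ae (Eventually.of_forall fun x => by ring)
    _ = ∫ x, ∫ ω, (ξ x ω : ℂ) * conj (Z ω) * conj (sphericalHarmonic ℓ m x) ∂P ∂sphereMeasure :=
        integral_integral_swap hi
    _ = _ := by simp only [integral_mul_const]

/-- The covariance kernel of the field. -/
noncomputable def covKernel (P : Measure Ω) (ξ : S2 → Ω → ℝ) (z : S2 × S2) : ℂ :=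
  ∫ ω, (ξ z.1 ω : ℂ) * (ξ z.2 ω : ℂ) ∂P

/-- On `(S² × S²) × Ω` the two factors are each square integrable, so their product is integrable
and `Ω` can be integrated out. -/
theorem integrable_covKernel [IsProbabilityMeasure P] (hs : IsSquareIntegrable P ξ) :
    Integrable (covKernel P ξ) (sphereMeasure.prod sphereMeasure) := by
  have h1 : MemLp (fun q : (S2 × S2) × Ω => (ξ q.1.1 q.2 : ℂ)) 2
      ((sphereMeasure.prod sphereMeasure).prod P) := by
    have hp : MeasurePreserving (fun q : (S2 × S2) × Ω => (q.2, q.1.1))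
        ((sphereMeasure.prod sphereMeasure).prod P) (P.prod sphereMeasure) :=
      Measure.measurePreserving_swap.comp (measurePreserving_fst.prod (MeasurePreserving.id P))
    exact (MemLp.ofReal (K := ℂ) hs).comp_measurePreserving hp
  have h2 : MemLp (fun q : (S2 × S2) × Ω => (ξ q.1.2 q.2 : ℂ)) 2
      ((sphereMeasure.prod sphereMeasure).prod P) := by
    have hp : MeasurePreserving (fun q : (S2 × S2) × Ω => (q.2, q.1.2))
        ((sphereMeasure.prod sphereMeasure).prod P) (P.prod sphereMeasure) :=
      Measure.measurePreserving_swap.comp (measurePreserving_snd.prod (MeasurePreserving.id P))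
    exact (MemLp.ofReal (K := ℂ) hs).comp_measurePreserving hp
  exact (MemLp.integrable_mul h1 h2).integral_prod_left

/-- Combines invariance of the second moments with invariance of the product surface measure. -/
theorem isInvariantForm_covKernel [IsProbabilityMeasure P] (hs : IsSquareIntegrable P ξ)
    (hi : IsTwoWeaklyIsotropic P ξ) :
    IsInvariantForm (sphereMeasure.prod sphereMeasure) (covKernel P ξ) Prod.fst Prod.snd where
  integrable := integrable_covKernel hs
  measurable_left := measurable_fst
  measurable_right := measurable_snd
  invariant R hR f g hf hg := by
    have hp := (measurePreserving_rotate R).prod (measurePreserving_rotate R)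
    have hm : AEStronglyMeasurable (fun z : S2 × S2 => covKernel P ξ z * (conj (f z.1) * g z.2))
        (sphereMeasure.prod sphereMeasure) :=
      (integrable_covKernel hs).1.mul
        (((Complex.continuous_conj.comp hf).measurable.comp measurable_fst).mul
          (hg.measurable.comp measurable_snd)).aestronglyMeasurable
    have hk : ∀ z : S2 × S2, covKernel P ξ (Prod.map (rotate R) (rotate R) z) = covKernel P ξ z := by
      intro z
      simp only [covKernel, Prod.map_fst, Prod.map_snd, ← Complex.ofReal_mul]
      rw [integral_complex_ofReal, integral_complex_ofReal, (hi.2 R hR).2 z.1 z.2]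
    have e := integral_map hp.measurable.aemeasurable (by rw [hp.map_eq]; exact hm)
    rw [hp.map_eq] at e
    simp only [sesqForm]
    rw [e]
    exact integral_congr_ae (Eventually.of_forall fun z => by simp only [hk]; rfl)

/-- Fubini once for each coefficient. This makes Schur's lemma `sesqForm_harmonic` applicable to the
covariances. -/
theorem integral_randomCoeff_mul_conj_randomCoeff [IsProbabilityMeasure P]
    (hξ : IsRandomField ξ) (hs : IsSquareIntegrable P ξ) (hi : IsTwoWeaklyIsotropic P ξ)
    (ℓ ℓ' : ℕ) (m m' : ℤ) :
    ∫ ω, randomCoeff ξ ℓ m ω * conj (randomCoeff ξ ℓ' m' ω) ∂P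
      = sesqForm (sphereMeasure.prod sphereMeasure) (covKernel P ξ) Prod.fst Prod.snd
          (sphericalHarmonic ℓ m) (sphericalHarmonic ℓ' m') := by
  rw [integral_randomCoeff_mul_conj hs (memLp_randomCoeff hξ hs ℓ' m'), sesqForm,
    integral_prod _ ((isInvariantForm_covKernel hs hi).integrable_mul
      (continuous_sphericalHarmonic ℓ m) (continuous_sphericalHarmonic ℓ' m'))]
  refine integral_congr_ae (Eventually.of_forall fun x => ?_)
  have e : ∫ ω, (ξ x ω : ℂ) * conj (randomCoeff ξ ℓ' m' ω) ∂P
      = ∫ y, covKernel P ξ (x, y) * sphericalHarmonic ℓ' m' y ∂sphereMeasure := by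
    have h := congrArg conj (integral_randomCoeff_mul_conj hs (Z := fun ω => (ξ x ω : ℂ))
      (hi.1 x).ofReal ℓ' m')
    rw [← integral_conj, ← integral_conj] at h
    simp only [map_mul, Complex.conj_conj, ← integral_conj, Complex.conj_ofReal] at h
    simp only [covKernel]
    simp only [mul_comm (ξ x _ : ℂ)]
    exact h
  simp only
  rw [e, ← integral_mul_const]
  exact integral_congr_ae (Eventually.of_forall fun y => by ring)

theorem randomCoeff_cov [IsProbabilityMeasure P]
    (hξ : IsRandomField ξ) (hs : IsSquareIntegrable P ξ) (hi : IsTwoWeaklyIsotropic P ξ)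
    {ℓ ℓ' : ℕ} {m m' : ℤ} (hm : m ∈ Finset.Icc (-(ℓ : ℤ)) ℓ)
    (hm' : m' ∈ Finset.Icc (-(ℓ' : ℤ)) ℓ') :
    ∫ ω, randomCoeff ξ ℓ m ω * conj (randomCoeff ξ ℓ' m' ω) ∂P
      = if ℓ = ℓ' ∧ m = m' then (angularPowerSpectrum P ξ ℓ : ℂ) else 0 := by
  rw [integral_randomCoeff_mul_conj_randomCoeff hξ hs hi,
    sesqForm_harmonic (isInvariantForm_covKernel hs hi) hm hm',
    ← integral_randomCoeff_mul_conj_randomCoeff hξ hs hi, angularPowerSpectrum,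
    ← integral_complex_ofReal]
  simp only [Complex.mul_conj', Complex.ofReal_pow]

/-- A closed subspace equals its double orthogonal complement. A vector orthogonal to every `ξ x` is
orthogonal to the coefficient by Fubini, so no approximation of the integral by finite sums is
needed. -/
theorem inSpace_randomCoeff [IsProbabilityMeasure P] (hξ : IsRandomField ξ)
    (hs : IsSquareIntegrable P ξ) {H : Submodule ℝ (Lp ℝ 2 P)}
    (hH : IsClosed (H : Set (Lp ℝ 2 P))) (hmem : ∀ x, InSpace H (ξ x)) (ℓ : ℕ) (m : ℤ) :
    InSpace H (fun ω => (randomCoeff ξ ℓ m ω).re) ∧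
      InSpace H (fun ω => (randomCoeff ξ ℓ m ω).im) := by
  have hL := memLp_randomCoeff hξ hs ℓ m
  have hHo : H = Hᗮᗮ := by
    rw [Submodule.orthogonal_orthogonal_eq_closure, hH.submodule_topologicalClosure_eq]
  have key : ∀ v ∈ Hᗮ, ∫ ω, randomCoeff ξ ℓ m ω * conj ((v ω : ℝ) : ℂ) ∂P = 0 := by
    intro v hv
    rw [integral_randomCoeff_mul_conj hs (Z := fun ω => ((v ω : ℝ) : ℂ)) (Lp.memLp v).ofReal]
    refine integral_eq_zero_of_ae (Eventually.of_forall fun x => ?_)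
    have h0 := (Submodule.mem_orthogonal _ _).1 hv _ (hmem x).2
    have hv' : (Lp.memLp v).toLp v = v := Lp.toLp_coeFn v _
    rw [← hv', inner_toLp] at h0
    have : ∫ ω, (ξ x ω : ℂ) * conj ((v ω : ℝ) : ℂ) ∂P = 0 := by
      simp only [Complex.conj_ofReal, ← Complex.ofReal_mul]
      rw [integral_complex_ofReal, h0, Complex.ofReal_zero]
    simp only [this, zero_mul, Pi.zero_apply]
  have hint : ∀ v : Lp ℝ 2 P, Integrable (fun ω => randomCoeff ξ ℓ m ω * conj ((v ω : ℝ) : ℂ)) P :=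
    fun v => integrable_mul_conj (𝕜 := ℂ) hL (Lp.memLp v).ofReal
  constructor
  · refine ⟨hL.re, ?_⟩
    rw [hHo, Submodule.mem_orthogonal]
    intro v hv
    have hv' : (Lp.memLp v).toLp v = v := Lp.toLp_coeFn v _
    rw [← hv', inner_toLp]
    have h1 := Complex.reCLM.integral_comp_comm (hint v)
    rw [key v hv, map_zero] at h1
    rw [← h1]
    exact integral_congr_ae (Eventually.of_forall fun ω => by simp [mul_comm])
  · refine ⟨hL.im, ?_⟩
    rw [hHo, Submodule.mem_orthogonal]
    intro v hv
    have hv' : (Lp.memLp v).toLp v = v := Lp.toLp_coeFn v _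
    rw [← hv', inner_toLp]
    have h1 := Complex.imCLM.integral_comp_comm (hint v)
    rw [key v hv, map_zero] at h1
    rw [← h1]
    exact integral_congr_ae (Eventually.of_forall fun ω => by simp [mul_comm])

end RandomCoeff

/-! ### Wiener integrals -/

section Wiener

variable {Ω : Type*} [MeasurableSpace Ω] {P : Measure Ω}

/-- The square integrable processes `B` and `B'` have the covariance `κ min(s, t)`. -/
structure HasBrownianCov (P : Measure Ω) (κ : ℝ) (B B' : ℝ → Ω → ℂ) : Prop where
  memLp_left : ∀ s, 0 ≤ s → MemLp (B s) 2 P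
  memLp_right : ∀ s, 0 ≤ s → MemLp (B' s) 2 P
  cov : ∀ s t, 0 ≤ s → 0 ≤ t → ∫ ω, B s ω * conj (B' t ω) ∂P = κ * (min s t : ℝ)

variable {T κ : ℝ} {B B' : ℝ → Ω → ℂ} {g g' : ℝ → ℝ} {X X' : Ω → ℂ}

/-- The second difference of `min` is the length of the overlap of `(a, b]` and `(d, e]`; this is
the core of the isometry. -/
theorem min_increments {a b d e : ℝ} (hab : a ≤ b) (hde : d ≤ e) :
    min b e - min b d - min a e + min a d = max (min b e - max a d) 0 := by
  rcases le_total b e with h1 | h1 <;> rcases le_total b d with h2 | h2 <;>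
    rcases le_total a e with h3 | h3 <;> rcases le_total a d with h4 | h4 <;>
    simp only [min_eq_left, min_eq_right, max_eq_left, max_eq_right, h1, h2, h3, h4] <;>
    first
    | (rw [max_eq_left (by linarith)]; linarith)
    | (rw [max_eq_right (by linarith)]; linarith)

theorem integral_indicator_mul_indicator {a b d e : ℝ} (ha : a ∈ Set.Icc 0 T)
    (hb : b ∈ Set.Icc 0 T) (hab : a ≤ b) (hde : d ≤ e) (c c' : ℝ) :
    ∫ u in Set.Icc 0 T, (Set.Ioc a b).indicator (fun _ => c) u *
        (Set.Ioc d e).indicator (fun _ => c') u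
      = c * c' * (min b e - min b d - min a e + min a d) := by
  have e1 : (fun u => (Set.Ioc a b).indicator (fun _ => c) u *
      (Set.Ioc d e).indicator (fun _ => c') u)
      = (Set.Ioc (max a d) (min b e)).indicator fun _ => c * c' := by
    funext u
    rw [← Set.Ioc_inter_Ioc]
    by_cases h1 : u ∈ Set.Ioc a b <;> by_cases h2 : u ∈ Set.Ioc d e <;>
      simp [h1, h2, Set.indicator]
  have hsub : Set.Icc 0 T ∩ Set.Ioc (max a d) (min b e) = Set.Ioc (max a d) (min b e) := by
    refine Set.inter_eq_right.2 fun u hu => ⟨?_, ?_⟩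
    · exact ha.1.trans ((le_max_left _ _).trans hu.1.le)
    · exact hu.2.trans ((min_le_left _ _).trans hb.2)
  rw [e1, setIntegral_indicator measurableSet_Ioc, hsub, setIntegral_const, Real.volume_real_Ioc,
    smul_eq_mul, min_increments hab hde, mul_comm]

namespace Step

theorem memLp_toFun (h : Step T) : MemLp h.toFun 2 (volume.restrict (Set.Icc 0 T)) :=
  memLp_finsetSum _ fun i _ => memLp_indicator_const 2 measurableSet_Ioc (h.c i)
    (Or.inr (measure_ne_top _ _))

theorem memLp_integral (h : Step T) (hB : ∀ s, 0 ≤ s → MemLp (B s) 2 P) :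
    MemLp (h.integral B) 2 P :=
  memLp_finsetSum _ fun _ _ => ((hB _ (h.mem _).1).sub (hB _ (h.mem _).1)).const_mul _

end Step

theorem integral_sub_mul_conj_sub {U V U' V' : Ω → ℂ} (hU : MemLp U 2 P) (hV : MemLp V 2 P)
    (hU' : MemLp U' 2 P) (hV' : MemLp V' 2 P) :
    ∫ ω, (U ω - V ω) * conj (U' ω - V' ω) ∂P
      = (∫ ω, U ω * conj (U' ω) ∂P - ∫ ω, U ω * conj (V' ω) ∂P)
        - (∫ ω, V ω * conj (U' ω) ∂P - ∫ ω, V ω * conj (V' ω) ∂P) := by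
  have hi : ∀ {F G : Ω → ℂ}, MemLp F 2 P → MemLp G 2 P →
    Integrable (fun ω => F ω * conj (G ω)) P := fun hF hG => integrable_mul_conj (𝕜 := ℂ) hF hG
  have hi2 : ∀ {F : Ω → ℂ}, MemLp F 2 P →
      Integrable (fun ω => F ω * conj (U' ω) - F ω * conj (V' ω)) P :=
    fun hF => (hi hF hU').sub (hi hF hV')
  rw [← integral_sub (hi hU hU') (hi hU hV'), ← integral_sub (hi hV hU') (hi hV hV'),
    ← integral_sub (hi2 hU) (hi2 hV)]
  exact integral_congr_ae (Eventually.of_forall fun ω => by simp only [map_sub]; ring)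

theorem HasBrownianCov.integral_increment (h : HasBrownianCov P κ B B') {a b d e : ℝ}
    (ha : 0 ≤ a) (hb : 0 ≤ b) (hd : 0 ≤ d) (he : 0 ≤ e) :
    ∫ ω, (B b ω - B a ω) * conj (B' e ω - B' d ω) ∂P
      = κ * ((min b e - min b d - min a e + min a d : ℝ) : ℂ) := by
  rw [integral_sub_mul_conj_sub (h.memLp_left b hb) (h.memLp_left a ha) (h.memLp_right e he)
    (h.memLp_right d hd),
    h.cov b e hb he, h.cov b d hb hd, h.cov a e ha he, h.cov a d ha hd]
  push_cast
  ring

/-- The isometry for integrals of step functions. -/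
theorem HasBrownianCov.integral_step (h : HasBrownianCov P κ B B') (f f' : Step T) :
    ∫ ω, f.integral B ω * conj (f'.integral B' ω) ∂P
      = κ * ((∫ u in Set.Icc 0 T, f.toFun u * f'.toFun u : ℝ) : ℂ) := by
  have h0 : ∀ (f : Step T) i, 0 ≤ f.s i := fun f i => (f.mem i).1
  have hi1 : ∀ i j, Integrable (fun ω => ((f.c i : ℂ) * (f'.c j : ℂ)) *
      ((B (f.s (i + 1)) ω - B (f.s i) ω) *
        conj (B' (f'.s (j + 1)) ω - B' (f'.s j) ω))) P := fun i j =>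
    (integrable_mul_conj (𝕜 := ℂ)
      ((h.memLp_left _ (h0 f (i + 1))).sub (h.memLp_left _ (h0 f i)))
      ((h.memLp_right _ (h0 f' (j + 1))).sub (h.memLp_right _ (h0 f' j)))).const_mul _
  have hi2 : ∀ i j, Integrable (fun u => (Set.Ioc (f.s i) (f.s (i + 1))).indicator
      (fun _ => f.c i) u * (Set.Ioc (f'.s j) (f'.s (j + 1))).indicator (fun _ => f'.c j) u)
      (volume.restrict (Set.Icc 0 T)) := fun i j =>
    MemLp.integrable_mul
      (memLp_indicator_const 2 measurableSet_Ioc _ (Or.inr (measure_ne_top _ _)))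
      (memLp_indicator_const 2 measurableSet_Ioc _ (Or.inr (measure_ne_top _ _)))
  calc ∫ ω, f.integral B ω * conj (f'.integral B' ω) ∂P
      = ∫ ω, ∑ i ∈ Finset.range f.n, ∑ j ∈ Finset.range f'.n, ((f.c i : ℂ) * (f'.c j : ℂ)) *
        ((B (f.s (i + 1)) ω - B (f.s i) ω) *
          conj (B' (f'.s (j + 1)) ω - B' (f'.s j) ω)) ∂P := by
        refine integral_congr_ae (Eventually.of_forall fun ω => ?_)
        simp only [Step.integral, map_sum, Finset.sum_mul_sum, map_mul, Complex.conj_ofReal]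
        exact Finset.sum_congr rfl fun i _ => Finset.sum_congr rfl fun j _ => by ring
    _ = ∑ i ∈ Finset.range f.n, ∑ j ∈ Finset.range f'.n, (κ : ℂ) *
        ((∫ u in Set.Icc 0 T, (Set.Ioc (f.s i) (f.s (i + 1))).indicator (fun _ => f.c i) u *
          (Set.Ioc (f'.s j) (f'.s (j + 1))).indicator (fun _ => f'.c j) u : ℝ) : ℂ) := by
        rw [integral_finsetSum _ fun i _ => integrable_finsetSum _ fun j _ => hi1 i j]
        refine Finset.sum_congr rfl fun i _ => ?_
        rw [integral_finsetSum _ fun j _ => hi1 i j]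
        refine Finset.sum_congr rfl fun j _ => ?_
        rw [integral_const_mul, h.integral_increment (h0 f _) (h0 f _) (h0 f' _) (h0 f' _),
          integral_indicator_mul_indicator (f.mem _) (f.mem _) (f.mono (Nat.le_succ i))
            (f'.mono (Nat.le_succ j))]
        push_cast
        ring
    _ = κ * ((∫ u in Set.Icc 0 T, ∑ i ∈ Finset.range f.n, ∑ j ∈ Finset.range f'.n,
          (Set.Ioc (f.s i) (f.s (i + 1))).indicator (fun _ => f.c i) u *
          (Set.Ioc (f'.s j) (f'.s (j + 1))).indicator (fun _ => f'.c j) u : ℝ) : ℂ) := by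
        rw [integral_finsetSum _ fun i _ => integrable_finsetSum _ fun j _ => hi2 i j]
        simp only [integral_finsetSum _ fun j _ => hi2 _ j]
        push_cast
        simp only [Finset.mul_sum]
    _ = _ := by simp only [Step.toFun, Finset.sum_mul_sum]

/-- The Wiener isometry. -/
theorem HasBrownianCov.integral_wiener (h : HasBrownianCov P κ B B')
    (hg : MemLp g 2 (volume.restrict (Set.Icc 0 T)))
    (hg' : MemLp g' 2 (volume.restrict (Set.Icc 0 T)))
    (hX : IsWienerIntegral P T g B X) (hX' : IsWienerIntegral P T g' B' X') :
    ∫ ω, X ω * conj (X' ω) ∂P = κ * ((∫ u in Set.Icc 0 T, g u * g' u : ℝ) : ℂ) := by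
  obtain ⟨h1, f, hf, hfX⟩ := hX
  obtain ⟨h2, f', hf', hfX'⟩ := hX'
  have t1 := integral_mul_conj_tendsto (𝕜 := ℂ) (fun n => (f n).memLp_integral h.memLp_left)
    (fun n => (f' n).memLp_integral h.memLp_right) h1 h2 hfX hfX'
  have t2 := integral_mul_conj_tendsto (𝕜 := ℝ) (fun n => (f n).memLp_toFun)
    (fun n => (f' n).memLp_toFun) hg hg' hf hf'
  simp only [conj_trivial] at t2
  have t3 := ((Complex.continuous_ofReal.tendsto _).comp t2).const_mul (κ : ℂ)
  refine tendsto_nhds_unique t1 (t3.congr fun n => ?_)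
  exact (h.integral_step (f n) (f' n)).symm

/-- By the isometry the four terms of `E |X - X'|²` are all equal and cancel. The value of
`wienerIntegral` is thus independent of the choice made in its definition, up to null sets. -/
theorem HasBrownianCov.ae_eq_of_isWienerIntegral (h : HasBrownianCov P κ B B)
    (hg : MemLp g 2 (volume.restrict (Set.Icc 0 T)))
    (hX : IsWienerIntegral P T g B X) (hX' : IsWienerIntegral P T g B X') : X =ᵐ[P] X' := by
  have hd : MemLp (fun ω => X ω - X' ω) 2 P := hX.1.sub hX'.1
  have e : ∫ ω, (X ω - X' ω) * conj (X ω - X' ω) ∂P = 0 := by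
    rw [integral_sub_mul_conj_sub hX.1 hX'.1 hX.1 hX'.1,
      h.integral_wiener hg hg hX hX, h.integral_wiener hg hg hX hX',
      h.integral_wiener hg hg hX' hX, h.integral_wiener hg hg hX' hX']
    ring
  have e2 : ∫ ω, ‖X ω - X' ω‖ ^ 2 ∂P = 0 := by
    apply Complex.ofReal_injective
    rw [← integral_complex_ofReal, Complex.ofReal_zero, ← e]
    exact integral_congr_ae (Eventually.of_forall fun ω => by
      simp only [Complex.mul_conj', Complex.ofReal_pow])
  have e3 := eLpNorm_two_eq hd
  rw [e2, Real.sqrt_zero, ENNReal.ofReal_zero, eLpNorm_eq_zero_iff hd.1 two_ne_zero] at e3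
  filter_upwards [e3] with ω hω
  exact sub_eq_zero.1 hω

/-- The step function with the right end point values of `g` on `k + 1` equal intervals. -/
noncomputable def stepApprox (hT : 0 < T) (g : ℝ → ℝ) (k : ℕ) : Step T where
  n := k + 1
  s i := min (i * (T / (k + 1))) T
  c i := g (min ((i + 1 : ℕ) * (T / (k + 1))) T)
  mono i j hij := by
    refine min_le_min_right _ (mul_le_mul_of_nonneg_right (by exact_mod_cast hij) (by positivity))
  mem i := ⟨le_min (by positivity) hT.le, min_le_right _ _⟩

theorem exists_stepApprox_eq (hT : 0 < T) (g : ℝ → ℝ) (k : ℕ) {u : ℝ} (hu : u ∈ Set.Ioc 0 T) :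
    ∃ v ∈ Set.Icc 0 T, |v - u| ≤ T / (k + 1) ∧ (stepApprox hT g k).toFun u = g v := by
  set δ : ℝ := T / (k + 1) with hδ
  have hδ0 : 0 < δ := by positivity
  have hkT : ((k + 1 : ℕ) : ℝ) * δ = T := by
    rw [hδ]; push_cast; field_simp
  -- The intervals are open on the left, so the one containing `u` has index `⌈u/δ⌉ - 1`.
  obtain ⟨i, hi⟩ : ∃ i, ⌈u / δ⌉₊ = i + 1 :=
    Nat.exists_eq_succ_of_ne_zero (Nat.ceil_pos.2 (div_pos hu.1 hδ0)).ne'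
  have hle : u ≤ ((i + 1 : ℕ) : ℝ) * δ := by
    rw [← hi]; exact (div_le_iff₀ hδ0).1 (Nat.le_ceil _)
  have hlt : (i : ℝ) * δ < u := by
    rw [← lt_div_iff₀ hδ0]
    exact Nat.lt_ceil.1 (by omega)
  have hik : i < k + 1 := by
    have h1 : (i : ℝ) * δ < ((k + 1 : ℕ) : ℝ) * δ := by rw [hkT]; exact hlt.trans_le hu.2
    exact_mod_cast lt_of_mul_lt_mul_right h1 hδ0.le
  have hmem : u ∈ Set.Ioc ((stepApprox hT g k).s i) ((stepApprox hT g k).s (i + 1)) :=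
    ⟨(min_le_left _ _).trans_lt hlt, le_min hle hu.2⟩
  refine ⟨(stepApprox hT g k).s (i + 1), (stepApprox hT g k).mem _, ?_, ?_⟩
  · rw [abs_of_nonneg (sub_nonneg.2 hmem.2)]
    have h1 : (stepApprox hT g k).s (i + 1) ≤ ((i + 1 : ℕ) : ℝ) * δ := min_le_left _ _
    push_cast at h1
    linarith
  · rw [Step.toFun, Finset.sum_eq_single_of_mem i
      (show i ∈ Finset.range (stepApprox hT g k).n from Finset.mem_range.2 hik),
      Set.indicator_of_mem hmem]
    · rfl
    · intro j _ hji
      refine Set.indicator_of_notMem (fun hj => ?_) _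
      rcases lt_or_gt_of_ne hji with hlt | hlt
      · exact absurd (hj.2.trans ((stepApprox hT g k).mono hlt)) (not_le.2 hmem.1)
      · exact absurd (hmem.2.trans ((stepApprox hT g k).mono hlt)) (not_le.2 hj.1)

theorem tendsto_stepApprox (hT : 0 < T) (hg : Continuous g) :
    Tendsto (fun k => eLpNorm (fun u => (stepApprox hT g k).toFun u - g u) 2
      (volume.restrict (Set.Icc 0 T))) atTop (𝓝 0) := by
  have huc := isCompact_Icc.uniformContinuousOn_of_continuous (s := Set.Icc 0 T) hg.continuousOn
  rw [Metric.uniformContinuousOn_iff] at huc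
  have hb : ∀ ε : ℝ, 0 < ε → ∀ᶠ k : ℕ in atTop,
      eLpNorm (fun u => (stepApprox hT g k).toFun u - g u) 2 (volume.restrict (Set.Icc 0 T))
        ≤ (volume.restrict (Set.Icc 0 T)) Set.univ ^ (2 : ℝ≥0∞).toReal⁻¹ * ENNReal.ofReal ε := by
    intro ε hε
    obtain ⟨δ, hδ, hd⟩ := huc ε hε
    have ht : Tendsto (fun k : ℕ => T / ((k : ℝ) + 1)) atTop (𝓝 0) :=
      tendsto_const_nhds.div_atTop (tendsto_atTop_add_const_right _ _ tendsto_natCast_atTop_atTop)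
    filter_upwards [ht.eventually_lt_const hδ] with k hk
    refine eLpNorm_le_of_ae_bound ?_
    -- The point `0` lies in no interval `(s i, s (i + 1)]`; it is a null set.
    have h0 : ∀ᵐ u ∂(volume.restrict (Set.Icc 0 T)), u ≠ 0 :=
      ae_restrict_of_ae (Measure.ae_ne volume 0)
    filter_upwards [ae_restrict_mem measurableSet_Icc, h0] with u hu hu0
    obtain ⟨v, hv, hvu, hvg⟩ := exists_stepApprox_eq hT g k (u := u)
      ⟨lt_of_le_of_ne hu.1 hu0.symm, hu.2⟩
    rw [hvg, ← dist_eq_norm]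
    exact (hd v hv u hu (by rw [Real.dist_eq]; exact hvu.trans_lt hk)).le
  set M : ℝ≥0∞ := (volume.restrict (Set.Icc 0 T)) Set.univ ^ (2 : ℝ≥0∞).toReal⁻¹ with hM
  have hMt : M ≠ ⊤ := ENNReal.rpow_ne_top_of_nonneg (by simp) (measure_ne_top _ _)
  rw [ENNReal.tendsto_nhds_zero]
  intro ε hε
  have hc : Tendsto (fun r : ℝ => M * ENNReal.ofReal r) (𝓝[>] 0) (𝓝 (M * ENNReal.ofReal 0)) :=
    ENNReal.Tendsto.const_mul
      ((ENNReal.continuous_ofReal.tendsto 0).mono_left nhdsWithin_le_nhds) (Or.inr hMt)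
  rw [ENNReal.ofReal_zero, mul_zero] at hc
  obtain ⟨r, hr, hr0⟩ := ((hc.eventually_le_const hε).and self_mem_nhdsWithin).exists
  filter_upwards [hb r hr0] with k hk using hk.trans hr

theorem HasBrownianCov.nonneg (h : HasBrownianCov P κ B B) : 0 ≤ κ := by
  have e := h.cov 1 1 zero_le_one zero_le_one
  have : ∫ ω, B 1 ω * conj (B 1 ω) ∂P = ((∫ ω, ‖B 1 ω‖ ^ 2 ∂P : ℝ) : ℂ) := by
    rw [← integral_complex_ofReal]
    exact integral_congr_ae (Eventually.of_forall fun ω => by simp [Complex.mul_conj'])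
  rw [this, min_self, Complex.ofReal_one, mul_one, Complex.ofReal_inj] at e
  rw [← e]
  positivity

/-- Up to the factor `√κ` integration of step functions is an isometry, so it carries Cauchy
sequences to Cauchy sequences. -/
theorem HasBrownianCov.norm_step_sub (h : HasBrownianCov P κ B B) (f f' : Step T) :
    ‖((f.memLp_integral h.memLp_left).toLp : Lp ℂ 2 P) - (f'.memLp_integral h.memLp_left).toLp‖
      = Real.sqrt κ * ‖((f.memLp_toFun).toLp : Lp ℝ 2 _) - (f'.memLp_toFun).toLp‖ := by
  have hi : ∀ p q : Step T, inner ℂ ((p.memLp_integral h.memLp_left).toLp : Lp ℂ 2 P)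
      ((q.memLp_integral h.memLp_left).toLp)
      = (κ : ℂ) * ((inner ℝ ((p.memLp_toFun).toLp : Lp ℝ 2 _) (q.memLp_toFun).toLp : ℝ) : ℂ) := by
    intro p q
    rw [← integral_mul_conj_eq_inner, ← integral_mul_conj_eq_inner, h.integral_step]
    simp
  have hsq : ((‖((f.memLp_integral h.memLp_left).toLp : Lp ℂ 2 P) -
      (f'.memLp_integral h.memLp_left).toLp‖ ^ 2 : ℝ) : ℂ)
      = ((κ * ‖((f.memLp_toFun).toLp : Lp ℝ 2 _) - (f'.memLp_toFun).toLp‖ ^ 2 : ℝ) : ℂ) := by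
    rw [← real_inner_self_eq_norm_sq ((f.memLp_toFun).toLp - (f'.memLp_toFun).toLp : Lp ℝ 2 _),
      Complex.ofReal_pow]
    refine (inner_self_eq_norm_sq_to_K (𝕜 := ℂ) ((f.memLp_integral h.memLp_left).toLp -
      (f'.memLp_integral h.memLp_left).toLp : Lp ℂ 2 P)).symm.trans ?_
    simp only [inner_sub_left, inner_sub_right, hi]
    push_cast
    ring
  rw [Complex.ofReal_inj] at hsq
  rw [← Real.sqrt_sq (norm_nonneg (((f.memLp_integral h.memLp_left).toLp : Lp ℂ 2 P) -
      (f'.memLp_integral h.memLp_left).toLp)), hsq, Real.sqrt_mul h.nonneg,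
    Real.sqrt_sq (norm_nonneg _)]

/-- Continuous functions have Wiener integrals. -/
theorem HasBrownianCov.exists_isWienerIntegral (h : HasBrownianCov P κ B B) (hT : 0 < T)
    (hg : Continuous g) (hg2 : MemLp g 2 (volume.restrict (Set.Icc 0 T))) :
    ∃ X, IsWienerIntegral P T g B X := by
  have hc := ((Lp.tendsto_Lp_iff_tendsto_eLpNorm'' (fun k => (stepApprox hT g k).toFun)
    (fun k => (stepApprox hT g k).memLp_toFun) g hg2).2 (tendsto_stepApprox hT hg)).cauchySeq
  have hcX : CauchySeq fun k =>
      (((stepApprox hT g k).memLp_integral h.memLp_left).toLp : Lp ℂ 2 P) := by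
    rw [Metric.cauchySeq_iff] at hc ⊢
    intro ε hε
    -- The added `1` keeps the denominator positive when `κ = 0`.
    obtain ⟨N, hN⟩ := hc (ε / (Real.sqrt κ + 1)) (by positivity)
    refine ⟨N, fun m hm n hn => ?_⟩
    have h1 := hN m hm n hn
    rw [dist_eq_norm] at h1 ⊢
    rw [h.norm_step_sub]
    rw [lt_div_iff₀ (by positivity)] at h1
    nlinarith [norm_nonneg (((stepApprox hT g m).memLp_toFun.toLp : Lp ℝ 2 _) -
      (stepApprox hT g n).memLp_toFun.toLp)]
  obtain ⟨Y, hY⟩ := cauchySeq_tendsto_of_complete hcX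
  refine ⟨Y, Lp.memLp Y, stepApprox hT g, tendsto_stepApprox hT hg, ?_⟩
  refine (Lp.tendsto_Lp_iff_tendsto_eLpNorm'' (fun k => (stepApprox hT g k).integral B)
    (fun k => (stepApprox hT g k).memLp_integral h.memLp_left) Y (Lp.memLp Y)).1 ?_
  rwa [Lp.toLp_coeFn]

theorem isWienerIntegral_wienerIntegral (h : ∃ X, IsWienerIntegral P T g B X) :
    IsWienerIntegral P T g B (wienerIntegral P T g B) := by
  rw [wienerIntegral, dif_pos h]
  exact h.choose_spec

/-- The integrand is real, so conjugating the integrator and multiplying it by a unit passes through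
the same step functions. Used for the relation between orders `m` and `-m`. -/
theorem IsWienerIntegral.conj (hX : IsWienerIntegral P T g B X) {ε : ℂ} (hε : ‖ε‖ = 1)
    (hB : ∀ s ω, B' s ω = ε * conj (B s ω)) :
    IsWienerIntegral P T g B' (fun ω => ε * conj (X ω)) := by
  obtain ⟨h1, f, h2, h3⟩ := hX
  refine ⟨h1.star.const_mul ε, f, h2, h3.congr fun k => ?_⟩
  refine eLpNorm_congr_norm_ae (Eventually.of_forall fun ω => ?_)
  have e : (f k).integral B' ω - ε * conj (X ω) = ε * conj ((f k).integral B ω - X ω) := by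
    simp only [Step.integral, hB, map_sub, map_sum, map_mul, Complex.conj_ofReal, mul_sub,
      Finset.mul_sum]
    congr 1
    exact Finset.sum_congr rfl fun i _ => by ring
  rw [e, norm_mul, hε, one_mul, RCLike.norm_conj]

theorem IsWienerIntegral.inSpace (hX : IsWienerIntegral P T g B X) {H : Submodule ℝ (Lp ℝ 2 P)}
    (hH : IsClosed (H : Set (Lp ℝ 2 P)))
    (hB : ∀ s, 0 ≤ s → InSpace H (fun ω => (B s ω).re) ∧ InSpace H (fun ω => (B s ω).im)) :
    InSpace H (fun ω => (X ω).re) ∧ InSpace H (fun ω => (X ω).im) := by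
  obtain ⟨h1, f, -, h3⟩ := hX
  constructor
  · refine InSpace.of_tendsto hH (F := fun k ω => ((f k).integral B ω).re) (fun k => ?_) h1.re.1 ?_
    · refine (InSpace.sum (Finset.range (f k).n) fun i _ => (((hB _ ((f k).mem (i + 1)).1).1.sub
        (hB _ ((f k).mem i).1).1).const_mul ((f k).c i))).congr (Eventually.of_forall fun ω => ?_)
      simp [Step.integral, Complex.re_sum]
    · refine tendsto_of_tendsto_of_tendsto_of_le_of_le tendsto_const_nhds h3
        (fun _ => zero_le) fun k => eLpNorm_mono fun ω => ?_
      simpa using Complex.abs_re_le_norm ((f k).integral B ω - X ω)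
  · refine InSpace.of_tendsto hH (F := fun k ω => ((f k).integral B ω).im) (fun k => ?_) h1.im.1 ?_
    · refine (InSpace.sum (Finset.range (f k).n) fun i _ => (((hB _ ((f k).mem (i + 1)).1).2.sub
        (hB _ ((f k).mem i).1).2).const_mul ((f k).c i))).congr (Eventually.of_forall fun ω => ?_)
      simp [Step.integral, Complex.im_sum]
    · refine tendsto_of_tendsto_of_tendsto_of_le_of_le tendsto_const_nhds h3
        (fun _ => zero_le) fun k => eLpNorm_mono fun ω => ?_
      simpa using Complex.abs_im_le_norm ((f k).integral B ω - X ω)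

/-- Orthogonality to the integrator extends to step integrals by linearity and to their limit by
continuity of the inner product. -/
theorem IsWienerIntegral.integral_mul_conj_eq_zero (hX : IsWienerIntegral P T g B X)
    (hB : ∀ s, 0 ≤ s → MemLp (B s) 2 P) {Z : Ω → ℂ} (hZ : MemLp Z 2 P)
    (h0 : ∀ s, 0 ≤ s → ∫ ω, Z ω * conj (B s ω) ∂P = 0) : ∫ ω, Z ω * conj (X ω) ∂P = 0 := by
  obtain ⟨h1, f, -, h3⟩ := hX
  have hl := integral_mul_conj_tendsto (𝕜 := ℂ) (fun _ => hZ)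
    (fun k => (f k).memLp_integral hB) hZ h1 (by simp) h3
  refine tendsto_nhds_unique hl (tendsto_const_nhds.congr fun k => ?_)
  have hi : ∀ s, 0 ≤ s → Integrable (fun ω => Z ω * conj (B s ω)) P := fun s hs =>
    integrable_mul_conj (𝕜 := ℂ) hZ (hB s hs)
  have e : ∀ ω, Z ω * conj ((f k).integral B ω) = ∑ i ∈ Finset.range (f k).n, ((f k).c i : ℂ) *
      (Z ω * conj (B ((f k).s (i + 1)) ω) - Z ω * conj (B ((f k).s i) ω)) := by
    intro ω
    simp only [Step.integral, map_sum, map_mul, map_sub, Complex.conj_ofReal, Finset.mul_sum]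
    exact Finset.sum_congr rfl fun i _ => by ring
  have hs : ∀ i, Integrable (fun ω => ((f k).c i : ℂ) *
      (Z ω * conj (B ((f k).s (i + 1)) ω) - Z ω * conj (B ((f k).s i) ω))) P := fun i =>
    ((hi _ ((f k).mem (i + 1)).1).sub (hi _ ((f k).mem i).1)).const_mul _
  simp only [e]
  rw [integral_finsetSum _ fun i _ => hs i]
  symm
  refine Finset.sum_eq_zero fun i _ => ?_
  rw [integral_const_mul, integral_sub (hi _ ((f k).mem (i + 1)).1) (hi _ ((f k).mem i).1),
    h0 _ ((f k).mem (i + 1)).1, h0 _ ((f k).mem i).1, sub_zero, mul_zero]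

end Wiener

/-! ### The noise -/

theorem isGaussianProcess_sumElim {Ω : Type*} [MeasurableSpace Ω] {P : Measure Ω}
    {S T : Type*} {X : S → Ω → ℝ} {Y : T → Ω → ℝ}
    (hX : IsGaussianProcess X P) (hY : IsGaussianProcess Y P)
    (h : IndepFun (fun ω s => X s ω) (fun ω s => Y s ω) P) :
    IsGaussianProcess (Sum.elim X Y) P := by
  classical
  refine ⟨fun I => ?_⟩
  have hi : IndepFun (fun ω => I.toLeft.restrict (X · ω)) (fun ω => I.toRight.restrict (Y · ω)) P :=
    h.comp (φ := fun x : S → ℝ => I.toLeft.restrict x) (ψ := fun x : T → ℝ => I.toRight.restrict x)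
      (measurable_pi_lambda _ fun i => measurable_pi_apply _)
      (measurable_pi_lambda _ fun i => measurable_pi_apply _)
  have hg := hi.hasGaussianLaw (hX.hasGaussianLaw _) (hY.hasGaussianLaw _)
  let l : (I.toLeft → ℝ) × (I.toRight → ℝ) →L[ℝ] (I → ℝ) := ContinuousLinearMap.pi fun i =>
    match i with
    | ⟨Sum.inl x, hx⟩ => (ContinuousLinearMap.proj (R := ℝ) (φ := fun _ : I.toLeft => ℝ)
        ⟨x, Finset.mem_toLeft.2 hx⟩).comp (ContinuousLinearMap.fst ℝ _ _)
    | ⟨Sum.inr y, hy⟩ => (ContinuousLinearMap.proj (R := ℝ) (φ := fun _ : I.toRight => ℝ)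
        ⟨y, Finset.mem_toRight.2 hy⟩).comp (ContinuousLinearMap.snd ℝ _ _)
  have e : (fun ω => I.restrict (Sum.elim X Y · ω))
      = l ∘ fun ω => (I.toLeft.restrict (X · ω), I.toRight.restrict (Y · ω)) := by
    funext ω i
    rcases i with ⟨i | i, hi⟩ <;> rfl
  rw [e]
  exact hg.map l

section Harmonics

theorem sphericalCoeff_eq_inner (u : L2S) (ℓ : ℕ) (m : ℤ) :
    sphericalCoeff u ℓ m = ((inner ℝ (harmonicRe ℓ m) u : ℝ) : ℂ)
      - Complex.I * ((inner ℝ (harmonicIm ℓ m) u : ℝ) : ℂ) := by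
  have hre : (harmonicRe ℓ m : S2 → ℝ) =ᵐ[sphereMeasure] fun x => (sphericalHarmonic ℓ m x).re :=
    ContinuousMap.coeFn_toLp _ _
  have him : (harmonicIm ℓ m : S2 → ℝ) =ᵐ[sphereMeasure] fun x => (sphericalHarmonic ℓ m x).im :=
    ContinuousMap.coeFn_toLp _ _
  rw [L2.inner_def, L2.inner_def, ← integral_complex_ofReal, ← integral_complex_ofReal,
    ← integral_const_mul, ← integral_sub (L2.integrable_inner _ _).ofReal
    ((L2.integrable_inner _ _).ofReal.const_mul _), sphericalCoeff]
  refine integral_congr_ae ?_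
  filter_upwards [hre, him] with x h1 h2
  simp only [h1, h2, RCLike.inner_apply, conj_trivial]
  apply Complex.ext <;> simp [mul_comm]

/-- Complex orthonormality in terms of real inner products. The real and imaginary parts need not be
orthonormal separately; only these two combinations are controlled. -/
theorem inner_harmonic {ℓ ℓ' : ℕ} {m m' : ℤ} (hm : m ∈ Finset.Icc (-(ℓ : ℤ)) ℓ)
    (hm' : m' ∈ Finset.Icc (-(ℓ' : ℤ)) ℓ') :
    ((inner ℝ (harmonicRe ℓ m) (harmonicRe ℓ' m') + inner ℝ (harmonicIm ℓ m) (harmonicIm ℓ' m')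
        : ℝ) : ℂ)
      + Complex.I * ((inner ℝ (harmonicRe ℓ m) (harmonicIm ℓ' m')
        - inner ℝ (harmonicIm ℓ m) (harmonicRe ℓ' m') : ℝ) : ℂ)
      = if ℓ = ℓ' ∧ m = m' then 1 else 0 := by
  have hre : (harmonicRe ℓ' m' : S2 → ℝ) =ᵐ[sphereMeasure]
      fun x => (sphericalHarmonic ℓ' m' x).re := ContinuousMap.coeFn_toLp _ _
  have him : (harmonicIm ℓ' m' : S2 → ℝ) =ᵐ[sphereMeasure]
      fun x => (sphericalHarmonic ℓ' m' x).im := ContinuousMap.coeFn_toLp _ _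
  have hi : ∀ u : L2S, Integrable (fun x => ((u x : ℝ) : ℂ) * conj (sphericalHarmonic ℓ m x))
      sphereMeasure := by
    intro u
    obtain ⟨C, -, hC⟩ := exists_norm_le_of_continuous (continuous_sphericalHarmonic ℓ m)
    refine (((Lp.memLp u).integrable one_le_two).ofReal (𝕜 := ℂ)).mul_bdd (c := C)
      (measurable_conj_sphericalHarmonic ℓ m).aestronglyMeasurable
      (Eventually.of_forall fun x => ?_)
    rw [RCLike.norm_conj]
    exact hC x
  have e : sphericalCoeff (harmonicRe ℓ' m') ℓ m + Complex.I * sphericalCoeff (harmonicIm ℓ' m') ℓ m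
      = if ℓ = ℓ' ∧ m = m' then 1 else 0 := by
    rw [← integral_conj_harmonic_mul hm hm', sphericalCoeff, sphericalCoeff, ← integral_const_mul,
      ← integral_add (hi _) ((hi _).const_mul _)]
    refine integral_congr_ae ?_
    filter_upwards [hre, him] with x h1 h2
    rw [h1, h2]
    conv_rhs => rw [← Complex.re_add_im (sphericalHarmonic ℓ' m' x)]
    ring
  rw [← e, sphericalCoeff_eq_inner, sphericalCoeff_eq_inner]
  push_cast
  linear_combination ((inner ℝ (harmonicIm ℓ m) (harmonicIm ℓ' m') : ℝ) : ℂ) * Complex.I_sq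

theorem noiseCoeff_eq {Ω : Type*} (τ : ℝ) (W : ℝ → Ω → L2S) (ℓ : ℕ) (m : ℤ) (s : ℝ) (ω : Ω) :
    noiseCoeff τ W ℓ m s ω = ((inner ℝ (harmonicRe ℓ m) (W (τ + s) ω) : ℝ) : ℂ)
      - Complex.I * ((inner ℝ (harmonicIm ℓ m) (W (τ + s) ω) : ℝ) : ℂ) :=
  sphericalCoeff_eq_inner _ _ _

theorem noiseCoeff_neg {Ω : Type*} (τ : ℝ) (W : ℝ → Ω → L2S) (ℓ : ℕ) (m : ℤ) (s : ℝ) (ω : Ω) :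
    noiseCoeff τ W ℓ (-m) s ω = (-1) ^ m.natAbs * conj (noiseCoeff τ W ℓ m s ω) :=
  sphericalCoeff_neg _ _ _

end Harmonics

namespace IsQWiener

variable {Ω : Type*} [MeasurableSpace Ω] {P : Measure Ω} {τ : ℝ} {Q : L2S →L[ℝ] L2S}
  {W : ℝ → Ω → L2S}

theorem hasLaw_inner (hW : IsQWiener P τ Q W) {t : ℝ} (ht : τ ≤ t) (f : L2S) :
    HasLaw (fun ω => inner ℝ f (W t ω))
      (gaussianReal 0 (Real.toNNReal ((t - τ) * inner ℝ (Q f) f))) P := by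
  refine (hW.law τ t le_rfl ht f).congr ?_
  filter_upwards [hW.start] with ω hω
  rw [hω, sub_zero]

theorem memLp_inner (hW : IsQWiener P τ Q W) {t : ℝ} (ht : τ ≤ t) (f : L2S) :
    MemLp (fun ω => inner ℝ f (W t ω)) 2 P :=
  (hW.hasLaw_inner ht f).hasGaussianLaw.memLp_two

theorem integral_inner (hW : IsQWiener P τ Q W) {t : ℝ} (ht : τ ≤ t) (f : L2S) :
    ∫ ω, inner ℝ f (W t ω) ∂P = 0 := by
  rw [(hW.hasLaw_inner ht f).integral_eq]
  simp

theorem integral_inner_sq (hW : IsQWiener P τ Q W) {t : ℝ} (ht : τ ≤ t) (f : L2S) :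
    ∫ ω, inner ℝ f (W t ω) ^ 2 ∂P = (t - τ) * inner ℝ (Q f) f := by
  have h := (hW.hasLaw_inner ht f).variance_eq
  rw [variance_of_integral_eq_zero (hW.memLp_inner ht f).1.aemeasurable (hW.integral_inner ht f),
    variance_id_gaussianReal, Real.coe_toNNReal _
      (mul_nonneg (sub_nonneg.2 ht) (hW.isPositive.inner_nonneg_left f))] at h
  exact h

/-- Polarization of the variances, with symmetry of `Q`. -/
theorem integral_inner_mul_inner_self (hW : IsQWiener P τ Q W) {t : ℝ} (ht : τ ≤ t) (f g : L2S) :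
    ∫ ω, inner ℝ f (W t ω) * inner ℝ g (W t ω) ∂P = (t - τ) * inner ℝ (Q f) g := by
  have h1 := hW.integral_inner_sq ht (f + g)
  have h2 := hW.integral_inner_sq ht (f - g)
  have hs : inner ℝ (Q g) f = inner ℝ (Q f) g := by
    rw [real_inner_comm]
    exact (hW.isPositive.isSymmetric f g).symm
  have hd : ∫ ω, inner ℝ (f + g) (W t ω) ^ 2 ∂P - ∫ ω, inner ℝ (f - g) (W t ω) ^ 2 ∂P
      = 4 * ∫ ω, inner ℝ f (W t ω) * inner ℝ g (W t ω) ∂P := by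
    rw [← integral_sub (hW.memLp_inner ht _).integrable_sq (hW.memLp_inner ht _).integrable_sq,
      ← integral_const_mul]
    refine integral_congr_ae (Eventually.of_forall fun ω => ?_)
    simp only [inner_add_left, inner_sub_left]
    ring
  rw [h1, h2] at hd
  simp only [map_add, map_sub, inner_add_left, inner_sub_left, inner_add_right, inner_sub_right,
    hs] at hd
  linarith

/-- The increment after time `s` is independent of `W s` and `⟨f, W s⟩` is centred, so only the
covariance at time `s` remains. -/
theorem integral_inner_mul_inner_of_le (hW : IsQWiener P τ Q W) {s t : ℝ} (hs : τ ≤ s)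
    (hst : s ≤ t) (f g : L2S) :
    ∫ ω, inner ℝ f (W s ω) * inner ℝ g (W t ω) ∂P = (s - τ) * inner ℝ (Q f) g := by
  have ht := hs.trans hst
  have hi : IndepFun (W s) (W t - W s) P :=
    hW.indep.indepFun_eval_sub (r := ⟨τ, Set.mem_Ici.2 le_rfl⟩) (s := ⟨s, hs⟩) (t := ⟨t, ht⟩)
      (Subtype.mk_le_mk.2 hs) (Subtype.mk_le_mk.2 hst) hW.start
  have hm : ∀ f : L2S, Measurable fun x : L2S => inner ℝ f x := fun f =>
    (continuous_const.inner continuous_id).measurable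
  have hi' : IndepFun (fun ω => inner ℝ f (W s ω)) (fun ω => inner ℝ g (W t ω - W s ω)) P :=
    hi.comp (hm f) (hm g)
  have hd : MemLp (fun ω => inner ℝ g (W t ω - W s ω)) 2 P := by
    simp only [inner_sub_right]
    exact (hW.memLp_inner ht g).sub (hW.memLp_inner hs g)
  have h0 : ∫ ω, inner ℝ f (W s ω) * inner ℝ g (W t ω - W s ω) ∂P = 0 := by
    rw [hi'.integral_fun_mul_eq_mul_integral (hW.memLp_inner hs f).1 hd.1, hW.integral_inner hs,
      zero_mul]
  have hm' : ∀ {r : ℝ}, τ ≤ r → Integrable (fun ω => inner ℝ f (W s ω) * inner ℝ g (W r ω)) P :=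
    fun hr => MemLp.integrable_mul (hW.memLp_inner hs f) (hW.memLp_inner hr g)
  rw [← hW.integral_inner_mul_inner_self hs f g, ← sub_eq_zero, ← integral_sub (hm' ht) (hm' hs),
    ← h0]
  refine integral_congr_ae (Eventually.of_forall fun ω => ?_)
  simp only [inner_sub_right]
  ring

theorem integral_inner_mul_inner (hW : IsQWiener P τ Q W) {s t : ℝ} (hs : τ ≤ s)
    (ht : τ ≤ t) (f g : L2S) :
    ∫ ω, inner ℝ f (W s ω) * inner ℝ g (W t ω) ∂P = (min s t - τ) * inner ℝ (Q f) g := by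
  rcases le_total s t with h | h
  · rw [min_eq_left h, hW.integral_inner_mul_inner_of_le hs h]
  · have hs' : inner ℝ (Q g) f = inner ℝ (Q f) g := by
      rw [real_inner_comm]
      exact (hW.isPositive.isSymmetric f g).symm
    rw [min_eq_right h, ← hs', ← hW.integral_inner_mul_inner_of_le ht h]
    simp only [mul_comm]

/-- Independent increments and the start at zero reduce joint Gaussianity in `L²(S²)` to single
times. There every continuous functional is an inner product by Riesz, and its law is prescribed. -/
theorem isGaussianProcess (hW : IsQWiener P τ Q W) :
    IsGaussianProcess (fun (p : Set.Ici τ × L2S) ω => inner ℝ p.2 (W p.1 ω)) P := by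
  have : SecondCountableTopology L2S := by
    have : Fact ((2 : ℝ≥0∞) ≠ ⊤) := ⟨ENNReal.ofNat_ne_top⟩
    exact Lp.SecondCountableTopology
  have hg : IsGaussianProcess (fun (t : Set.Ici τ) ω => W t ω) P := by
    refine hW.indep.isGaussianProcess (fun t => ⟨isGaussian_of_map_eq_gaussianReal fun l => ?_⟩)
      hW.start
    refine ⟨0, Real.toNNReal ((t - τ) * inner ℝ
      (Q ((InnerProductSpace.toDual ℝ L2S).symm l)) ((InnerProductSpace.toDual ℝ L2S).symm l)), ?_⟩
    · rw [← (hW.hasLaw_inner t.2 ((InnerProductSpace.toDual ℝ L2S).symm l)).map_eq,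
        Measure.map_map l.measurable (hW.measurable t t.2)]
      congr 1
      funext ω
      exact InnerProductSpace.toDual_symm_apply.symm
  exact hg.of_isGaussianProcess fun p => ⟨{p.1}, (innerSL ℝ p.2).comp
    (ContinuousLinearMap.proj ⟨p.1, Finset.mem_singleton_self _⟩), fun ω => rfl⟩

variable {A : ℕ → ℝ}

theorem memLp_noiseCoeff (hW : IsQWiener P τ Q W) (ℓ : ℕ) (m : ℤ) {s : ℝ} (hs : 0 ≤ s) :
    MemLp (noiseCoeff τ W ℓ m s) 2 P := by
  have : noiseCoeff τ W ℓ m s = _ := funext fun ω => noiseCoeff_eq τ W ℓ m s ω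
  rw [this]
  have ht : τ ≤ τ + s := by linarith
  exact (hW.memLp_inner ht _).ofReal.sub ((hW.memLp_inner ht _).ofReal.const_mul _)

theorem hasBrownianCov (hW : IsQWiener P τ Q W) (hQ : HasHarmonicSpectrum Q A)
    {ℓ ℓ' : ℕ} {m m' : ℤ} (hm : m ∈ Finset.Icc (-(ℓ : ℤ)) ℓ)
    (hm' : m' ∈ Finset.Icc (-(ℓ' : ℤ)) ℓ') :
    HasBrownianCov P (if ℓ = ℓ' ∧ m = m' then A ℓ else 0) (noiseCoeff τ W ℓ m)
      (noiseCoeff τ W ℓ' m') where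
  memLp_left _ hs := hW.memLp_noiseCoeff ℓ m hs
  memLp_right _ hs := hW.memLp_noiseCoeff ℓ' m' hs
  cov s t hs ht := by
    have hs' : τ ≤ τ + s := by linarith
    have ht' : τ ≤ τ + t := by linarith
    have hi : ∀ f g : L2S, Integrable
        (fun ω => inner ℝ f (W (τ + s) ω) * inner ℝ g (W (τ + t) ω)) P := fun f g =>
      MemLp.integrable_mul (hW.memLp_inner hs' f) (hW.memLp_inner ht' g)
    have hmin : min (τ + s) (τ + t) - τ = min s t := by
      rw [min_add_add_left]; ring
    obtain ⟨q1, q2⟩ := hQ ℓ m hm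
    have hr := hi (harmonicRe ℓ m) (harmonicRe ℓ' m')
    have hr' := hi (harmonicIm ℓ m) (harmonicIm ℓ' m')
    have hm1 := hi (harmonicRe ℓ m) (harmonicIm ℓ' m')
    have hm2 := hi (harmonicIm ℓ m) (harmonicRe ℓ' m')
    have e : ∀ ω, noiseCoeff τ W ℓ m s ω * conj (noiseCoeff τ W ℓ' m' t ω)
        = ((inner ℝ (harmonicRe ℓ m) (W (τ + s) ω) * inner ℝ (harmonicRe ℓ' m') (W (τ + t) ω)
          + inner ℝ (harmonicIm ℓ m) (W (τ + s) ω) * inner ℝ (harmonicIm ℓ' m') (W (τ + t) ω)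
            : ℝ) : ℂ)
        + Complex.I *
          ((inner ℝ (harmonicRe ℓ m) (W (τ + s) ω) * inner ℝ (harmonicIm ℓ' m') (W (τ + t) ω)
          - inner ℝ (harmonicIm ℓ m) (W (τ + s) ω) * inner ℝ (harmonicRe ℓ' m') (W (τ + t) ω)
            : ℝ) : ℂ) := by
      intro ω
      rw [noiseCoeff_eq, noiseCoeff_eq]
      simp only [map_sub, map_mul, Complex.conj_ofReal, Complex.conj_I]
      push_cast
      linear_combination (-((inner ℝ (harmonicIm ℓ m) (W (τ + s) ω) : ℝ) : ℂ) *
        ((inner ℝ (harmonicIm ℓ' m') (W (τ + t) ω) : ℝ) : ℂ)) * Complex.I_sq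
    simp only [e]
    rw [integral_add (hr.add hr').ofReal ((hm1.sub hm2).ofReal.const_mul _), integral_const_mul,
      integral_complex_ofReal, integral_complex_ofReal, integral_add hr hr', integral_sub hm1 hm2]
    simp only [hW.integral_inner_mul_inner hs' ht', hmin, q1, q2, inner_smul_left, conj_trivial]
    -- Since `Q` acts as the scalar `A ℓ` on both parts of the harmonic, the covariances combine
    -- into exactly this expression.
    have k := inner_harmonic hm hm'
    have : ((if ℓ = ℓ' ∧ m = m' then A ℓ else 0 : ℝ) : ℂ)
        = A ℓ * (if ℓ = ℓ' ∧ m = m' then 1 else 0) := by split_ifs <;> simp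
    rw [this, ← k]
    push_cast
    ring

theorem inSpace_noiseCoeff {H : Submodule ℝ (Lp ℝ 2 P)}
    (hH : ∀ t, τ ≤ t → ∀ f : L2S, InSpace H (fun ω => inner ℝ f (W t ω))) (ℓ : ℕ) (m : ℤ) {s : ℝ}
    (hs : 0 ≤ s) : InSpace H (fun ω => (noiseCoeff τ W ℓ m s ω).re) ∧
      InSpace H (fun ω => (noiseCoeff τ W ℓ m s ω).im) := by
  have ht : τ ≤ τ + s := by linarith
  refine ⟨(hH _ ht (harmonicRe ℓ m)).congr (Eventually.of_forall fun ω => ?_),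
    ((hH _ ht (harmonicIm ℓ m)).const_mul (-1)).congr (Eventually.of_forall fun ω => ?_)⟩
  · simp [noiseCoeff_eq]
  · simp [noiseCoeff_eq]

end IsQWiener

/-! ### The coefficients of the solution -/

section Solution

variable {Ω : Type*} [MeasurableSpace Ω] {P : Measure Ω}

namespace IsSpectralFamily

variable {a b : ℕ → ℤ → Ω → ℂ} {v w : ℕ → ℝ}

theorem add (ha : IsSpectralFamily P a v) (hb : IsSpectralFamily P b w)
    (h : ∀ (ℓ ℓ' : ℕ) (m m' : ℤ), m ∈ Finset.Icc (-(ℓ : ℤ)) ℓ → m' ∈ Finset.Icc (-(ℓ' : ℤ)) ℓ' →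
      ∫ ω, a ℓ m ω * conj (b ℓ' m' ω) ∂P = 0) :
    IsSpectralFamily P (fun ℓ m ω => a ℓ m ω + b ℓ m ω) (fun ℓ => v ℓ + w ℓ) where
  memLp ℓ m hm := (ha.memLp ℓ m hm).add (hb.memLp ℓ m hm)
  cov ℓ ℓ' m m' hm hm' := by
    have hi : ∀ {U V : Ω → ℂ}, MemLp U 2 P → MemLp V 2 P →
      Integrable (fun ω => U ω * conj (V ω)) P := fun hU hV => integrable_mul_conj (𝕜 := ℂ) hU hV
    have h1 := hi (ha.memLp ℓ m hm) (ha.memLp ℓ' m' hm')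
    have h2 := hi (ha.memLp ℓ m hm) (hb.memLp ℓ' m' hm')
    have h3 := hi (hb.memLp ℓ m hm) (ha.memLp ℓ' m' hm')
    have h4 := hi (hb.memLp ℓ m hm) (hb.memLp ℓ' m' hm')
    have h12 : Integrable (fun ω => a ℓ m ω * conj (a ℓ' m' ω) + a ℓ m ω * conj (b ℓ' m' ω)) P :=
      h1.add h2
    have h34 : Integrable (fun ω => b ℓ m ω * conj (a ℓ' m' ω) + b ℓ m ω * conj (b ℓ' m' ω)) P :=
      h3.add h4
    have e : ∀ ω, (a ℓ m ω + b ℓ m ω) * conj (a ℓ' m' ω + b ℓ' m' ω)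
        = (a ℓ m ω * conj (a ℓ' m' ω) + a ℓ m ω * conj (b ℓ' m' ω))
          + (b ℓ m ω * conj (a ℓ' m' ω) + b ℓ m ω * conj (b ℓ' m' ω)) := fun ω => by
      rw [map_add]; ring
    have e3 : ∫ ω, b ℓ m ω * conj (a ℓ' m' ω) ∂P = 0 := by
      have := congrArg conj (h ℓ' ℓ m' m hm' hm)
      rw [← integral_conj, map_zero] at this
      rw [← this]
      exact integral_congr_ae (Eventually.of_forall fun ω => by
        simp only [map_mul, Complex.conj_conj]; ring)
    simp only [e]
    rw [integral_add h12 h34, integral_add h1 h2, integral_add h3 h4, h _ _ _ _ hm hm', e3,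
      ha.cov _ _ _ _ hm hm', hb.cov _ _ _ _ hm hm']
    split_ifs <;> simp
  real ℓ m hm := by
    filter_upwards [ha.real ℓ m hm, hb.real ℓ m hm] with ω h1 h2
    rw [h1, h2, map_add, mul_add]
  summable := by
    simpa only [mul_add] using ha.summable.add hb.summable

end IsSpectralFamily

theorem IsL2Sum.add {a b : ℕ → ℤ → Ω → ℂ} {U V : S2 → Ω → ℝ} (hU : IsL2Sum P a U)
    (hV : IsL2Sum P b V) (ha : ∀ L, AEStronglyMeasurable
      (fun p : Ω × S2 => partialSum a L p.2 p.1) (P.prod sphereMeasure))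
    (hb : ∀ L, AEStronglyMeasurable
      (fun p : Ω × S2 => partialSum b L p.2 p.1) (P.prod sphereMeasure)) :
    IsL2Sum P (fun ℓ m ω => a ℓ m ω + b ℓ m ω) (fun x ω => U x ω + V x ω) := by
  refine ⟨hU.1.add hV.1, hU.2.1.add hV.2.1, ?_⟩
  have h := hU.2.2.add hV.2.2
  rw [add_zero] at h
  refine tendsto_of_tendsto_of_tendsto_of_le_of_le tendsto_const_nhds h (fun _ => zero_le)
    fun L => ?_
  have e : (fun p : Ω × S2 => partialSum (fun ℓ m ω => a ℓ m ω + b ℓ m ω) L p.2 p.1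
        - ((U p.2 p.1 + V p.2 p.1 : ℝ) : ℂ))
      = (fun p : Ω × S2 => partialSum a L p.2 p.1 - (U p.2 p.1 : ℂ))
        + fun p : Ω × S2 => partialSum b L p.2 p.1 - (V p.2 p.1 : ℂ) := by
    funext p
    simp only [partialSum, add_mul, Finset.sum_add_distrib, Pi.add_apply]
    push_cast
    ring
  have hc : ∀ {F : S2 → Ω → ℝ}, IsRandomField F →
      AEStronglyMeasurable (fun p : Ω × S2 => (F p.2 p.1 : ℂ)) (P.prod sphereMeasure) :=
    fun hF => (Complex.measurable_ofReal.comp hF).aestronglyMeasurable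
  simp only [e]
  exact eLpNorm_add_le ((ha L).sub (hc hU.1)) ((hb L).sub (hc hV.1)) one_le_two

variable {α τ t : ℝ}

theorem mittagLeffler_eigenvalue_mem_Icc (h0 : 0 < α) (h1 : α ≤ 1) (ℓ : ℕ) {r : ℝ} (hr : 0 ≤ r) :
    mittagLeffler α (-eigenvalue ℓ * r ^ α) ∈ Set.Icc 0 1 := by
  rw [neg_mul]
  refine mittagLeffler_neg_mem_Icc h0 h1 (mul_nonneg ?_ (Real.rpow_nonneg hr α))
  rw [eigenvalue]
  positivity

theorem isSpectralFamily_homCoeff [IsProbabilityMeasure P] (h0 : 0 < α) (h1 : α ≤ 1)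
    (ht : 0 ≤ t) {ξ : S2 → Ω → ℝ} (hξ : IsRandomField ξ) (hs : IsSquareIntegrable P ξ)
    (hi : IsTwoWeaklyIsotropic P ξ)
    (hC : Summable fun ℓ : ℕ => (2 * (ℓ : ℝ) + 1) * angularPowerSpectrum P ξ ℓ) :
    IsSpectralFamily P (homCoeff α t ξ) fun ℓ =>
      angularPowerSpectrum P ξ ℓ * mittagLeffler α (-eigenvalue ℓ * t ^ α) ^ 2 where
  memLp ℓ m _ := (memLp_randomCoeff hξ hs ℓ m).const_mul _
  cov ℓ ℓ' m m' hm hm' := by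
    have e : ∀ ω, homCoeff α t ξ ℓ m ω * conj (homCoeff α t ξ ℓ' m' ω)
        = ((mittagLeffler α (-eigenvalue ℓ * t ^ α) : ℂ) *
            (mittagLeffler α (-eigenvalue ℓ' * t ^ α) : ℂ)) *
          (randomCoeff ξ ℓ m ω * conj (randomCoeff ξ ℓ' m' ω)) := fun ω => by
      simp only [homCoeff, map_mul, Complex.conj_ofReal]; ring
    simp only [e]
    rw [integral_const_mul, randomCoeff_cov hξ hs hi hm hm']
    split_ifs with h
    · rw [← h.1]; push_cast; ring
    · rw [mul_zero]
  real ℓ m _ := Eventually.of_forall fun ω => by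
    simp only [homCoeff, randomCoeff, sphericalCoeff_neg, map_mul, Complex.conj_ofReal]; ring
  summable := by
    have hC0 : ∀ ℓ, 0 ≤ angularPowerSpectrum P ξ ℓ := fun ℓ =>
      integral_nonneg fun ω => sq_nonneg _
    refine Summable.of_nonneg_of_le (fun ℓ => ?_) (fun ℓ => ?_) hC
    · have := hC0 ℓ
      positivity
    · have hm := mittagLeffler_eigenvalue_mem_Icc h0 h1 ℓ ht
      refine mul_le_mul_of_nonneg_left ?_ (by positivity)
      exact mul_le_of_le_one_right (hC0 ℓ) (pow_le_one₀ hm.1 hm.2)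

/-- Continuity holds on the whole line, also beyond `T`, because `Real.rpow` with a fixed positive
exponent is continuous. -/
theorem continuous_relaxation (h0 : 0 < α) (h1 : α ≤ 1) (ℓ : ℕ) (T : ℝ) :
    Continuous fun s => mittagLeffler α (-eigenvalue ℓ * (T - s) ^ α) :=
  (continuous_mittagLeffler h0 h1).comp (continuous_const.mul
    ((Real.continuous_rpow_const h0.le).comp (continuous_const.sub continuous_id)))

theorem memLp_relaxation (h0 : 0 < α) (h1 : α ≤ 1) (ℓ : ℕ) (T : ℝ) :
    MemLp (fun s => mittagLeffler α (-eigenvalue ℓ * (T - s) ^ α)) 2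
      (volume.restrict (Set.Icc 0 T)) := by
  refine MemLp.of_bound (continuous_relaxation h0 h1 ℓ T).aestronglyMeasurable 1 ?_
  filter_upwards [ae_restrict_mem measurableSet_Icc] with s hs
  have := mittagLeffler_eigenvalue_mem_Icc h0 h1 ℓ (sub_nonneg.2 hs.2)
  rw [Real.norm_eq_abs, abs_of_nonneg this.1]
  exact this.2

theorem integral_relaxation_sq (ℓ : ℕ) {T : ℝ} (hT : 0 ≤ T) :
    ∫ s in Set.Icc 0 T, mittagLeffler α (-eigenvalue ℓ * (T - s) ^ α) *
      mittagLeffler α (-eigenvalue ℓ * (T - s) ^ α) = sigmaSq ℓ T α := by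
  rw [integral_Icc_eq_integral_Ioc, ← intervalIntegral.integral_of_le hT, sigmaSq]
  have := intervalIntegral.integral_comp_sub_left (a := 0) (b := T)
    (fun r => mittagLeffler α (-eigenvalue ℓ * r ^ α) ^ 2) T
  rw [sub_self, sub_zero] at this
  simp only [← sq]
  exact this

theorem sigmaSq_mem_Icc (h0 : 0 < α) (h1 : α ≤ 1) (ℓ : ℕ) {T : ℝ} (hT : 0 ≤ T) :
    sigmaSq ℓ T α ∈ Set.Icc 0 T := by
  have hm : ∀ r ∈ Set.Icc 0 T, mittagLeffler α (-eigenvalue ℓ * r ^ α) ∈ Set.Icc 0 1 :=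
    fun r hr => mittagLeffler_eigenvalue_mem_Icc h0 h1 ℓ hr.1
  have hc : Continuous fun r => mittagLeffler α (-eigenvalue ℓ * r ^ α) ^ 2 :=
    ((continuous_mittagLeffler h0 h1).comp (continuous_const.mul
      (Real.continuous_rpow_const h0.le))).pow 2
  refine ⟨intervalIntegral.integral_nonneg hT fun r _ => sq_nonneg _, ?_⟩
  have := intervalIntegral.integral_mono_on hT (hc.intervalIntegrable (μ := volume) 0 T)
    (continuous_const.intervalIntegrable (μ := volume) (u := fun _ : ℝ => (1 : ℝ)) 0 T)
    fun r hr => pow_le_one₀ (hm r hr).1 (hm r hr).2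
  simpa [sigmaSq] using this

variable {Q : L2S →L[ℝ] L2S} {A : ℕ → ℝ} {W : ℝ → Ω → L2S}

theorem isWienerIntegral_inhomCoeff (h0 : 0 < α) (h1 : α ≤ 1) (ht : τ < t)
    (hW : IsQWiener P τ Q W) (hQ : HasHarmonicSpectrum Q A) {ℓ : ℕ} {m : ℤ}
    (hm : m ∈ Finset.Icc (-(ℓ : ℤ)) ℓ) :
    IsWienerIntegral P (t - τ) (fun s => mittagLeffler α (-eigenvalue ℓ * (t - τ - s) ^ α))
      (noiseCoeff τ W ℓ m) (inhomCoeff P α τ t W ℓ m) := by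
  have e : inhomCoeff P α τ t W ℓ m = wienerIntegral P (t - τ)
      (fun s => mittagLeffler α (-eigenvalue ℓ * (t - τ - s) ^ α)) (noiseCoeff τ W ℓ m) :=
    funext fun ω => if_neg (not_le.2 ht)
  rw [e]
  exact isWienerIntegral_wienerIntegral ((hW.hasBrownianCov hQ hm hm).exists_isWienerIntegral
    (sub_pos.2 ht) (continuous_relaxation h0 h1 ℓ _) (memLp_relaxation h0 h1 ℓ _))

theorem inhomCoeff_of_le (ht : t ≤ τ) (ℓ : ℕ) (m : ℤ) : inhomCoeff P α τ t W ℓ m = fun _ => 0 :=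
  funext fun _ => if_pos ht

theorem isSpectralFamily_inhomCoeff (h0 : 0 < α) (h1 : α ≤ 1)
    (hW : IsQWiener P τ Q W) (hQ : HasHarmonicSpectrum Q A) (hA0 : ∀ ℓ, 0 ≤ A ℓ)
    (hA : Summable fun ℓ : ℕ => (2 * (ℓ : ℝ) + 1) * A ℓ) :
    IsSpectralFamily P (inhomCoeff P α τ t W) fun ℓ =>
      if t ≤ τ then 0 else A ℓ * sigmaSq ℓ (t - τ) α := by
  by_cases ht : t ≤ τ
  · simp only [if_pos ht]
    refine ⟨fun ℓ m _ => ?_, fun ℓ ℓ' m m' _ _ => ?_, fun ℓ m _ => ?_, ?_⟩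
    · rw [inhomCoeff_of_le ht]; exact MemLp.zero
    · simp [inhomCoeff_of_le ht]
    · simp [inhomCoeff_of_le ht]
    · simp
  · simp only [if_neg ht]
    rw [not_le] at ht
    have hX := fun {ℓ : ℕ} {m : ℤ} (hm : m ∈ Finset.Icc (-(ℓ : ℤ)) ℓ) =>
      isWienerIntegral_inhomCoeff h0 h1 ht hW hQ hm
    have hL := fun ℓ => memLp_relaxation h0 h1 ℓ (t - τ)
    refine ⟨fun ℓ m hm => (hX hm).1, fun ℓ ℓ' m m' hm hm' => ?_, fun ℓ m hm => ?_, ?_⟩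
    · rw [(hW.hasBrownianCov hQ hm hm').integral_wiener (hL ℓ) (hL ℓ') (hX hm) (hX hm')]
      split_ifs with h
      · rw [← h.1, integral_relaxation_sq ℓ (sub_pos.2 ht).le]
        push_cast
        ring
      · simp
    -- The integrals for `m` and `-m` are chosen independently of each other, so the conjugation
    -- relation can hold only almost surely, by uniqueness of the Wiener integral.
    · have hm' : -m ∈ Finset.Icc (-(ℓ : ℤ)) ℓ := by
        rw [Finset.mem_Icc] at hm ⊢; omega
      exact (hW.hasBrownianCov hQ hm' hm').ae_eq_of_isWienerIntegral (hL ℓ) (hX hm')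
        ((hX hm).conj (by simp) (noiseCoeff_neg τ W ℓ m))
    · refine Summable.of_nonneg_of_le (fun ℓ => ?_) (fun ℓ => ?_) (hA.mul_right (t - τ))
      · have h2 := hA0 ℓ
        have h3 := (sigmaSq_mem_Icc h0 h1 ℓ (sub_pos.2 ht).le).1
        positivity
      · rw [← mul_assoc]
        refine mul_le_mul_of_nonneg_left (sigmaSq_mem_Icc h0 h1 ℓ (sub_pos.2 ht).le).2 ?_
        have h2 := hA0 ℓ
        positivity

/-! ### Joint behaviour of the initial field and the noise. -/

section Independence

variable {ξ : S2 → Ω → ℝ}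

theorem measurable_inner_eval (τ : ℝ) (p : Set.Ici τ × L2S) :
    Measurable fun w : Set.Ici τ → L2S => inner ℝ p.2 (w p.1) :=
  (continuous_const.inner continuous_id).measurable.comp (measurable_pi_apply p.1)

theorem integral_mul_inner_eq_zero (hW : IsQWiener P τ Q W) (hc : IsCentred P ξ)
    (hindep : IndepFun (fun ω (x : S2) => ξ x ω) (fun ω (s : Set.Ici τ) => W s ω) P)
    (x : S2) {s : ℝ} (hs : τ ≤ s) (f : L2S) : ∫ ω, ξ x ω * inner ℝ f (W s ω) ∂P = 0 := by
  have hi : IndepFun (ξ x) (fun ω => inner ℝ f (W s ω)) P :=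
    hindep.comp (φ := fun w : S2 → ℝ => w x) (measurable_pi_apply x)
      (measurable_inner_eval τ (⟨s, hs⟩, f))
  rw [hi.integral_fun_mul_eq_mul_integral (hc x).1.1 (hW.memLp_inner hs f).1, (hc x).2, zero_mul]

/-- Fubini reduces the claim to single values `ξ x`, which are orthogonal to the noise by
independence and centredness, and therefore to its Wiener integrals. -/
theorem integral_homCoeff_mul_conj_inhomCoeff [IsProbabilityMeasure P] (h0 : 0 < α) (h1 : α ≤ 1)
    (hs : IsSquareIntegrable P ξ) (hi : IsTwoWeaklyIsotropic P ξ) (hc : IsCentred P ξ)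
    (hW : IsQWiener P τ Q W) (hQ : HasHarmonicSpectrum Q A)
    (hindep : IndepFun (fun ω (x : S2) => ξ x ω) (fun ω (s : Set.Ici τ) => W s ω) P)
    (ℓ ℓ' : ℕ) (m m' : ℤ) (hm' : m' ∈ Finset.Icc (-(ℓ' : ℤ)) ℓ') :
    ∫ ω, homCoeff α t ξ ℓ m ω * conj (inhomCoeff P α τ t W ℓ' m' ω) ∂P = 0 := by
  by_cases ht : t ≤ τ
  · simp [inhomCoeff_of_le ht]
  · rw [not_le] at ht
    have hX := isWienerIntegral_inhomCoeff h0 h1 ht hW hQ hm'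
    have hxi : ∀ x, ∫ ω, (ξ x ω : ℂ) * conj (inhomCoeff P α τ t W ℓ' m' ω) ∂P = 0 := by
      intro x
      refine hX.integral_mul_conj_eq_zero (fun s hs => hW.memLp_noiseCoeff ℓ' m' hs)
        (Z := fun ω => (ξ x ω : ℂ)) (hi.1 x).ofReal fun s hs => ?_
      have hts : τ ≤ τ + s := by linarith
      have e : ∀ ω, (ξ x ω : ℂ) * conj (noiseCoeff τ W ℓ' m' s ω)
          = ((ξ x ω * inner ℝ (harmonicRe ℓ' m') (W (τ + s) ω) : ℝ) : ℂ)
            + Complex.I * ((ξ x ω * inner ℝ (harmonicIm ℓ' m') (W (τ + s) ω) : ℝ) : ℂ) := by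
        intro ω
        rw [noiseCoeff_eq]
        simp only [map_sub, map_mul, Complex.conj_ofReal, Complex.conj_I]
        push_cast
        ring
      have hI : ∀ f : L2S, Integrable (fun ω => ξ x ω * inner ℝ f (W (τ + s) ω)) P := fun f =>
        MemLp.integrable_mul (hi.1 x) (hW.memLp_inner hts f)
      simp only [e]
      rw [integral_add (hI _).ofReal ((hI _).ofReal.const_mul _), integral_const_mul,
        integral_complex_ofReal, integral_complex_ofReal,
        integral_mul_inner_eq_zero hW hc hindep x hts,
        integral_mul_inner_eq_zero hW hc hindep x hts]
      simp
    have e : ∀ ω, homCoeff α t ξ ℓ m ω * conj (inhomCoeff P α τ t W ℓ' m' ω)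
        = (mittagLeffler α (-eigenvalue ℓ * t ^ α) : ℂ) *
          (randomCoeff ξ ℓ m ω * conj (inhomCoeff P α τ t W ℓ' m' ω)) := fun ω => by
      rw [homCoeff, mul_assoc]
    simp only [e]
    rw [integral_const_mul, integral_randomCoeff_mul_conj hs hX.1]
    simp [hxi]

/-- The initial field and the noise generate a closed Gaussian subspace of `L²(Ω)`. -/
theorem exists_isGaussianSubspace [IsProbabilityMeasure P] (hg : IsGaussianProcess ξ P)
    (hc : IsCentred P ξ)
    (hi : IsTwoWeaklyIsotropic P ξ) (hW : IsQWiener P τ Q W)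
    (hindep : IndepFun (fun ω (x : S2) => ξ x ω) (fun ω (s : Set.Ici τ) => W s ω) P) :
    ∃ H : Submodule ℝ (Lp ℝ 2 P), IsGaussianSubspace H ∧ IsClosed (H : Set (Lp ℝ 2 P)) ∧
      (∀ x, InSpace H (ξ x)) ∧
      ∀ s, τ ≤ s → ∀ f : L2S, InSpace H (fun ω => inner ℝ f (W s ω)) := by
  have hZ := isGaussianProcess_sumElim hg hW.isGaussianProcess
    (hindep.comp (φ := id) (ψ := fun (w : Set.Ici τ → L2S) (p : Set.Ici τ × L2S) =>
      inner ℝ p.2 (w p.1)) measurable_id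
      (measurable_pi_lambda _ fun p => measurable_inner_eval τ p))
  have h2 : ∀ i,
      MemLp (Sum.elim ξ (fun (p : Set.Ici τ × L2S) ω => inner ℝ p.2 (W p.1 ω)) i) 2 P := by
    rintro (x | p)
    · exact hi.1 x
    · exact hW.memLp_inner p.1.2 p.2
  have h0 : ∀ i, ∫ ω, Sum.elim ξ (fun (p : Set.Ici τ × L2S) ω => inner ℝ p.2 (W p.1 ω)) i ω ∂P
      = 0 := by
    rintro (x | p)
    · exact (hc x).2
    · exact hW.integral_inner p.1.2 p.2
  refine ⟨_, (isGaussianSubspace_span hZ h2 h0).topologicalClosure,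
    Submodule.isClosed_topologicalClosure _, fun x => ⟨hi.1 x, ?_⟩,
    fun s hs f => ⟨hW.memLp_inner hs f, ?_⟩⟩
  · exact Submodule.le_topologicalClosure _ (Submodule.subset_span ⟨Sum.inl x, rfl⟩)
  · exact Submodule.le_topologicalClosure _
      (Submodule.subset_span ⟨Sum.inr (⟨s, hs⟩, f), rfl⟩)

end Independence

/-! ### Gaussianity and isotropy of the sum of the expansion. -/

section GaussianSum

variable {a : ℕ → ℤ → Ω → ℂ} {H : Submodule ℝ (Lp ℝ 2 P)} {V : S2 → Ω → ℝ}

/-- `V` is real, so `V x` is the limit of the real parts of the partial sums, which are real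
combinations of real and imaginary parts of the coefficients. -/
theorem inSpace_of_isPointwiseSum (hH : IsClosed (H : Set (Lp ℝ 2 P)))
    (ha : ∀ (ℓ : ℕ) (m : ℤ), m ∈ Finset.Icc (-(ℓ : ℤ)) ℓ →
      InSpace H (fun ω => (a ℓ m ω).re) ∧ InSpace H (fun ω => (a ℓ m ω).im))
    (hV : IsPointwiseSum P a V) (x : S2) : InSpace H (V x) := by
  refine InSpace.of_tendsto hH (F := fun L ω => (partialSum a L x ω).re) (fun L => ?_)
    (hV.1.comp measurable_prodMk_right).aestronglyMeasurable ?_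
  · refine (InSpace.sum (Finset.range (L + 1)) fun ℓ _ =>
      InSpace.sum (Finset.Icc (-(ℓ : ℤ)) ℓ) fun m hm =>
        ((ha ℓ m hm).1.const_mul (sphericalHarmonic ℓ m x).re).sub
          ((ha ℓ m hm).2.const_mul (sphericalHarmonic ℓ m x).im)).congr
      (Eventually.of_forall fun ω => ?_)
    simp only [partialSum, Complex.re_sum, Complex.mul_re]
    exact Finset.sum_congr rfl fun ℓ _ => Finset.sum_congr rfl fun m _ => by ring
  · refine tendsto_of_tendsto_of_tendsto_of_le_of_le tendsto_const_nhds (hV.2 x)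
      (fun _ => zero_le) fun L => eLpNorm_mono fun ω => ?_
    simpa using Complex.abs_re_le_norm (partialSum a L x ω - (V x ω : ℂ))

theorem IsGaussianSubspace.integral_complex_eq_zero [IsProbabilityMeasure P]
    (hG : IsGaussianSubspace H) {X : Ω → ℂ} (hX : Integrable X P)
    (h1 : InSpace H (fun ω => (X ω).re)) (h2 : InSpace H (fun ω => (X ω).im)) :
    ∫ ω, X ω ∂P = 0 := by
  apply Complex.ext
  · exact (Complex.reCLM.integral_comp_comm hX).symm.trans (hG.integral_eq_zero h1)
  · exact (Complex.imCLM.integral_comp_comm hX).symm.trans (hG.integral_eq_zero h2)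

theorem IsSpectralFamily.isGaussian_isotropic [IsProbabilityMeasure P] {v : ℕ → ℝ}
    (h : IsSpectralFamily P a v) (hG : IsGaussianSubspace H) (hV : IsPointwiseSum P a V)
    (hmem : ∀ x, InSpace H (V x)) :
    IsGaussianProcess V P ∧ IsCentred P V ∧ IsTwoWeaklyIsotropic P V ∧
      IsStronglyIsotropic P V := by
  have h0 : ∀ x, ∫ ω, V x ω ∂P = 0 := fun x => hG.integral_eq_zero (hmem x)
  refine ⟨hG.isGaussianProcess hmem, fun x => ⟨(hmem x).1.integrable one_le_two, h0 x⟩,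
    ⟨fun x => (hmem x).1, fun R _ => ⟨fun x => by rw [h0, h0], h.integral_mul_rotate hV R⟩⟩, ?_⟩
  intro R _ k x
  exact hG.map_pi_eq (fun i => hmem (x i)) (fun i => hmem (rotate R (x i)))
    fun i j => h.integral_mul_rotate hV R (x i) (x j)

end GaussianSum

end Solution

end SphereDiffusion

/-! ### The main theorem. -/

open SphereDiffusion in
theorem proposition5p1 {Ω : Type*} [MeasurableSpace Ω] (P : Measure Ω) [IsProbabilityMeasure P]
    (α τ t : ℝ) (hα : α ∈ Set.Ioc (0 : ℝ) 1) (hτ : 0 < τ) (ht : 0 < t)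
    -- the initial field
    (ξ : S2 → Ω → ℝ) (hξ_field : IsRandomField ξ) (hξ_sq : IsSquareIntegrable P ξ)
    (hξ_gauss : IsGaussianProcess ξ P) (hξ_centred : IsCentred P ξ)
    (hξ_iso : IsTwoWeaklyIsotropic P ξ)
    (hC : Summable fun ℓ : ℕ => (2 * (ℓ : ℝ) + 1) * angularPowerSpectrum P ξ ℓ)
    -- the noise
    (Q : L2S →L[ℝ] L2S) (A : ℕ → ℝ) (W : ℝ → Ω → L2S) (hW : IsQWiener P τ Q W)
    (hQ : HasHarmonicSpectrum Q A) (hA_nonneg : ∀ ℓ, 0 ≤ A ℓ)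
    (hA : Summable fun ℓ : ℕ => (2 * (ℓ : ℝ) + 1) * A ℓ)
    -- independence of the initial field and the noise
    (hindep : IndepFun (fun ω (x : S2) => ξ x ω) (fun ω (s : Set.Ici τ) => W s ω) P) :
    -- both series converge in the square mean to random fields
    (∃ UH UI : S2 → Ω → ℝ,
      IsL2Sum P (homCoeff α t ξ) UH ∧ IsL2Sum P (inhomCoeff P α τ t W) UI) ∧
    ∀ UH UI : S2 → Ω → ℝ,
      IsL2Sum P (homCoeff α t ξ) UH → IsL2Sum P (inhomCoeff P α τ t W) UI →
      ∀ U : S2 → Ω → ℝ, (U = fun x ω => UH x ω + UI x ω) →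
        -- the field has a version that is defined at every point by its expansion
        (∃ V, IsPointwiseSum P
            (fun ℓ m ω => homCoeff α t ξ ℓ m ω + inhomCoeff P α τ t W ℓ m ω) V) ∧
        -- any such version is a version of the field, Gaussian, centred and isotropic
        (∀ V, IsPointwiseSum P
            (fun ℓ m ω => homCoeff α t ξ ℓ m ω + inhomCoeff P α τ t W ℓ m ω) V →
          (∀ᵐ p ∂(P.prod sphereMeasure), V p.2 p.1 = U p.2 p.1) ∧
          IsSquareIntegrable P V ∧ IsGaussianProcess V P ∧ IsCentred P V ∧
          IsTwoWeaklyIsotropic P V ∧ IsStronglyIsotropic P V) ∧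
        -- the random coefficients
        (∀ (ℓ : ℕ) (m : ℤ), m ∈ Finset.Icc (-(ℓ : ℤ)) ℓ →
          (∀ᵐ ω ∂P, randomCoeff U ℓ m ω =
            if t ≤ τ then homCoeff α t ξ ℓ m ω
            else homCoeff α t ξ ℓ m ω + inhomCoeff P α τ t W ℓ m ω) ∧
          MemLp (randomCoeff U ℓ m) 2 P ∧ ∫ ω, randomCoeff U ℓ m ω ∂P = 0) ∧
        -- their covariances
        ∀ (ℓ ℓ' : ℕ) (m m' : ℤ), m ∈ Finset.Icc (-(ℓ : ℤ)) ℓ → m' ∈ Finset.Icc (-(ℓ' : ℤ)) ℓ' →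
          ∫ ω, randomCoeff U ℓ m ω * conj (randomCoeff U ℓ' m' ω) ∂P =
            if ℓ = ℓ' ∧ m = m' then
              ((if t ≤ τ then
                  angularPowerSpectrum P ξ ℓ * mittagLeffler α (-eigenvalue ℓ * t ^ α) ^ 2
                else
                  angularPowerSpectrum P ξ ℓ * mittagLeffler α (-eigenvalue ℓ * t ^ α) ^ 2 +
                    A ℓ * sigmaSq ℓ (t - τ) α : ℝ) : ℂ)
            else 0 := by
  obtain ⟨h0, h1⟩ := hα
  have hH := isSpectralFamily_homCoeff h0 h1 ht.le hξ_field hξ_sq hξ_iso hC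
  have hI := isSpectralFamily_inhomCoeff (t := t) h0 h1 hW hQ hA_nonneg hA
  -- The two families are mutually uncorrelated, so their power spectra add.
  have hS := hH.add hI fun ℓ ℓ' m m' _ hm' => integral_homCoeff_mul_conj_inhomCoeff h0 h1 hξ_sq
    hξ_iso hξ_centred hW hQ hindep ℓ ℓ' m m' hm'
  obtain ⟨H, hG, hHc, hHξ, hHW⟩ := exists_isGaussianSubspace hξ_gauss hξ_centred hξ_iso hW hindep
  -- Both summands lie in the common Gaussian subspace, so their sum does; separate Gaussianity of
  -- the two parts would not suffice.
  have hmem : ∀ (ℓ : ℕ) (m : ℤ), m ∈ Finset.Icc (-(ℓ : ℤ)) ℓ →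
      InSpace H (fun ω => (homCoeff α t ξ ℓ m ω + inhomCoeff P α τ t W ℓ m ω).re) ∧
      InSpace H (fun ω => (homCoeff α t ξ ℓ m ω + inhomCoeff P α τ t W ℓ m ω).im) := by
    intro ℓ m hm
    obtain ⟨r1, r2⟩ := inSpace_randomCoeff hξ_field hξ_sq hHc hHξ ℓ m
    have hI' : InSpace H (fun ω => (inhomCoeff P α τ t W ℓ m ω).re) ∧
        InSpace H (fun ω => (inhomCoeff P α τ t W ℓ m ω).im) := by
      by_cases htτ : t ≤ τ
      · rw [inhomCoeff_of_le htτ]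
        exact ⟨InSpace.zero, InSpace.zero⟩
      · exact (isWienerIntegral_inhomCoeff h0 h1 (not_le.1 htτ) hW hQ hm).inSpace hHc
          fun s hs => IsQWiener.inSpace_noiseCoeff hHW ℓ m hs
    refine ⟨((r1.const_mul (mittagLeffler α (-eigenvalue ℓ * t ^ α))).add hI'.1).congr
      (Eventually.of_forall fun ω => ?_),
      ((r2.const_mul (mittagLeffler α (-eigenvalue ℓ * t ^ α))).add hI'.2).congr
      (Eventually.of_forall fun ω => ?_)⟩
    · simp [homCoeff]
    · simp [homCoeff]
  refine ⟨?_, ?_⟩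
  · obtain ⟨UH, -, hUH⟩ := hH.exists_isPointwiseSum_isL2Sum
    obtain ⟨UI, -, hUI⟩ := hI.exists_isPointwiseSum_isL2Sum
    exact ⟨UH, UI, hUH, hUI⟩
  rintro UH UI hUH hUI U rfl
  have hU := hUH.add hUI (fun L => (hH.memLp_partialSum_prod L).1)
    fun L => (hI.memLp_partialSum_prod L).1
  have hcoeff := fun {ℓ : ℕ} {m : ℤ} (hm : m ∈ Finset.Icc (-(ℓ : ℤ)) ℓ) =>
    hS.randomCoeff_ae_eq hU hm
  refine ⟨?_, fun V hV => ?_, fun ℓ m hm => ⟨?_, ?_, ?_⟩, fun ℓ ℓ' m m' hm hm' => ?_⟩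
  · obtain ⟨V, hV, -⟩ := hS.exists_isPointwiseSum_isL2Sum
    exact ⟨V, hV⟩
  · have hae := hS.ae_eq_of_isPointwiseSum_of_isL2Sum hV hU
    exact ⟨hae, (memLp_congr_ae hae).2 hU.2.1, hS.isGaussian_isotropic hG hV
      (inSpace_of_isPointwiseSum hHc hmem hV)⟩
  · filter_upwards [hcoeff hm] with ω hω
    rw [hω]
    split_ifs with h
    · rw [inhomCoeff_of_le h, add_zero]
    · rfl
  · exact (memLp_congr_ae (hcoeff hm)).2 (hS.memLp ℓ m hm)
  · rw [integral_congr_ae (hcoeff hm)]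
    exact hG.integral_complex_eq_zero ((hS.memLp ℓ m hm).integrable one_le_two)
      (hmem ℓ m hm).1 (hmem ℓ m hm).2
  · have e : ∫ ω, randomCoeff (fun x ω => UH x ω + UI x ω) ℓ m ω *
        conj (randomCoeff (fun x ω => UH x ω + UI x ω) ℓ' m' ω) ∂P
        = ∫ ω, (homCoeff α t ξ ℓ m ω + inhomCoeff P α τ t W ℓ m ω) *
          conj (homCoeff α t ξ ℓ' m' ω + inhomCoeff P α τ t W ℓ' m' ω) ∂P := by
      refine integral_congr_ae ?_
      filter_upwards [hcoeff hm, hcoeff hm'] with ω h2 h3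
      rw [h2, h3]
    rw [e, hS.cov ℓ ℓ' m m' hm hm']
    split_ifs <;> simp
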